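/- Let $M\ge 2$ be an integer, $L>0$, $\ell\in\mathbb R$. Let $\psi_1,\psi_M:\mathbb R\to[0,+\infty)$, where $\psi_M$ is strictly convex and $C^1$, and $\psi_1=\min\{W_1,W_2\}$ with $W_1,W_2:\mathbb R\to\mathbb R$ strictly convex and $W_i(z)\ge cz^2-\frac1c$ for all $z$, for some $c>0$. Put $$\psi_0(z)=\psi_M(z)+\frac1M\min\Big\{\sum_{k=1}^M\psi_1(z_k):\ \sum_{k=1}^M z_k=Mz\Big\},$$ and let $\psi_0^{**}$ be its biconjugate (convex envelope). For $\alpha\in\mathbb R$ let $\mathbf M^\alpha\subset\mathbb R^M$ be the set of minimizers of $\sum_k\psi_1(z_k)$ subject to $\sum_k z_k=M\alpha$. Let $\mathbf M_\alpha=\mathbf M^\alpha$ if $\alpha$ is interior to $\{\psi_0=\psi_0^{**}\}$; otherwise let $\mathbf M_\alpha$ be the union of the $\mathbf M^\beta$ over all $\beta$ with $\psi_0(\beta)=\psi_0^{**}(\beta)$ in the maximal interval containing $\alpha$ on which $\psi_0^{**}$ is affine. Assume that $\psi_0^{**}$ is differentiable at $\ell/L$, and that $\psi_1$ is of class $C^1$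 in a neighbourhood of every entry of every element of $\mathbf M_{\ell/L}$. Let $r$ be the tangent line to $\psi_0^{**}$ at $\ell/L$. *Discrete energies.* For $n\ge1$ let $\varepsilon_n=L/n$. Let $W^{1,1}_{\#,\ell}(0,L)$ be the set of $u\in W^{1,1}_{\rm loc}(\mathbb R)$ such that $u(t)-\frac{\ell}{L}t$ is $L$-periodic, and $\mathcal A^\#_{n,\ell}(0,L)$ the set of those that are moreover continuous on $[0,L]$ and affine on each $(i\varepsilon_n,(i+1)\varepsilon_n)$, $0\le i<n$. With $u_i=u(i\varepsilon_n)$, $i\in\mathbb Z$, let $$E^\ell_{n,M}(u)=\sum_{i=0}^{n-1}\varepsilon_n\psi_1\Big(\frac{u_{i+1}-u_i}{\varepsilon_n}\Big)+\sum_{i=0}^{n-1}\varepsilon_n\psi_M\Big(\frac{u_{i+M}-u_i}{M\varepsilon_n}\Big)$$ if $u\in\mathcal A^\#_{n,\ell}(0,L)$ and $E^\ell_{n,M}(u)=+\infty$ otherwise, let $E^\ell_M(u)=\int_0^L\psi_0^{**}(u')\,dt$ for $u\in W^{1,1}_{\#,\ell}(0,L)$, and $$E^1_{n,M}(u)=\frac{E^\ell_{n,M}(u)-\min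 E^\ell_M}{\varepsilon_n}.$$ *Convergence.* For $k=1,\dots,M$ the $k$-th $M$-interpolation $u_k$ of $u$ is the continuous piecewise-affine function with $u_k(0)=u_0$ and $u_k'=\frac{u_{Mi+k}-u_{Mi+k-1}}{\varepsilon_n}$ on $(iM\varepsilon_n,(i+1)M\varepsilon_n)$, $i\in\mathbb Z$. We say that $u^n\to\mathbf u=(\mathbf u_1,\dots,\mathbf u_M)$ if $u^n_k\to\mathbf u_k$ in $L^\infty(0,L)$ for every $k$. *Transition energy.* For $\mathbf z\in\mathbb R^M$ let $u_{\mathbf z}$ be the continuous function with $u_{\mathbf z}(0)=0$ and slope $z_k$ on $(k-1,k)+M\mathbb Z$, $k=1,\dots,M$. For $\mathbf z,\mathbf z'\in\mathbf M_{\ell/L}$ let $$\Phi^{(\ell/L)}(\mathbf z,\mathbf z')=\inf_{N\in\mathbb N}\ \inf_v\ \sum_{i\in\mathbb Z}\Big(\psi_M\Big(\frac{v_{i+M}-v_i}{M}\Big)+\frac1M\sum_{k=0}^{M-1}\psi_1(v_{i+k+1}-v_{i+k})-r\Big(\frac{v_{i+M}-v_i}{M}\Big)\Big),$$ where $v$ ranges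 over the functions $\mathbb Z\to\mathbb R$ with $v_i=u_{\mathbf z}(i)$ for $i\le -N$ and $v_i=u_{\mathbf z'}(i)$ for $i\ge N$. *Limit.* Fix $q\in\{0,\dots,M-1\}$. Let $D_q^\#$ be the set of continuous, (locally) piecewise-affine $\mathbf u:\mathbb R\to\mathbb R^M$, with $S(\mathbf u')$ the jump set of $\mathbf u'$, such that $\mathbf u_1(0)=\dots=\mathbf u_M(0)$; $\mathbf u'(t)\in\mathbf M_{\ell/L}$ for all $t\notin S(\mathbf u')$; $S(\mathbf u')\cap(0,L]$ is finite; $\sum_{k=1}^M\mathbf u_k(t)-M\frac{\ell}{L}t$ is $L$-periodic; and $\mathbf u_k'(t)=\mathbf u'_{k+q}(t+L)$ for every $k$, with $k+q$ taken modulo $M$, and every $t$ with $t,\,t+L\notin S(\mathbf u')$. **Theorem.** As $n\to+\infty$ with $n\equiv q$ mod $M$, the functionals $E^1_{n,M}$ $\Gamma$-converge, with respect to the convergence above, to the functional on $L^\infty((0,L);\mathbb R^M)$ with value $$E^1_q(\mathbf u)=\sum_{t\in S(\mathbf u')\cap(0,L]}\Phi^{(\ell/L)}\big(\mathbf u'(t-),\mathbf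 u'(t+)\big)$$ at the restriction to $(0,L)$ of any $\mathbf u\in D_q^\#$ (which is determined by this restriction), and $+\infty$ at all other elements. That is: $\liminf_n E^1_{n,M}(u^n)$ is at least the value of the limit functional at $\mathbf u$ whenever $u^n\to\mathbf u$, and for every $\mathbf u\in D_q^\#$ there is a sequence $u^n\to\mathbf u$ with $\limsup_n E^1_{n,M}(u^n)\le E^1_q(\mathbf u)$. -/

import Mathlib

open Filter Topology MeasureTheory Set

namespace LatticeGamma

noncomputable section

/-! ### Convex duality -/

/-- The Legendre-Fenchel conjugate of a real function, `f*(p) = sup_x (p x - f x)`. It is used for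
functions with superlinear growth only, for which all the suprema are finite. -/
def conjugate (f : ℝ → ℝ) (p : ℝ) : ℝ := ⨆ x : ℝ, (p * x - f x)

/-- The biconjugate `f**`. -/
def biconjugate (f : ℝ → ℝ) : ℝ → ℝ := conjugate (conjugate f)

/-! ### The bulk energy density and the minimal slope patterns -/

/-- The zero-order energy density
`ψ₀ z = ψ_M z + (1/M) min {∑ ψ₁ (z_k) : ∑ z_k = M z}`. -/
def psiZero (M : ℕ) (ψ₁ ψM : ℝ → ℝ) (z : ℝ) : ℝ :=
  ψM z + (1 / (M : ℝ)) *
    sInf {e : ℝ | ∃ w : Fin M → ℝ, ∑ k, w k = M * z ∧ e = ∑ k, ψ₁ (w k)}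

/-- `ψ₀**`. -/
def psiZeroConv (M : ℕ) (ψ₁ ψM : ℝ → ℝ) : ℝ → ℝ := biconjugate (psiZero M ψ₁ ψM)

/-- The tangent line to `ψ₀**` at `α`, evaluated at `x`. -/
def tangentLine (M : ℕ) (ψ₁ ψM : ℝ → ℝ) (α x : ℝ) : ℝ :=
  psiZeroConv M ψ₁ ψM α + deriv (psiZeroConv M ψ₁ ψM) α * (x - α)

/-- `𝐌^α`: the minimizers of `∑ ψ₁ (z_k)` among the `M`-tuples of mean value `α`. -/
def minimizers (M : ℕ) (ψ₁ : ℝ → ℝ) (α : ℝ) : Set (Fin M → ℝ) :=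
  {z | ∑ k, z k = M * α ∧
    ∀ w : Fin M → ℝ, ∑ k, w k = M * α → ∑ k, ψ₁ (z k) ≤ ∑ k, ψ₁ (w k)}

/-- The contact set `{ψ₀ = ψ₀**}`. -/
def contactSet (M : ℕ) (ψ₁ ψM : ℝ → ℝ) : Set ℝ :=
  {z | psiZero M ψ₁ ψM z = psiZeroConv M ψ₁ ψM z}

/-- The maximal interval around `α` on which `ψ₀**` is affine
(it reduces to `{α}` if there is no nondegenerate one). -/
def affineInterval (M : ℕ) (ψ₁ ψM : ℝ → ℝ) (α : ℝ) : Set ℝ :=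
  {β | ∃ a b : ℝ, ∀ x ∈ uIcc α β, psiZeroConv M ψ₁ ψM x = a + b * x}

/-- `𝐌_α`: it is `𝐌^α` if `α` is interior to the contact set, and otherwise the union of the
`𝐌^β` over the contact points `β` in the affine interval of `ψ₀**` that contains `α`. -/
def minimalSlopes (M : ℕ) (ψ₁ ψM : ℝ → ℝ) (α : ℝ) : Set (Fin M → ℝ) :=
  {z | (α ∈ interior (contactSet M ψ₁ ψM) ∧ z ∈ minimizers M ψ₁ α) ∨
    (α ∉ interior (contactSet M ψ₁ ψM) ∧
      ∃ β ∈ affineInterval M ψ₁ ψM α ∩ contactSet M ψ₁ ψM, z ∈ minimizers M ψ₁ β)}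

/-! ### The transition energy -/

/-- The values at the integers of the function `u_z` with `u_z(0) = 0` and slope `z_k` on
`(k - 1, k) + M ℤ`, `k = 1, …, M` (the indices of `z` are counted from `0` here). -/
def profile {M : ℕ} (z : Fin M → ℝ) (i : ℤ) : ℝ :=
  ((i / (M : ℤ) : ℤ) : ℝ) * ∑ k, z k +
    ∑ k ∈ Finset.univ.filter (fun k : Fin M => ((k : ℕ) : ℤ) < i % (M : ℤ)), z k

/-- The renormalized energy of the window `{i, …, i + M}` of a function `v : ℤ → ℝ`. -/
def cellEnergy (M : ℕ) (ψ₁ ψM : ℝ → ℝ) (α : ℝ) (v : ℤ → ℝ) (i : ℤ) : ℝ :=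
  ψM ((v (i + M) - v i) / M)
    + (1 / (M : ℝ)) * ∑ k ∈ Finset.range M, ψ₁ (v (i + k + 1) - v (i + k))
    - tangentLine M ψ₁ ψM α ((v (i + M) - v i) / M)

/-- The transition energy `Φ^(α)(z, z')`. For `z, z' ∈ 𝐌_α` the series has nonnegative terms,
only finitely many of which differ from `0`. -/
def transitionEnergy (M : ℕ) (ψ₁ ψM : ℝ → ℝ) (α : ℝ) (z z' : Fin M → ℝ) : ℝ :=
  ⨅ N : ℕ, sInf {e : ℝ | ∃ v : ℤ → ℝ,
    (∀ i : ℤ, i ≤ -(N : ℤ) → v i = profile z i) ∧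
    (∀ i : ℤ, (N : ℤ) ≤ i → v i = profile z' i) ∧
    e = ∑' i : ℤ, cellEnergy M ψ₁ ψM α v i}

/-! ### The discrete energies -/

/-- `W^{1,1}_{#,ℓ}(0,L)`: the functions of `W^{1,1}_loc(ℝ)` (that is, locally absolutely
continuous) such that `u(t) - (ℓ/L) t` is `L`-periodic. -/
def sobolevPer (L ℓ : ℝ) : Set (ℝ → ℝ) :=
  {u | (∀ a b : ℝ, AbsolutelyContinuousOnInterval u a b) ∧
    Function.Periodic (fun t => u t - ℓ / L * t) L}

/-- The minimum over `W^{1,1}_{#,ℓ}(0,L)` of the bulk limit energy `∫₀ᴸ ψ₀**(u') dt`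
(the integrand is nonnegative). -/
def minBulk (M : ℕ) (ψ₁ ψM : ℝ → ℝ) (L ℓ : ℝ) : ℝ :=
  (⨅ u ∈ sobolevPer L ℓ,
    ∫⁻ t in Ioo 0 L, ENNReal.ofReal (psiZeroConv M ψ₁ ψM (deriv u t))).toReal

/-- The lattice spacing `ε_n = L / n`. -/
def eps (L : ℝ) (n : ℕ) : ℝ := L / n

/-- `𝒜^#_{n,ℓ}(0,L)`: the functions of `W^{1,1}_{#,ℓ}(0,L)` that are continuous on `[0,L]` and
affine on each `(i ε_n, (i+1) ε_n)`, `0 ≤ i < n`. -/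
def discreteSpace (L ℓ : ℝ) (n : ℕ) : Set (ℝ → ℝ) :=
  {u | u ∈ sobolevPer L ℓ ∧ ContinuousOn u (Icc 0 L) ∧
    ∀ i : ℕ, i < n → ∃ a b : ℝ, ∀ t ∈ Ioo (i * eps L n) ((i + 1) * eps L n), u t = a + b * t}

/-- The values `u_i = u(ε_n i)`, `i ∈ ℤ`. -/
def node (L : ℝ) (n : ℕ) (u : ℝ → ℝ) (i : ℤ) : ℝ := u (eps L n * i)

/-- `E_{n,M}`. -/
def bulkEnergy (M : ℕ) (ψ₁ ψM : ℝ → ℝ) (L : ℝ) (n : ℕ) (u : ℝ → ℝ) : ℝ :=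
  ∑ i ∈ Finset.range n,
      eps L n * ψ₁ ((node L n u (i + 1) - node L n u i) / eps L n)
    + ∑ i ∈ Finset.range n,
      eps L n * ψM ((node L n u (i + M) - node L n u i) / (M * eps L n))

open Classical in
/-- `E^1_{n,M}(u) = (E^ℓ_{n,M}(u) - min E^ℓ_M) / ε_n`, with value `+∞` off `𝒜^#_{n,ℓ}(0,L)`. -/
def renormEnergy (M : ℕ) (ψ₁ ψM : ℝ → ℝ) (L ℓ : ℝ) (n : ℕ) (u : ℝ → ℝ) : EReal :=
  if u ∈ discreteSpace L ℓ n then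
    (((bulkEnergy M ψ₁ ψM L n u - minBulk M ψ₁ ψM L ℓ) / eps L n : ℝ) : EReal)
  else ⊤

/-! ### `M`-interpolations and convergence -/

/-- The `k`-th `M`-interpolation of `u`: it takes the value `u_0` at `0` and has on
`[i M ε_n, (i+1) M ε_n)` the slope of `u` on the `k`-th of the `M` lattice intervals that form it
(`k` is counted from `0`). -/
def interpolation (M : ℕ) (L : ℝ) (n : ℕ) (u : ℝ → ℝ) (k : Fin M) (t : ℝ) : ℝ :=
  node L n u 0 + ∫ s in (0 : ℝ)..t,
    (node L n u (M * ⌊s / (M * eps L n)⌋ + (k : ℕ) + 1)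
      - node L n u (M * ⌊s / (M * eps L n)⌋ + (k : ℕ))) / eps L n

/-- Convergence in `L^∞(0,L)`, along the filter `l`, of all the `M`-interpolations. -/
def InterpConverges (M : ℕ) (L : ℝ) (l : Filter ℕ) (u : ℕ → ℝ → ℝ) (v : ℝ → Fin M → ℝ) : Prop :=
  ∀ k : Fin M, Tendsto
    (fun n => eLpNorm (fun t => interpolation M L n (u n) k t - v t k) ⊤
      (volume.restrict (Ioo 0 L))) l (𝓝 0)

/-- `Γ`-convergence along the filter `l` of functionals `F n : X → [-∞,∞]` to `G : Y → [-∞,∞]`,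
with respect to a notion `conv` of convergence of sequences in `X` to elements of `Y`: the liminf
inequality holds for all converging sequences, and every `y` at which `G` is not `+∞` has a recovery
sequence (where `G y = +∞` the liminf inequality says all, and there need not be any sequence that
converges to `y`). -/
def GammaConverges {X Y : Type*} (l : Filter ℕ) (conv : (ℕ → X) → Y → Prop)
    (F : ℕ → X → EReal) (G : Y → EReal) : Prop :=
  (∀ (y : Y) (x : ℕ → X), conv x y → G y ≤ liminf (fun n => F n (x n)) l) ∧
  (∀ y : Y, G y ≠ ⊤ → ∃ x : ℕ → X, conv x y ∧ limsup (fun n => F n (x n)) l ≤ G y)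

/-! ### The limit -/

/-- Continuous and locally affine off a locally finite set. -/
def IsPiecewiseAffine {M : ℕ} (u : ℝ → Fin M → ℝ) : Prop :=
  Continuous u ∧ ∃ S : Set ℝ, (∀ a b : ℝ, (S ∩ Icc a b).Finite) ∧
    ∀ t ∉ S, ∃ z : Fin M → ℝ, ∀ᶠ s in 𝓝 t, u s = u t + (s - t) • z

/-- `u'(t-)`. -/
def leftSlope {M : ℕ} (u : ℝ → Fin M → ℝ) (t : ℝ) : Fin M → ℝ := derivWithin u (Iio t) t

/-- `u'(t+)`. -/
def rightSlope {M : ℕ} (u : ℝ → Fin M → ℝ) (t : ℝ) : Fin M → ℝ := derivWithin u (Ioi t) t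

/-- The jump set `S(u')` of the derivative of a piecewise-affine function. -/
def jumpSet {M : ℕ} (u : ℝ → Fin M → ℝ) : Set ℝ := {t | leftSlope u t ≠ rightSlope u t}

/-- The domain `D_q^#`. Addition in `Fin M` is modulo `M`. -/
def limitDomain (M : ℕ) (ψ₁ ψM : ℝ → ℝ) (L ℓ : ℝ) (q : Fin M) : Set (ℝ → Fin M → ℝ) :=
  {u | IsPiecewiseAffine u ∧
    (∀ k k' : Fin M, u 0 k = u 0 k') ∧
    (∀ t ∉ jumpSet u, deriv u t ∈ minimalSlopes M ψ₁ ψM (ℓ / L)) ∧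
    (jumpSet u ∩ Ioc 0 L).Finite ∧
    Function.Periodic (fun t => ∑ k, u t k - M * (ℓ / L) * t) L ∧
    (∀ t : ℝ, t ∉ jumpSet u → t + L ∉ jumpSet u →
      ∀ k : Fin M, deriv u t k = deriv u (t + L) (k + q))}

/-- `E^1_q(u) = ∑_{t ∈ S(u') ∩ (0,L]} Φ^(ℓ/L)(u'(t-), u'(t+))`. -/
def interfaceEnergy (M : ℕ) (ψ₁ ψM : ℝ → ℝ) (L ℓ : ℝ) (u : ℝ → Fin M → ℝ) : ℝ :=
  ∑ᶠ t ∈ jumpSet u ∩ Ioc 0 L,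
    transitionEnergy M ψ₁ ψM (ℓ / L) (leftSlope u t) (rightSlope u t)

/-- The limit functional on `L^∞(0,L)`: its value at `v` is `E^1_q(u)` if `v` is the restriction to
`(0,L)` of some `u ∈ D_q^#`, and `+∞` otherwise. (Such a `u` is determined by its restriction, so
that the infimum is over at most one element.) -/
def limitEnergy (M : ℕ) (ψ₁ ψM : ℝ → ℝ) (L ℓ : ℝ) (q : Fin M) (v : ℝ → Fin M → ℝ) : EReal :=
  ⨅ u ∈ {u ∈ limitDomain M ψ₁ ψM L ℓ q | ∀ᵐ t ∂(volume.restrict (Ioo 0 L)), v t = u t},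
    ((interfaceEnergy M ψ₁ ψM L ℓ u : ℝ) : EReal)

end

end LatticeGamma

namespace LatticeGamma

/-! ### Biconjugates of functions with quadratic growth -/

/-! Write `r` for the tangent line at `α = ℓ/L`, and let the cost of a tuple `w` of `M` consecutive
slopes be `ψ_M` at the mean of `w`, plus the mean of the `ψ₁(w_k)`, minus `r` at the mean of `w`.
Over one period each slope lies in exactly `M` windows, and `r` is affine while the mean slope is
`α`. Hence the renormalized energy is exactly the sum of the costs of the `n` windows of a period
(`Admissible.renormEnergy_eq`). The cost is nonnegative because `r ≤ ψ₀** ≤ ψ₀`, and its zeros are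
exactly the elements of `𝐌_α` (`minimalSlopes_eq`). So the problem is one of phase transitions
between the zeros of a nonnegative cost.

Three facts about the zeros carry the argument. They are finitely many: two zeros whose entries lie
in the same wells would have a midpoint of negative cost (`finite_zeros`). Two zeros that share an
entry have the same sum, by the stationarity condition and the injectivity of `ψ_M'`
(`sum_eq_of_shared_entry`). Consecutive windows overlap in `M - 1 ≥ 1` entries, so a run of windows
close to zeros must follow one single periodic pattern (`IsWellCost.exists_pattern`). Finally the
cost is differentiable at its zeros with derivative zero, so that changing `K` cells by `O(1/K)`
each costs `o(1)` (`cost_add_le`). Therefore the offset between the two profiles in the definition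
of the transition energy does not matter (`transitionEnergy_le_of_connects`), and a bounded error in
the total length can be spread over all the cells at vanishing cost.

Lower bound: along an ultrafilter on which the energies stay below `C`, all the interpolations
converge pointwise on the line. A point near which cells keep away from the zeros carries a fixed
amount of energy, so there are finitely many such points in a bounded interval. Elsewhere a single
pattern prevails and the limit is affine with that pattern as slope. A shift by `n ≡ q` lattice
sites rotates the entries of a block by `q`, whence the twisted periodicity of the limit. At each
jump the sequence is cut at two cells that almost follow the patterns on either side and is
completed by exact patterns, which bounds the transition energy by the energy of the cells in
between (`transitionEnergy_le_of_near`). These groups of cells are disjoint and fit in one period.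

Upper bound: the slopes of the limit are sampled on the lattice, almost optimal transitions are
inserted at the jumps in an `n`-periodic way (`splice`), and one constant of size `O(1/n)` is added
to all slopes to restore the mean `α`. A diagonal argument concludes. An element of the limit domain
is determined by its restriction to `(0, L)` (`IsTwisted.eq_of_ae_eq`), so the infimum in the limit
functional is its interface energy. -/

theorem bddAbove_conjugate {f : ℝ → ℝ} {c : ℝ} (hc : 0 < c) (hf : ∀ x, c * x ^ 2 - 1 / c ≤ f x)
    (p : ℝ) : BddAbove (range fun x => p * x - f x) := by
  -- `p²/(4c)` is the maximum over `x` of `p x - c x²`.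
  refine ⟨p ^ 2 / (4 * c) + 1 / c, ?_⟩
  rintro _ ⟨x, rfl⟩
  have h1 : p ^ 2 / (4 * c) - p * x + c * x ^ 2 = (p - 2 * c * x) ^ 2 / (4 * c) := by
    field_simp; ring
  have h2 : 0 ≤ (p - 2 * c * x) ^ 2 / (4 * c) := by positivity
  have := hf x
  simp only; linarith

theorem le_conjugate {f : ℝ → ℝ} {c : ℝ} (hc : 0 < c) (hf : ∀ x, c * x ^ 2 - 1 / c ≤ f x)
    (p x : ℝ) : p * x - f x ≤ conjugate f p :=
  le_ciSup (bddAbove_conjugate hc hf p) x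

theorem bddAbove_biconjugate {f : ℝ → ℝ} {c : ℝ} (hc : 0 < c)
    (hf : ∀ x, c * x ^ 2 - 1 / c ≤ f x) (x : ℝ) :
    BddAbove (range fun p => x * p - conjugate f p) := by
  refine ⟨f x, ?_⟩
  rintro _ ⟨p, rfl⟩
  have := le_conjugate hc hf p x
  simp only; linarith

theorem biconjugate_le {f : ℝ → ℝ} {c : ℝ} (hc : 0 < c) (hf : ∀ x, c * x ^ 2 - 1 / c ≤ f x)
    (x : ℝ) : biconjugate f x ≤ f x := by
  refine ciSup_le fun p => ?_
  have := le_conjugate hc hf p x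
  linarith

theorem affine_le_biconjugate {f : ℝ → ℝ} {c : ℝ} (hc : 0 < c)
    (hf : ∀ x, c * x ^ 2 - 1 / c ≤ f x) {a b : ℝ} (h : ∀ x, a + b * x ≤ f x) (x : ℝ) :
    a + b * x ≤ biconjugate f x := by
  have h1 : conjugate f b ≤ -a := ciSup_le fun y => by linarith [h y]
  have h2 : x * b - conjugate f b ≤ biconjugate f x := le_ciSup (bddAbove_biconjugate hc hf x) b
  linarith

theorem convexOn_biconjugate {f : ℝ → ℝ} {c : ℝ} (hc : 0 < c)
    (hf : ∀ x, c * x ^ 2 - 1 / c ≤ f x) : ConvexOn ℝ univ (biconjugate f) := by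
  refine ⟨convex_univ, fun x _ y _ a b ha hb hab => ?_⟩
  refine ciSup_le fun p => ?_
  have h1 : x * p - conjugate f p ≤ biconjugate f x := le_ciSup (bddAbove_biconjugate hc hf x) p
  have h2 : y * p - conjugate f p ≤ biconjugate f y := le_ciSup (bddAbove_biconjugate hc hf y) p
  simp only [smul_eq_mul]
  have h3 := mul_le_mul_of_nonneg_left h1 ha
  have h4 := mul_le_mul_of_nonneg_left h2 hb
  have h5 : conjugate f p = a * conjugate f p + b * conjugate f p := by rw [← add_mul, hab, one_mul]
  nlinarith

theorem tangent_le_of_convexOn {g : ℝ → ℝ} (hg : ConvexOn ℝ univ g) {x : ℝ}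
    (hd : DifferentiableAt ℝ g x) (y : ℝ) : g x + deriv g x * (y - x) ≤ g y := by
  rcases lt_trichotomy x y with h | h | h
  · have := hg.le_slope_of_hasDerivAt (mem_univ x) (mem_univ y) h hd.hasDerivAt
    rw [slope_def_field, le_div_iff₀ (by linarith)] at this
    linarith
  · subst h; simp
  · have := hg.slope_le_of_hasDerivAt (mem_univ y) (mem_univ x) h hd.hasDerivAt
    rw [slope_def_field, div_le_iff₀ (by linarith)] at this
    linarith

/-- The standing assumptions on the energy densities and on the mean slope `α`. -/
structure Admissible (M : ℕ) (W₁ W₂ ψ₁ ψM : ℝ → ℝ) (c α : ℝ) : Prop where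
  two_le : 2 ≤ M
  eq_min : ∀ z, ψ₁ z = min (W₁ z) (W₂ z)
  nonneg₁ : ∀ z, 0 ≤ ψ₁ z
  nonnegM : ∀ z, 0 ≤ ψM z
  convex₁ : StrictConvexOn ℝ univ W₁
  convex₂ : StrictConvexOn ℝ univ W₂
  c_pos : 0 < c
  growth₁ : ∀ z, c * z ^ 2 - 1 / c ≤ W₁ z
  growth₂ : ∀ z, c * z ^ 2 - 1 / c ≤ W₂ z
  convexM : StrictConvexOn ℝ univ ψM
  contDiffM : ContDiff ℝ 1 ψM
  contDiffAt : ∀ z ∈ minimalSlopes M ψ₁ ψM α, ∀ k : Fin M, ContDiffAt ℝ 1 ψ₁ (z k)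
  diff : DifferentiableAt ℝ (psiZeroConv M ψ₁ ψM) α

/-- The renormalized energy of a window with the slopes `w`. -/
noncomputable def cost (M : ℕ) (ψ₁ ψM : ℝ → ℝ) (α : ℝ) (w : Fin M → ℝ) : ℝ :=
  ψM ((∑ k, w k) / M) + (1 / (M : ℝ)) * ∑ k, ψ₁ (w k) - tangentLine M ψ₁ ψM α ((∑ k, w k) / M)

/-! ### Lower bounds for `ψ₀` and for the cost of a window -/

namespace Admissible

variable {M : ℕ} {W₁ W₂ ψ₁ ψM : ℝ → ℝ} {c α : ℝ}

theorem pos (H : Admissible M W₁ W₂ ψ₁ ψM c α) : (0 : ℝ) < M := by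
  have := H.two_le
  exact_mod_cast (by omega : 0 < M)

theorem growth (H : Admissible M W₁ W₂ ψ₁ ψM c α) (z : ℝ) : c * z ^ 2 - 1 / c ≤ ψ₁ z := by
  rw [H.eq_min]; exact le_min (H.growth₁ z) (H.growth₂ z)

theorem sum_growth (H : Admissible M W₁ W₂ ψ₁ ψM c α) (w : Fin M → ℝ) :
    c * ∑ k, w k ^ 2 - M * (1 / c) ≤ ∑ k, ψ₁ (w k) := by
  calc c * ∑ k, w k ^ 2 - M * (1 / c) = ∑ k, (c * w k ^ 2 - 1 / c) := by
        simp [Finset.sum_sub_distrib, Finset.mul_sum]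
    _ ≤ _ := Finset.sum_le_sum fun k _ => H.growth (w k)

theorem psiZero_le (H : Admissible M W₁ W₂ ψ₁ ψM c α) (w : Fin M → ℝ) {z : ℝ}
    (hw : ∑ k, w k = M * z) : psiZero M ψ₁ ψM z ≤ ψM z + (1 / (M : ℝ)) * ∑ k, ψ₁ (w k) := by
  unfold psiZero
  have hM := H.pos
  have : sInf {e : ℝ | ∃ w : Fin M → ℝ, ∑ k, w k = M * z ∧ e = ∑ k, ψ₁ (w k)} ≤
      ∑ k, ψ₁ (w k) := by
    refine csInf_le ⟨0, ?_⟩ ⟨w, hw, rfl⟩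
    rintro _ ⟨w, -, rfl⟩
    exact Finset.sum_nonneg fun k _ => H.nonneg₁ _
  gcongr

theorem le_psiZero (H : Admissible M W₁ W₂ ψ₁ ψM c α) {z b : ℝ}
    (hb : ∀ w : Fin M → ℝ, ∑ k, w k = M * z → b ≤ ψM z + (1 / (M : ℝ)) * ∑ k, ψ₁ (w k)) :
    b ≤ psiZero M ψ₁ ψM z := by
  unfold psiZero
  have hM := H.pos
  have : M * (b - ψM z) ≤
      sInf {e : ℝ | ∃ w : Fin M → ℝ, ∑ k, w k = M * z ∧ e = ∑ k, ψ₁ (w k)} := by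
    refine le_csInf ⟨_, fun _ => z, by simp, rfl⟩ ?_
    rintro _ ⟨w, hw, rfl⟩
    have := hb w hw
    rw [one_div, ← div_eq_inv_mul] at this
    rw [← sub_le_iff_le_add', le_div_iff₀ hM] at this
    linarith
  rw [one_div, ← div_eq_inv_mul, ← sub_le_iff_le_add', le_div_iff₀ hM]
  linarith

theorem growth_psiZero (H : Admissible M W₁ W₂ ψ₁ ψM c α) (z : ℝ) :
    c * z ^ 2 - 1 / c ≤ psiZero M ψ₁ ψM z := by
  have hM := H.pos
  have hc := H.c_pos
  refine H.le_psiZero fun w hw => ?_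
  have h1 := H.sum_growth w
  -- By Cauchy–Schwarz the quadratic lower bound passes from the entries to their mean.
  have h2 := sq_sum_le_card_mul_sum_sq (s := Finset.univ) (f := w)
  rw [hw] at h2
  simp only [Finset.card_univ, Fintype.card_fin] at h2
  have h3 : M * z ^ 2 ≤ ∑ k, w k ^ 2 := by
    have : (M : ℝ) * (M * z ^ 2) ≤ M * ∑ k, w k ^ 2 := by linarith
    exact le_of_mul_le_mul_left this hM
  have h4 : c * z ^ 2 - 1 / c ≤ (1 / (M : ℝ)) * ∑ k, ψ₁ (w k) := by
    rw [one_div_mul_eq_div, le_div_iff₀ hM]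
    have := mul_le_mul_of_nonneg_left h3 hc.le
    linarith
  linarith [H.nonnegM z]

theorem psiZeroConv_le (H : Admissible M W₁ W₂ ψ₁ ψM c α) (z : ℝ) :
    psiZeroConv M ψ₁ ψM z ≤ psiZero M ψ₁ ψM z :=
  biconjugate_le H.c_pos H.growth_psiZero z

theorem convexOn_psiZeroConv (H : Admissible M W₁ W₂ ψ₁ ψM c α) :
    ConvexOn ℝ univ (psiZeroConv M ψ₁ ψM) :=
  convexOn_biconjugate H.c_pos H.growth_psiZero

theorem tangentLine_le (H : Admissible M W₁ W₂ ψ₁ ψM c α) (z : ℝ) :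
    tangentLine M ψ₁ ψM α z ≤ psiZeroConv M ψ₁ ψM z :=
  tangent_le_of_convexOn H.convexOn_psiZeroConv H.diff z

theorem psiZero_nonneg (H : Admissible M W₁ W₂ ψ₁ ψM c α) (z : ℝ) : 0 ≤ psiZero M ψ₁ ψM z :=
  H.le_psiZero fun w _ => add_nonneg (H.nonnegM z)
    (mul_nonneg (by positivity) (Finset.sum_nonneg fun k _ => H.nonneg₁ _))

theorem psiZeroConv_nonneg (H : Admissible M W₁ W₂ ψ₁ ψM c α) (z : ℝ) :
    0 ≤ psiZeroConv M ψ₁ ψM z := by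
  have := affine_le_biconjugate H.c_pos H.growth_psiZero (a := 0) (b := 0)
    (fun x => by simpa using H.psiZero_nonneg x) z
  simpa [psiZeroConv] using this

theorem psiZero_sub_le_cost (H : Admissible M W₁ W₂ ψ₁ ψM c α) (w : Fin M → ℝ) :
    psiZero M ψ₁ ψM ((∑ k, w k) / M) - tangentLine M ψ₁ ψM α ((∑ k, w k) / M) ≤
      cost M ψ₁ ψM α w := by
  have := H.psiZero_le w (z := (∑ k, w k) / M) (by field_simp [H.pos.ne'])
  unfold cost; linarith

/-- The tangent line lies below `ψ₀**` by convexity, `ψ₀**` lies below `ψ₀`, and `ψ₀` is the least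
value of the first two terms of the cost at a given mean. -/
theorem cost_nonneg (H : Admissible M W₁ W₂ ψ₁ ψM c α) (w : Fin M → ℝ) :
    0 ≤ cost M ψ₁ ψM α w := by
  linarith [H.psiZero_sub_le_cost w, H.tangentLine_le ((∑ k, w k) / M),
    H.psiZeroConv_le ((∑ k, w k) / M)]

theorem continuous_psi₁ (H : Admissible M W₁ W₂ ψ₁ ψM c α) : Continuous ψ₁ := by
  have h1 : Continuous W₁ := continuousOn_univ.1 (H.convex₁.convexOn.continuousOn isOpen_univ)
  have h2 : Continuous W₂ := continuousOn_univ.1 (H.convex₂.convexOn.continuousOn isOpen_univ)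
  have : ψ₁ = fun z => min (W₁ z) (W₂ z) := funext H.eq_min
  rw [this]; exact h1.min h2

theorem continuous_cost (H : Admissible M W₁ W₂ ψ₁ ψM c α) : Continuous (cost M ψ₁ ψM α) := by
  have h1 := H.continuous_psi₁
  have h2 := H.contDiffM.continuous
  unfold cost tangentLine
  fun_prop

/-- The cost sees the entries only through symmetric sums. This is used for rotations: all the
windows of a periodic pattern have the same cost. -/
theorem cost_comp_perm (σ : Equiv.Perm (Fin M)) (w : Fin M → ℝ) :
    cost M ψ₁ ψM α (w ∘ σ) = cost M ψ₁ ψM α w := by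
  have h1 : ∑ k, (w ∘ σ) k = ∑ k, w k := Equiv.sum_comp σ w
  have h2 : ∑ k, ψ₁ ((w ∘ σ) k) = ∑ k, ψ₁ (w k) := Equiv.sum_comp σ (ψ₁ ∘ w)
  unfold cost; rw [h1, h2]

/-- The quadratic growth of `ψ₁` dominates the affine function that is subtracted. A linear bound on
the norm is all that is needed later. -/
theorem coercive_cost (H : Admissible M W₁ W₂ ψ₁ ψM c α) :
    ∃ A : ℝ, 0 < A ∧ ∀ w : Fin M → ℝ, ‖w‖ ≤ A * (1 + cost M ψ₁ ψM α w) := by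
  have hM := H.pos
  have hc := H.c_pos
  set a := psiZeroConv M ψ₁ ψM α - deriv (psiZeroConv M ψ₁ ψM) α * α with ha
  set b := deriv (psiZeroConv M ψ₁ ψM) α with hb
  set κ : ℝ := c / M with hκ
  have hκ0 : 0 < κ := by positivity
  -- the cost dominates `κ ‖w‖² - 1/c - |a| - |b| ‖w‖`
  have key : ∀ w : Fin M → ℝ, κ * ‖w‖ ^ 2 - 1 / c - |a| - |b| * ‖w‖ ≤ cost M ψ₁ ψM α w := by
    intro w
    have h1 := H.sum_growth w
    have h2 : ‖w‖ ^ 2 ≤ ∑ k, w k ^ 2 := by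
      have : Nonempty (Fin M) := ⟨⟨0, by have := H.two_le; omega⟩⟩
      obtain ⟨k, hk⟩ := Finite.exists_max (fun k => ‖w k‖)
      have : ‖w‖ ≤ ‖w k‖ := (pi_norm_le_iff_of_nonneg (norm_nonneg _)).2 hk
      calc ‖w‖ ^ 2 ≤ ‖w k‖ ^ 2 := by gcongr
        _ = w k ^ 2 := by simp
        _ ≤ _ := Finset.single_le_sum (f := fun k => w k ^ 2) (fun i _ => sq_nonneg _)
          (Finset.mem_univ k)
    have h3 : |(∑ k, w k) / M| ≤ ‖w‖ := by
      rw [abs_div, abs_of_pos hM, div_le_iff₀ hM]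
      calc |∑ k, w k| ≤ ∑ k, |w k| := Finset.abs_sum_le_sum_abs _ _
        _ ≤ ∑ _k : Fin M, ‖w‖ := Finset.sum_le_sum fun k _ => norm_le_pi_norm w k
        _ = _ := by simp [mul_comm]
    have h4 : κ * ‖w‖ ^ 2 - 1 / c ≤ (1 / (M : ℝ)) * ∑ k, ψ₁ (w k) := by
      rw [one_div_mul_eq_div, le_div_iff₀ hM, hκ]
      have := mul_le_mul_of_nonneg_left h2 hc.le
      have e : (c / M * ‖w‖ ^ 2 - 1 / c) * M = c * ‖w‖ ^ 2 - M * (1 / c) := by field_simp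
      rw [e]; linarith
    have h5 : tangentLine M ψ₁ ψM α ((∑ k, w k) / M) ≤ |a| + |b| * ‖w‖ := by
      have e : tangentLine M ψ₁ ψM α ((∑ k, w k) / M) = a + b * ((∑ k, w k) / M) := by
        rw [ha, hb]; unfold tangentLine; ring
      rw [e]
      have := (le_abs_self (b * ((∑ k, w k) / M)))
      rw [abs_mul] at this
      have := mul_le_mul_of_nonneg_left h3 (abs_nonneg b)
      linarith [le_abs_self a]
    unfold cost
    linarith [H.nonnegM ((∑ k, w k) / M)]
  -- `(|b| + 1)²/(4κ)` is the maximum of `(|b| + 1) s - κ s²`, the amount by which `‖w‖ + |b| ‖w‖`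
  -- can exceed `κ ‖w‖²`.
  refine ⟨1 + 1 / c + |a| + (|b| + 1) ^ 2 / (4 * κ), by positivity, fun w => ?_⟩
  have h0 := H.cost_nonneg w
  have h1 : ‖w‖ ≤ 1 / c + |a| + (|b| + 1) ^ 2 / (4 * κ) + cost M ψ₁ ψM α w := by
    have e : (|b| + 1) ^ 2 / (4 * κ) - (|b| + 1) * ‖w‖ + κ * ‖w‖ ^ 2 =
        (|b| + 1 - 2 * κ * ‖w‖) ^ 2 / (4 * κ) := by field_simp; ring
    have : 0 ≤ (|b| + 1 - 2 * κ * ‖w‖) ^ 2 / (4 * κ) := by positivity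
    linarith [key w]
  have h2 : 0 ≤ (1 / c + |a| + (|b| + 1) ^ 2 / (4 * κ)) * cost M ψ₁ ψM α w := by positivity
  nlinarith

end Admissible
namespace Admissible

variable {M : ℕ} {W₁ W₂ ψ₁ ψM : ℝ → ℝ} {c α : ℝ}

/-! ### The zero set of the cost -/

/-- The cost is the excess of the tuple over `ψ₀` at its mean plus the gap between `ψ₀` and the
tangent line there. Both are nonnegative, so the sum vanishes only if both do. -/
theorem cost_eq_zero_iff (H : Admissible M W₁ W₂ ψ₁ ψM c α) (z : Fin M → ℝ) :
    cost M ψ₁ ψM α z = 0 ↔ z ∈ minimizers M ψ₁ ((∑ k, z k) / M) ∧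
      psiZero M ψ₁ ψM ((∑ k, z k) / M) = tangentLine M ψ₁ ψM α ((∑ k, z k) / M) := by
  have hM := H.pos
  have hz : ∑ k, z k = M * ((∑ k, z k) / M) := by field_simp
  have h1 := H.psiZero_sub_le_cost z
  have h2 := H.tangentLine_le ((∑ k, z k) / M)
  have h3 := H.psiZeroConv_le ((∑ k, z k) / M)
  constructor
  · intro h
    refine ⟨⟨hz, fun w hw => ?_⟩, by linarith⟩
    rw [← hz] at hw
    have h4 := H.cost_nonneg w
    rw [← h] at h4
    unfold cost at h4
    rw [hw] at h4
    have : (1 / (M : ℝ)) * ∑ k, ψ₁ (z k) ≤ (1 / (M : ℝ)) * ∑ k, ψ₁ (w k) := by linarith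
    exact le_of_mul_le_mul_left this (by positivity)
  · rintro ⟨⟨-, hmin⟩, h⟩
    refine le_antisymm ?_ (H.cost_nonneg z)
    have h5 : ψM ((∑ k, z k) / M) + (1 / (M : ℝ)) * ∑ k, ψ₁ (z k) ≤
        psiZero M ψ₁ ψM ((∑ k, z k) / M) := by
      refine H.le_psiZero fun w hw => ?_
      have := hmin w hw
      gcongr
    unfold cost; linarith

/-- On a nondegenerate interval with endpoint `α`, differentiability at `α` forces the affine
function to be the tangent. Conversely, a convex function that touches its tangent at `α` and at `β`
coincides with it in between. -/
theorem mem_affineInterval_iff (H : Admissible M W₁ W₂ ψ₁ ψM c α) (β : ℝ) :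
    β ∈ affineInterval M ψ₁ ψM α ↔ psiZeroConv M ψ₁ ψM β = tangentLine M ψ₁ ψM α β := by
  constructor
  · rintro ⟨a, b, h⟩
    have hα := h α left_mem_uIcc
    have hβ := h β right_mem_uIcc
    unfold tangentLine
    rcases eq_or_ne α β with rfl | hne
    · simp
    have hu : UniqueDiffWithinAt ℝ (uIcc α β) α := by
      refine uniqueDiffOn_Icc ?_ α left_mem_uIcc
      simpa using Ne.symm hne
    have h1 : HasDerivWithinAt (psiZeroConv M ψ₁ ψM) b (uIcc α β) α := by
      have : HasDerivWithinAt (fun x => a + b * x) b (uIcc α β) α := by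
        simpa using (((hasDerivAt_id α).const_mul b).const_add a).hasDerivWithinAt
      exact this.congr h hα
    have h2 := hu.eq_deriv _ H.diff.hasDerivAt.hasDerivWithinAt h1
    rw [h2, hα, hβ]; ring
  · intro h
    refine ⟨psiZeroConv M ψ₁ ψM α - deriv (psiZeroConv M ψ₁ ψM) α * α,
      deriv (psiZeroConv M ψ₁ ψM) α, fun x hx => ?_⟩
    have h1 := H.tangentLine_le x
    rw [← segment_eq_uIcc] at hx
    obtain ⟨s, t, hs, ht, hst, rfl⟩ := hx
    have h2 := H.convexOn_psiZeroConv.2 (mem_univ α) (mem_univ β) hs ht hst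
    simp only [smul_eq_mul] at h1 h2 ⊢
    rw [h] at h2
    unfold tangentLine at h1 h2
    have : s = 1 - t := by linarith
    subst this
    nlinarith

/-- On the tuples of a given mean the cost differs from the mean of the `ψ₁(w_k)` by a constant, so
its coercivity and continuity provide the minimum. -/
theorem exists_mem_minimizers (H : Admissible M W₁ W₂ ψ₁ ψM c α) (β : ℝ) :
    ∃ z, z ∈ minimizers M ψ₁ β := by
  have hM := H.pos
  obtain ⟨A, hA, hco⟩ := H.coercive_cost
  set R := A * (1 + cost M ψ₁ ψM α fun _ => β) with hR
  have hcl : IsClosed {w : Fin M → ℝ | ∑ k, w k = M * β} :=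
    isClosed_eq (by fun_prop) continuous_const
  have hK : IsCompact (Metric.closedBall (0 : Fin M → ℝ) R ∩ {w | ∑ k, w k = M * β}) :=
    (isCompact_closedBall _ _).inter_right hcl
  have hmem : (fun _ => β) ∈ Metric.closedBall (0 : Fin M → ℝ) R ∩ {w | ∑ k, w k = M * β} := by
    refine ⟨?_, by simp⟩
    simpa using hco fun _ => β
  obtain ⟨z, ⟨hz1, hz2⟩, hz⟩ := hK.exists_isMinOn ⟨_, hmem⟩ H.continuous_cost.continuousOn
  refine ⟨z, hz2, fun w hw => ?_⟩
  have hle : cost M ψ₁ ψM α z ≤ cost M ψ₁ ψM α w := by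
    by_cases hwR : ‖w‖ ≤ R
    · exact hz ⟨by simpa using hwR, hw⟩
    · refine (hz hmem).trans ?_
      push Not at hwR
      have := hwR.trans_le (hco w)
      rw [hR, mul_lt_mul_iff_right₀ hA] at this
      linarith
  have hz2' : ∑ k, z k = M * β := hz2
  unfold cost at hle
  rw [hw, hz2'] at hle
  have : (1 / (M : ℝ)) * ∑ k, ψ₁ (z k) ≤ (1 / (M : ℝ)) * ∑ k, ψ₁ (w k) := by linarith
  exact le_of_mul_le_mul_left this (by positivity)

/-- Each entry is labelled by the well that realizes the minimum in `ψ₁`. For two distinct zeros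
with equal labels, the midpoint lowers the sum of the `ψ₁` strictly by strict convexity of the
wells, does not increase the `ψ_M` term beyond the average, and averages the affine term, so its
cost would be negative. There are finitely many labellings. -/
theorem finite_zeros (H : Admissible M W₁ W₂ ψ₁ ψM c α) : {z | cost M ψ₁ ψM α z = 0}.Finite := by
  classical
  have hM := H.pos
  let lab : (Fin M → ℝ) → Fin M → Bool := fun z k => decide (W₁ (z k) ≤ W₂ (z k))
  refine Set.Finite.of_finite_image (f := lab) (Set.toFinite _) ?_
  intro z hz y hy hzy
  by_contra hne
  obtain ⟨k₀, hk₀⟩ := Function.ne_iff.1 hne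
  simp only [mem_ofPred_eq] at hz hy
  have hstep : ∀ k, ψ₁ ((1 / 2 : ℝ) * z k + (1 / 2 : ℝ) * y k) ≤
        (1 / 2 : ℝ) * ψ₁ (z k) + (1 / 2 : ℝ) * ψ₁ (y k) ∧
      (z k ≠ y k → ψ₁ ((1 / 2 : ℝ) * z k + (1 / 2 : ℝ) * y k) <
        (1 / 2 : ℝ) * ψ₁ (z k) + (1 / 2 : ℝ) * ψ₁ (y k)) := by
    intro k
    have hk : (W₁ (z k) ≤ W₂ (z k)) ↔ (W₁ (y k) ≤ W₂ (y k)) := by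
      have := congrFun hzy k
      simpa [lab] using this
    have aux : ∀ W : ℝ → ℝ, StrictConvexOn ℝ univ W → (∀ x, ψ₁ x ≤ W x) → ψ₁ (z k) = W (z k) →
        ψ₁ (y k) = W (y k) → ψ₁ ((1 / 2 : ℝ) * z k + (1 / 2 : ℝ) * y k) ≤
        (1 / 2 : ℝ) * ψ₁ (z k) + (1 / 2 : ℝ) * ψ₁ (y k) ∧
      (z k ≠ y k → ψ₁ ((1 / 2 : ℝ) * z k + (1 / 2 : ℝ) * y k) <
        (1 / 2 : ℝ) * ψ₁ (z k) + (1 / 2 : ℝ) * ψ₁ (y k)) := by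
      intro W hW hle e1 e2
      rw [e1, e2]
      have h1 := hW.convexOn.2 (mem_univ (z k)) (mem_univ (y k))
        (by norm_num : (0 : ℝ) ≤ 1 / 2) (by norm_num : (0 : ℝ) ≤ 1 / 2) (by norm_num)
      refine ⟨(hle _).trans h1, fun hne => ?_⟩
      have h2 := hW.2 (mem_univ (z k)) (mem_univ (y k)) hne
        (by norm_num : (0 : ℝ) < 1 / 2) (by norm_num : (0 : ℝ) < 1 / 2) (by norm_num)
      exact (hle _).trans_lt h2
    by_cases h : W₁ (z k) ≤ W₂ (z k)
    · exact aux W₁ H.convex₁ (fun x => by rw [H.eq_min]; exact min_le_left _ _)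
        (by rw [H.eq_min, min_eq_left h]) (by rw [H.eq_min, min_eq_left (hk.1 h)])
    · have h' : ¬ W₁ (y k) ≤ W₂ (y k) := fun h' => h (hk.2 h')
      push Not at h h'
      exact aux W₂ H.convex₂ (fun x => by rw [H.eq_min]; exact min_le_right _ _)
        (by rw [H.eq_min, min_eq_right h.le]) (by rw [H.eq_min, min_eq_right h'.le])
  have hsum : ∑ k, ψ₁ ((1 / 2 : ℝ) * z k + (1 / 2 : ℝ) * y k) <
      (1 / 2 : ℝ) * ∑ k, ψ₁ (z k) + (1 / 2 : ℝ) * ∑ k, ψ₁ (y k) := by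
    rw [Finset.mul_sum, Finset.mul_sum, ← Finset.sum_add_distrib]
    exact Finset.sum_lt_sum (fun k _ => (hstep k).1) ⟨k₀, Finset.mem_univ _, (hstep k₀).2 hk₀⟩
  have hmean : (∑ k, ((1 / 2 : ℝ) * z k + (1 / 2 : ℝ) * y k)) / M =
      (1 / 2 : ℝ) * ((∑ k, z k) / M) + (1 / 2 : ℝ) * ((∑ k, y k) / M) := by
    rw [Finset.sum_add_distrib, ← Finset.mul_sum, ← Finset.mul_sum]; ring
  have hψ := H.convexM.convexOn.2 (mem_univ ((∑ k, z k) / M)) (mem_univ ((∑ k, y k) / M))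
        (by norm_num : (0 : ℝ) ≤ 1 / 2) (by norm_num : (0 : ℝ) ≤ 1 / 2) (by norm_num)
  have hpos := H.cost_nonneg fun k => (1 / 2 : ℝ) * z k + (1 / 2 : ℝ) * y k
  have hsum' := mul_lt_mul_of_pos_left hsum (by positivity : (0 : ℝ) < 1 / M)
  unfold cost at hz hy hpos
  rw [hmean] at hpos
  simp only [smul_eq_mul] at hψ
  unfold tangentLine at hz hy hpos
  linarith

/-- When `α` is interior to the contact set, the definition admits only the mean `α`, and zeros with
another mean have to be excluded; finiteness of the zero set does this. In the other case the
contact points of the affine interval are exactly the means at which `ψ₀` meets the tangent line. -/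
theorem minimalSlopes_eq (H : Admissible M W₁ W₂ ψ₁ ψM c α) :
    minimalSlopes M ψ₁ ψM α = {z | cost M ψ₁ ψM α z = 0} := by
  have hM := H.pos
  have hmean : ∀ {β : ℝ} {z : Fin M → ℝ}, z ∈ minimizers M ψ₁ β → (∑ k, z k) / M = β := by
    intro β z hz
    rw [hz.1]; field_simp
  have hrα : tangentLine M ψ₁ ψM α α = psiZeroConv M ψ₁ ψM α := by simp [tangentLine]
  ext z
  simp only [minimalSlopes, mem_ofPred_eq]
  constructor
  · rintro (⟨hα, hz⟩ | ⟨-, β, ⟨hβ1, hβ2⟩, hz⟩)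
    · rw [H.cost_eq_zero_iff, hmean hz, hrα]
      exact ⟨hz, (interior_subset hα : α ∈ contactSet M ψ₁ ψM)⟩
    · rw [H.cost_eq_zero_iff, hmean hz, ← (H.mem_affineInterval_iff β).1 hβ1]
      exact ⟨hz, hβ2⟩
  · intro h0
    obtain ⟨hz, hr⟩ := (H.cost_eq_zero_iff z).1 h0
    set β := (∑ k, z k) / M with hβ
    have hconv : psiZeroConv M ψ₁ ψM β = tangentLine M ψ₁ ψM α β :=
      le_antisymm ((H.psiZeroConv_le β).trans hr.le) (H.tangentLine_le β)
    by_cases hα : α ∈ interior (contactSet M ψ₁ ψM)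
    · refine Or.inl ⟨hα, ?_⟩
      by_cases hαβ : α = β
      · rwa [hαβ]
      exfalso
      -- A zero of mean `β ≠ α` makes `ψ₀**` equal to the tangent on the segment from `α` to `β`.
      -- Near `α` the points of this segment are contact points, so each is the mean of a zero:
      -- infinitely many zeros.
      have hfin : ((fun z : Fin M → ℝ => (∑ k, z k) / M) '' {z | cost M ψ₁ ψM α z = 0}).Finite :=
        H.finite_zeros.image _
      have hcont : Tendsto (fun t : ℝ => α + t * (β - α)) (𝓝[>] 0) (𝓝 α) := by
        have : Tendsto (fun t : ℝ => α + t * (β - α)) (𝓝 0) (𝓝 (α + 0 * (β - α))) :=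
          (by fun_prop : Continuous fun t : ℝ => α + t * (β - α)).tendsto 0
        rw [zero_mul, add_zero] at this
        exact this.mono_left nhdsWithin_le_nhds
      have hev := hcont.eventually (isOpen_interior.mem_nhds hα)
      have hev2 : ∀ᶠ t : ℝ in 𝓝[>] 0, t ∈ Ioo (0 : ℝ) 1 := Ioo_mem_nhdsGT one_pos
      obtain ⟨t₀, ht₀, hsub⟩ := mem_nhdsGT_iff_exists_Ioo_subset.1 (hev.and hev2)
      have hinf : ((fun t : ℝ => α + t * (β - α)) '' Ioo 0 t₀).Infinite := by
        refine (Ioo_infinite ht₀).image ?_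
        intro s _ t _ hst
        have : β - α ≠ 0 := sub_ne_zero.2 (Ne.symm hαβ)
        simpa [this] using hst
      refine hinf (hfin.subset ?_)
      rintro _ ⟨t, ht, rfl⟩
      obtain ⟨h1, h2⟩ := hsub ht
      have h1' : psiZero M ψ₁ ψM (α + t * (β - α)) = psiZeroConv M ψ₁ ψM (α + t * (β - α)) :=
        (interior_subset h1 : α + t * (β - α) ∈ contactSet M ψ₁ ψM)
      obtain ⟨y, hy⟩ := H.exists_mem_minimizers (α + t * (β - α))
      refine ⟨y, ?_, hmean hy⟩
      simp only [mem_ofPred_eq]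
      rw [H.cost_eq_zero_iff, hmean hy]
      refine ⟨hy, h1'.trans (le_antisymm ?_ (H.tangentLine_le _))⟩
      have hc := H.convexOn_psiZeroConv.2 (mem_univ α) (mem_univ β)
        (by linarith [h2.2] : 0 ≤ 1 - t) h2.1.le (by ring)
      simp only [smul_eq_mul] at hc
      rw [hconv] at hc
      have e : (1 - t) * α + t * β = α + t * (β - α) := by ring
      rw [e] at hc
      refine hc.trans (le_of_eq ?_)
      unfold tangentLine; ring
    · exact Or.inr ⟨hα, β, ⟨(H.mem_affineInterval_iff β).2 hconv, hr.trans hconv.symm⟩, hz⟩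

/-! ### First-order conditions at the zeros of the cost -/

theorem differentiableAt_psi₁ (H : Admissible M W₁ W₂ ψ₁ ψM c α) {z : Fin M → ℝ}
    (hz : cost M ψ₁ ψM α z = 0) (k : Fin M) : DifferentiableAt ℝ ψ₁ (z k) :=
  (H.contDiffAt z (by rw [H.minimalSlopes_eq]; exact hz) k).differentiableAt (by norm_num)

theorem hasFDerivAt_cost (H : Admissible M W₁ W₂ ψ₁ ψM c α) {z : Fin M → ℝ}
    (hz : cost M ψ₁ ψM α z = 0) : HasFDerivAt (cost M ψ₁ ψM α) (0 : (Fin M → ℝ) →L[ℝ] ℝ) z := by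
  have h1 := H.differentiableAt_psi₁ hz
  have hMd := H.contDiffM.differentiable (by norm_num)
  have hd : DifferentiableAt ℝ (cost M ψ₁ ψM α) z := by
    unfold cost tangentLine
    have h2 : ∀ k, DifferentiableAt ℝ (fun w : Fin M → ℝ => ψ₁ (w k)) z := fun k =>
      (h1 k).comp z (differentiableAt_apply (𝕜 := ℝ) (F' := fun _ : Fin M => ℝ) k z)
    have h3 : DifferentiableAt ℝ (fun w : Fin M → ℝ => (∑ k, w k) / (M : ℝ)) z := by fun_prop
    have h4 : DifferentiableAt ℝ (fun w : Fin M → ℝ => ψM ((∑ k, w k) / (M : ℝ))) z :=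
      (hMd _).comp z h3
    have h5 : DifferentiableAt ℝ (fun w : Fin M → ℝ => ∑ k, ψ₁ (w k)) z := by fun_prop
    fun_prop
  have hmin : IsLocalMin (cost M ψ₁ ψM α) z :=
    Eventually.of_forall fun w => by rw [hz]; exact H.cost_nonneg w
  have := hmin.hasFDerivAt_eq_zero hd.hasFDerivAt
  rw [← this]; exact hd.hasFDerivAt

/-- This is the vanishing of the partial derivative of the cost in the `k`-th entry, multiplied by
`M`. -/
theorem stationary (H : Admissible M W₁ W₂ ψ₁ ψM c α) {z : Fin M → ℝ}
    (hz : cost M ψ₁ ψM α z = 0) (k : Fin M) :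
    deriv ψ₁ (z k) + deriv ψM ((∑ j, z j) / M) = deriv (psiZeroConv M ψ₁ ψM) α := by
  classical
  have hM := H.pos
  have hline : HasDerivAt (fun t : ℝ => z + t • (Pi.single k 1 : Fin M → ℝ))
      (Pi.single k 1 : Fin M → ℝ) 0 := by
    simpa using ((hasDerivAt_id (0 : ℝ)).smul_const (Pi.single k 1 : Fin M → ℝ)).const_add z
  have h0 : HasDerivAt (fun t : ℝ => cost M ψ₁ ψM α (z + t • (Pi.single k 1 : Fin M → ℝ))) 0 0 := by
    have hz' : HasFDerivAt (cost M ψ₁ ψM α) (0 : (Fin M → ℝ) →L[ℝ] ℝ)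
        (z + (0 : ℝ) • (Pi.single k 1 : Fin M → ℝ)) := by simpa using H.hasFDerivAt_cost hz
    have h := hz'.comp_hasDerivAt (0 : ℝ) hline
    rwa [zero_apply] at h
  have hs : ∀ t : ℝ, ∑ j, (z + t • (Pi.single k 1 : Fin M → ℝ)) j = (∑ j, z j) + t := by
    intro t
    simp [Finset.sum_add_distrib, ← Finset.mul_sum]
  have h1 : HasDerivAt (fun t : ℝ => ((∑ j, z j) + t) / M) (1 / M) 0 :=
    ((hasDerivAt_id (0 : ℝ)).const_add _).div_const _
  have h2 : HasDerivAt (fun t : ℝ => ψM (((∑ j, z j) + t) / M))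
      (deriv ψM ((∑ j, z j) / M) * (1 / M)) 0 := by
    have hMd := (H.contDiffM.differentiable (by norm_num) ((∑ j, z j) / M)).hasDerivAt
    have hMd' : HasDerivAt ψM (deriv ψM ((∑ j, z j) / M)) (((∑ j, z j) + 0) / M) := by
      simpa using hMd
    exact hMd'.comp (0 : ℝ) h1
  have h3 : HasDerivAt (fun t : ℝ => ∑ j, ψ₁ ((z + t • (Pi.single k 1 : Fin M → ℝ)) j))
      (∑ j, deriv ψ₁ (z j) * (Pi.single k 1 : Fin M → ℝ) j) 0 := by
    refine HasDerivAt.fun_sum fun j _ => ?_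
    have h4 : HasDerivAt (fun t : ℝ => (z + t • (Pi.single k 1 : Fin M → ℝ)) j)
        ((Pi.single k 1 : Fin M → ℝ) j) 0 := hasDerivAt_pi.1 hline j
    have h5 : HasDerivAt ψ₁ (deriv ψ₁ (z j)) ((z + (0 : ℝ) • (Pi.single k 1 : Fin M → ℝ)) j) := by
      simpa using (H.differentiableAt_psi₁ hz j).hasDerivAt
    exact h5.comp (0 : ℝ) h4
  have h3' : ∑ j, deriv ψ₁ (z j) * (Pi.single k 1 : Fin M → ℝ) j = deriv ψ₁ (z k) := by
    simp [Pi.single_apply]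
  rw [h3'] at h3
  have h6 : HasDerivAt (fun t : ℝ => tangentLine M ψ₁ ψM α (((∑ j, z j) + t) / M))
      (deriv (psiZeroConv M ψ₁ ψM) α * (1 / M)) 0 := by
    unfold tangentLine
    exact ((h1.sub_const _).const_mul _).const_add _
  have h7 := (h2.add (h3.const_mul (1 / (M : ℝ)))).sub h6
  have h8 : (fun t : ℝ => cost M ψ₁ ψM α (z + t • (Pi.single k 1 : Fin M → ℝ))) =
      ((fun t : ℝ => ψM (((∑ j, z j) + t) / M)) + fun t =>
        1 / (M : ℝ) * ∑ j, ψ₁ ((z + t • (Pi.single k 1 : Fin M → ℝ)) j)) -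
        fun t => tangentLine M ψ₁ ψM α (((∑ j, z j) + t) / M) := by
    funext t
    rw [Pi.sub_apply, Pi.add_apply, cost, hs]
  rw [h8] at h0
  have h9 := h0.unique h7
  field_simp at h9
  linarith

/-- A common entry gives the same value of `ψ₁'` in the two stationarity conditions, hence the same
value of `ψ_M'` at the two means; strict convexity makes `ψ_M'` injective. This is what lets a
pattern propagate from a window to the next. -/
theorem sum_eq_of_shared_entry (H : Admissible M W₁ W₂ ψ₁ ψM c α) {z y : Fin M → ℝ}
    (hz : cost M ψ₁ ψM α z = 0) (hy : cost M ψ₁ ψM α y = 0) {j k : Fin M} (h : z j = y k) :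
    ∑ i, z i = ∑ i, y i := by
  have hM := H.pos
  have h1 := H.stationary hz j
  have h2 := H.stationary hy k
  rw [h] at h1
  have hinj := (H.convexM.strictMonoOn_deriv fun x _ =>
    H.contDiffM.differentiable (by norm_num) x).injOn
  have := hinj (mem_univ ((∑ i, z i) / (M : ℝ))) (mem_univ ((∑ i, y i) / (M : ℝ))) (by linarith)
  field_simp at this
  exact this

/-- The derivative of the cost is zero at each zero, and finiteness of the zero set makes the
estimate uniform. It makes small tilts of many cells asymptotically free. -/
theorem cost_add_le (H : Admissible M W₁ W₂ ψ₁ ψM c α) {κ : ℝ} (hκ : 0 < κ) :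
    ∃ ρ > 0, ∀ z, cost M ψ₁ ψM α z = 0 → ∀ h, ‖h‖ ≤ ρ → cost M ψ₁ ψM α (z + h) ≤ κ * ‖h‖ := by
  have h1 : ∀ᶠ h in 𝓝 (0 : Fin M → ℝ), ∀ z ∈ {z | cost M ψ₁ ψM α z = 0},
      cost M ψ₁ ψM α (z + h) ≤ κ * ‖h‖ := by
    rw [eventually_all_finite H.finite_zeros]
    intro z hz
    have h2 := hasFDerivAt_iff_isLittleO_nhds_zero.1 (H.hasFDerivAt_cost hz)
    filter_upwards [h2.bound hκ] with h hh
    have hz' : cost M ψ₁ ψM α z = 0 := hz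
    simp only [hz', sub_zero, zero_apply, Real.norm_eq_abs] at hh
    exact (le_abs_self _).trans hh
  obtain ⟨ρ, hρ, hball⟩ := Metric.nhds_basis_closedBall.mem_iff.1 h1
  exact ⟨ρ, hρ, fun z hz h hh => hball (by simpa using hh) z hz⟩

end Admissible

/-! ### Windows and periodic patterns -/

/-- The window `(d i, …, d (i + M - 1))` of a sequence. -/
def window (M : ℕ) (d : ℤ → ℝ) (i : ℤ) : Fin M → ℝ := fun k => d (i + ((k : ℕ) : ℤ))

/-- The `M`-periodic sequence with values `z 0, …, z (M - 1)`. -/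
def per {M : ℕ} [NeZero M] (z : Fin M → ℝ) (i : ℤ) : ℝ := z (Fin.ofNat M (i % (M : ℤ)).toNat)

theorem sum_filter_lt_succ {M : ℕ} (z : Fin M → ℝ) {r : ℤ} (k : Fin M) (hk : r = ((k : ℕ) : ℤ)) :
    ∑ j ∈ Finset.univ.filter (fun j : Fin M => ((j : ℕ) : ℤ) < r + 1), z j =
      ∑ j ∈ Finset.univ.filter (fun j : Fin M => ((j : ℕ) : ℤ) < r), z j + z k := by
  have : Finset.univ.filter (fun j : Fin M => ((j : ℕ) : ℤ) < r + 1) =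
      insert k (Finset.univ.filter (fun j : Fin M => ((j : ℕ) : ℤ) < r)) := by
    ext j
    simp only [Finset.mem_filter, Finset.mem_univ, true_and, Finset.mem_insert, Fin.ext_iff]
    omega
  rw [this, Finset.sum_insert (by simp [hk]), add_comm]

theorem sum_filter_lt_zero {M : ℕ} (z : Fin M → ℝ) {r : ℤ} (hr : r = 0) :
    ∑ j ∈ Finset.univ.filter (fun j : Fin M => ((j : ℕ) : ℤ) < r), z j = 0 := by
  subst hr
  rw [Finset.filter_false_of_mem (fun k _ => by omega), Finset.sum_empty]

theorem profile_zero {M : ℕ} (z : Fin M → ℝ) : profile z 0 = 0 := by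
  unfold profile
  rw [sum_filter_lt_zero z (Int.zero_emod _)]
  simp

section Patterns
variable {M : ℕ} [NeZero M]

theorem natCast_pos_of_neZero : (0 : ℤ) < M := by exact_mod_cast Nat.pos_of_ne_zero (NeZero.ne M)

theorem per_of_emod {z : Fin M → ℝ} {i : ℤ} {k : Fin M} (h : i % (M : ℤ) = ((k : ℕ) : ℤ)) :
    per z i = z k := by
  unfold per
  congr 1
  rw [h, Int.toNat_natCast]
  ext
  simp

theorem per_congr (z : Fin M → ℝ) {i j : ℤ} (h : i % (M : ℤ) = j % (M : ℤ)) :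
    per z i = per z j := by unfold per; rw [h]

theorem per_mul_add (z : Fin M → ℝ) (j i : ℤ) : per z (M * j + i) = per z i :=
  per_congr z (by simp)

theorem per_coe (z : Fin M → ℝ) (k : Fin M) : per z ((k : ℕ) : ℤ) = z k :=
  per_of_emod (Int.emod_eq_of_lt (by positivity) (by exact_mod_cast k.2))

theorem window_per_mul (z : Fin M → ℝ) (j : ℤ) : window M (per z) (M * j) = z := by
  funext k
  rw [window, per_mul_add, per_coe]

/-- The rotation by `i` of the indices modulo `M`. -/
noncomputable def rotation (M : ℕ) [NeZero M] (i : ℤ) : Equiv.Perm (Fin M) :=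
  Equiv.ofBijective (fun k : Fin M => Fin.ofNat M ((i + ((k : ℕ) : ℤ)) % (M : ℤ)).toNat) <| by
    refine Finite.injective_iff_bijective.1 fun j k h => ?_
    have hM := natCast_pos_of_neZero (M := M)
    have h1 := congrArg Fin.val h
    simp only [Fin.ofNat] at h1
    have hlt : ∀ x : ℤ, (x % (M : ℤ)).toNat % M = (x % (M : ℤ)).toNat := fun x =>
      Nat.mod_eq_of_lt (by have := Int.emod_lt_of_pos x hM; have := Int.emod_nonneg x hM.ne'; omega)
    rw [hlt, hlt] at h1
    have h2 : (i + ((j : ℕ) : ℤ)) % (M : ℤ) = (i + ((k : ℕ) : ℤ)) % (M : ℤ) := by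
      have := Int.emod_nonneg (i + ((j : ℕ) : ℤ)) hM.ne'
      have := Int.emod_nonneg (i + ((k : ℕ) : ℤ)) hM.ne'
      omega
    have h3 : ((j : ℕ) : ℤ) % M = ((k : ℕ) : ℤ) % M := by
      exact Int.ModEq.add_left_cancel' i h2
    rw [Int.emod_eq_of_lt (by positivity) (by exact_mod_cast j.2),
      Int.emod_eq_of_lt (by positivity) (by exact_mod_cast k.2)] at h3
    ext; exact_mod_cast h3

theorem window_per_eq (z : Fin M → ℝ) (i : ℤ) : window M (per z) i = z ∘ rotation M i := rfl

theorem profile_succ (z : Fin M → ℝ) (i : ℤ) : profile z (i + 1) - profile z i = per z i := by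
  have hM := natCast_pos_of_neZero (M := M)
  have h0 := Int.emod_nonneg i hM.ne'
  have h1 := Int.emod_lt_of_pos i hM
  obtain ⟨k, hk⟩ : ∃ k : Fin M, i % (M : ℤ) = ((k : ℕ) : ℤ) :=
    ⟨⟨(i % (M : ℤ)).toNat, by omega⟩, by simp [h0]⟩
  rw [per_of_emod hk]
  have hstep := sum_filter_lt_succ z k hk
  have hdiv := Int.emod_add_mul_ediv i M
  unfold profile
  -- Either `i + 1` stays in the block of `i`, or it opens the next block, where the partial sum
  -- restarts at zero and one full sum is added.
  rcases lt_or_eq_of_le (Int.add_one_le_of_lt h1) with h | h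
  · have e1 : (i + 1) / (M : ℤ) = i / M := by
      rw [Int.ediv_eq_iff_of_pos hM]
      constructor <;> nlinarith
    have e2 : (i + 1) % (M : ℤ) = i % M + 1 := by
      have := Int.emod_add_mul_ediv (i + 1) M
      rw [e1] at this; linarith
    rw [e1, e2, hstep]; ring
  · have e1 : (i + 1) / (M : ℤ) = i / M + 1 := by
      rw [Int.ediv_eq_iff_of_pos hM]
      constructor <;> nlinarith
    have e2 : (i + 1) % (M : ℤ) = 0 := by
      have := Int.emod_add_mul_ediv (i + 1) M
      rw [e1] at this; linarith
    have e3 : ∑ j ∈ Finset.univ.filter (fun j : Fin M => ((j : ℕ) : ℤ) < i % (M : ℤ) + 1), z j =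
        ∑ j, z j := by
      rw [Finset.filter_true_of_mem fun j _ => ?_]
      rw [h]; exact_mod_cast j.2
    rw [e3] at hstep
    have e4 : ∑ j ∈ Finset.univ.filter (fun j : Fin M => ((j : ℕ) : ℤ) < (i + 1) % (M : ℤ)), z j
        = 0 := sum_filter_lt_zero z e2
    rw [e1, e4]; push_cast; linarith

end Patterns

theorem sum_window_diff (M : ℕ) (v : ℤ → ℝ) (i : ℤ) :
    ∑ k, window M (fun j => v (j + 1) - v j) i k = v (i + M) - v i := by
  unfold window
  rw [Fin.sum_univ_eq_sum_range (fun k => v (i + (k : ℤ) + 1) - v (i + (k : ℤ))) M]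
  have := Finset.sum_range_sub (fun k : ℕ => v (i + (k : ℤ))) M
  simpa [add_assoc] using this

theorem cellEnergy_eq_cost (M : ℕ) (ψ₁ ψM : ℝ → ℝ) (α : ℝ) (v : ℤ → ℝ) (i : ℤ) :
    cellEnergy M ψ₁ ψM α v i = cost M ψ₁ ψM α (window M (fun j => v (j + 1) - v j) i) := by
  unfold cellEnergy cost
  rw [sum_window_diff]
  congr 3
  rw [← Fin.sum_univ_eq_sum_range (fun k => ψ₁ (v (i + (k : ℤ) + 1) - v (i + (k : ℤ)))) M]
  rfl

theorem exists_primitive (d : ℤ → ℝ) (i₀ : ℤ) (a : ℝ) :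
    ∃ v : ℤ → ℝ, v i₀ = a ∧ ∀ i, v (i + 1) - v i = d i := by
  have key : ∃ v : ℤ → ℝ, ∀ i, v (i + 1) - v i = d i := by
    refine ⟨fun i => ∑ j ∈ Finset.Ico 0 i, d j - ∑ j ∈ Finset.Ico i 0, d j, fun i => ?_⟩
    dsimp only
    rcases le_or_gt 0 i with h | h
    · have e : Finset.Ico 0 (i + 1) = insert i (Finset.Ico 0 i) := by
        ext j; simp only [Finset.mem_Ico, Finset.mem_insert]; omega
      rw [e, Finset.sum_insert (by simp), Finset.Ico_eq_empty (a := i) (by omega),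
        Finset.Ico_eq_empty (a := i + 1) (by omega)]
      simp
    · have e : Finset.Ico i 0 = insert i (Finset.Ico (i + 1) 0) := by
        ext j; simp only [Finset.mem_Ico, Finset.mem_insert]; omega
      rw [e, Finset.sum_insert (by simp), Finset.Ico_eq_empty (a := 0) (b := i) (by omega),
        Finset.Ico_eq_empty (a := 0) (b := i + 1) (by omega)]
      simp
  obtain ⟨v, hv⟩ := key
  exact ⟨fun i => v i + (a - v i₀), by simp, fun i => by simp [hv]⟩

theorem sub_eq_of_succ_sub_eq_of_le {v w : ℤ → ℝ} {a : ℤ}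
    (h : ∀ i, a ≤ i → v (i + 1) - v i = w (i + 1) - w i) {i : ℤ} (hi : a ≤ i) :
    v i - w i = v a - w a := by
  induction i, hi using Int.leInduction with
  | base => rfl
  | succ i hi ih => linarith [h i hi]

theorem sub_eq_of_succ_sub_eq_of_ge {v w : ℤ → ℝ} {a : ℤ}
    (h : ∀ i, i < a → v (i + 1) - v i = w (i + 1) - w i) {i : ℤ} (hi : i ≤ a) :
    v i - w i = v a - w a := by
  induction i, hi using Int.leInductionDown with
  | base => rfl
  | pred i hi ih =>
    have := h (i - 1) (by omega)
    rw [sub_add_cancel] at this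
    linarith

/-! ### Abstract costs -/

/-- The properties of the cost of a window that the asymptotic analysis uses. -/
structure IsWellCost {M : ℕ} (G : (Fin M → ℝ) → ℝ) : Prop where
  two_le : 2 ≤ M
  nonneg : ∀ w, 0 ≤ G w
  continuous : Continuous G
  comp_perm : ∀ (σ : Equiv.Perm (Fin M)) w, G (w ∘ σ) = G w
  coercive : ∃ A : ℝ, 0 < A ∧ ∀ w, ‖w‖ ≤ A * (1 + G w)
  finite_zeros : {z | G z = 0}.Finite
  add_le : ∀ κ : ℝ, 0 < κ → ∃ ρ > 0, ∀ z, G z = 0 → ∀ h, ‖h‖ ≤ ρ → G (z + h) ≤ κ * ‖h‖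
  sum_eq : ∀ z y, G z = 0 → G y = 0 → ∀ j k, z j = y k → ∑ i, z i = ∑ i, y i

theorem Admissible.isWellCost {M : ℕ} {W₁ W₂ ψ₁ ψM : ℝ → ℝ} {c α : ℝ}
    (H : Admissible M W₁ W₂ ψ₁ ψM c α) : IsWellCost (cost M ψ₁ ψM α) where
  two_le := H.two_le
  nonneg := H.cost_nonneg
  continuous := H.continuous_cost
  comp_perm := cost_comp_perm
  coercive := H.coercive_cost
  finite_zeros := H.finite_zeros
  add_le := fun _ hκ => H.cost_add_le hκ
  sum_eq := fun _ _ hz hy _ _ h => H.sum_eq_of_shared_entry hz hy h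

/-! ### Low cost, closeness to zeros, and rigidity of patterns -/

namespace IsWellCost

variable {M : ℕ} {G : (Fin M → ℝ) → ℝ}

theorem neZero (hG : IsWellCost G) : NeZero M := ⟨by have := hG.two_le; omega⟩

theorem window_per [NeZero M] (hG : IsWellCost G) (z : Fin M → ℝ) (i : ℤ) :
    G (window M (per z) i) = G z := by rw [window_per_eq, hG.comp_perm]

/-- Away from its zeros the cost has a positive minimum on a compact set, and coercivity keeps
tuples of small cost in a ball. -/
theorem exists_near (hG : IsWellCost G) {η : ℝ} (hη : 0 < η) :
    ∃ δ > 0, ∀ w, G w < δ → ∃ z, G z = 0 ∧ ‖w - z‖ < η := by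
  obtain ⟨A, hA, hco⟩ := hG.coercive
  -- Coercivity puts every tuple of cost less than `1` in the ball of radius `2A`.
  set K : Set (Fin M → ℝ) := Metric.closedBall 0 (A * 2) ∩ {w | ∀ z ∈ {z | G z = 0}, η ≤ ‖w - z‖}
    with hK
  have hcl : IsClosed {w : Fin M → ℝ | ∀ z ∈ {z | G z = 0}, η ≤ ‖w - z‖} := by
    have : {w : Fin M → ℝ | ∀ z ∈ {z | G z = 0}, η ≤ ‖w - z‖} =
        ⋂ z ∈ {z | G z = 0}, {w : Fin M → ℝ | η ≤ ‖w - z‖} := by ext; simp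
    rw [this]
    exact isClosed_biInter fun z _ => isClosed_le continuous_const (by fun_prop)
  have hKc : IsCompact K := (isCompact_closedBall _ _).inter_right hcl
  have main : ∃ δ > 0, ∀ w ∈ K, δ ≤ G w := by
    rcases K.eq_empty_or_nonempty with h | h
    · exact ⟨1, one_pos, by simp [h]⟩
    · obtain ⟨w, hw, hmin⟩ := hKc.exists_isMinOn h hG.continuous.continuousOn
      refine ⟨G w, ?_, fun y hy => hmin hy⟩
      refine lt_of_le_of_ne (hG.nonneg w) fun h0 => ?_
      have := hw.2 w h0.symm
      simp at this; linarith
  obtain ⟨δ, hδ, hδK⟩ := main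
  refine ⟨min δ 1, by positivity, fun w hw => ?_⟩
  by_contra! hcon
  have hwK : w ∈ K := by
    refine ⟨?_, fun z hz => hcon z hz⟩
    have h1 := hco w
    have h2 := hw.trans_le (min_le_right _ _)
    simp only [Metric.mem_closedBall, dist_zero_right]
    nlinarith
  exact absurd (hδK w hwK) (not_le.2 (hw.trans_le (min_le_left _ _)))

/-- The differences between entries of zeros form a finite set, whose nonzero elements stay away
from `0`. Entries at different positions are compared as well, since overlapping windows match
shifted positions. -/
theorem exists_separation (hG : IsWellCost G) : ∃ η > 0, ∀ z y, G z = 0 → G y = 0 →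
    ∀ j k, |z j - y k| ≤ 2 * η → z j = y k := by
  have hfin : ((fun p : ((Fin M → ℝ) × (Fin M → ℝ)) × (Fin M × Fin M) =>
      |p.1.1 p.2.1 - p.1.2 p.2.2|) ''
      (({z | G z = 0} ×ˢ {z | G z = 0}) ×ˢ univ) \ {0}).Finite :=
    (((hG.finite_zeros.prod hG.finite_zeros).prod finite_univ).image _).sdiff
  have h0 : (0 : ℝ) ∉ (fun p : ((Fin M → ℝ) × (Fin M → ℝ)) × (Fin M × Fin M) =>
      |p.1.1 p.2.1 - p.1.2 p.2.2|) ''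
      (({z | G z = 0} ×ˢ {z | G z = 0}) ×ˢ univ) \ {0} := by simp
  have hev := hfin.isClosed.isOpen_compl.mem_nhds h0
  obtain ⟨η, hη, hball⟩ := Metric.nhds_basis_closedBall.mem_iff.1 hev
  refine ⟨η / 2, by positivity, fun z y hz hy j k h => ?_⟩
  by_contra hne
  have : |z j - y k| ∈ Metric.closedBall (0 : ℝ) η := by
    simpa using (by linarith : |z j - y k| ≤ η)
  refine hball this ⟨⟨((z, y), (j, k)), ⟨⟨hz, hy⟩, mem_univ _⟩, rfl⟩, ?_⟩
  simpa [sub_eq_zero] using hne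

/-- Where all the windows are close to zeros of the cost, the sequence follows a single pattern. -/
theorem exists_pattern [NeZero M] (hG : IsWellCost G) {η : ℝ}
    (hη : ∀ z y, G z = 0 → G y = 0 → ∀ j k, |z j - y k| ≤ 2 * η → z j = y k)
    (d : ℤ → ℝ) {a b : ℤ} (hab : a ≤ b)
    (hd : ∀ i, a ≤ i → i ≤ b → ∃ y, G y = 0 ∧ ‖window M d i - y‖ ≤ η) :
    ∃ z, G z = 0 ∧ ∀ i, a ≤ i → i ≤ b → ‖window M d i - window M (per z) i‖ ≤ η := by
  have hM := natCast_pos_of_neZero (M := M)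
  have h2 := hG.two_le
  obtain ⟨y, hy0, hy⟩ := hd a le_rfl hab
  -- Patterns are indexed from site `0`, while `y` is read from site `a`; rotating by `-a` gives the
  -- tuple whose periodic extension shows `y` at `a`.
  have hz : window M (per (window M (per y) (-a))) a = y := by
    funext k
    have h1 := Int.emod_nonneg (a + ((k : ℕ) : ℤ)) hM.ne'
    have h2 := Int.emod_lt_of_pos (a + ((k : ℕ) : ℤ)) hM
    set r := (a + ((k : ℕ) : ℤ)) % (M : ℤ) with hr
    have e : per (window M (per y) (-a)) (a + ((k : ℕ) : ℤ)) =
        window M (per y) (-a) ⟨r.toNat, by omega⟩ :=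
      per_of_emod (by simp [← hr, h1])
    rw [window, e, window, ← per_coe y k]
    refine per_congr _ ?_
    simp only [Int.toNat_of_nonneg h1]
    rw [hr, Int.add_emod_emod]
    congr 1; ring
  refine ⟨window M (per y) (-a), by rw [hG.window_per, hy0], ?_⟩
  set z := window M (per y) (-a) with hzdef
  have hz0 : G z = 0 := by rw [hzdef, hG.window_per, hy0]
  intro i hai
  induction i, hai using Int.leInduction with
  | base => intro _; rwa [hz]
  | succ i hi ih =>
    intro hib
    have ih := ih (by omega)
    obtain ⟨x, hx0, hx⟩ := hd (i + 1) (by omega) hib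
    suffices x = window M (per z) (i + 1) by rwa [← this]
    have hw0 : G (window M (per z) i) = 0 := by rw [hG.window_per, hz0]
    have hw1 : G (window M (per z) (i + 1)) = 0 := by rw [hG.window_per, hz0]
    have hx' : ∀ k : Fin M, |d (i + 1 + ((k : ℕ) : ℤ)) - x k| ≤ η := fun k =>
      (norm_le_pi_norm (window M d (i + 1) - x) k).trans hx
    have ih' : ∀ k : Fin M, |d (i + ((k : ℕ) : ℤ)) - per z (i + ((k : ℕ) : ℤ))| ≤ η := fun k =>
      (norm_le_pi_norm (window M d i - window M (per z) i) k).trans ih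
    -- On the `M - 1` common sites both zeros are within `η` of `d`, so separation makes them equal
    -- there.
    have hlow : ∀ k : Fin M, ∀ hk : (k : ℕ) + 1 < M, x k = window M (per z) i ⟨k + 1, hk⟩ := by
      intro k hk
      refine hη _ _ hx0 hw0 _ _ ?_
      have h1 := hx' k
      have h2 := ih' ⟨k + 1, hk⟩
      simp only [window]
      have e : i + (((k : ℕ) + 1 : ℕ) : ℤ) = i + 1 + ((k : ℕ) : ℤ) := by push_cast; ring
      simp only [e] at h2 ⊢
      rw [abs_le] at h1 h2 ⊢
      constructor <;> linarith
    have hlow' : ∀ k : Fin M, (k : ℕ) + 1 < M → x k = window M (per z) (i + 1) k := by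
      intro k hk
      rw [hlow k hk]
      simp only [window]
      congr 1; push_cast; ring
    -- Since `M ≥ 2` at least one entry is shared, so the sums agree, and the only entry not yet
    -- determined is forced.
    have hsum : ∑ k, x k = ∑ k, window M (per z) (i + 1) k := by
      have e1 : ∑ k, x k = ∑ k, window M (per z) i k :=
        hG.sum_eq _ _ hx0 hw0 _ _ (hlow ⟨0, by omega⟩ (by simp; omega))
      rw [e1, window_per_eq, window_per_eq]
      exact (Equiv.sum_comp (rotation M i) z).trans (Equiv.sum_comp (rotation M (i + 1)) z).symm
    let l : Fin M := ⟨M - 1, by omega⟩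
    have hrest : ∀ k ∈ Finset.univ.erase l, x k = window M (per z) (i + 1) k := by
      intro k hk
      refine hlow' k ?_
      have h1 : k ≠ l := Finset.ne_of_mem_erase hk
      have h2 : (k : ℕ) ≠ M - 1 := fun h => h1 (Fin.ext h)
      have := k.2
      omega
    have hlast : x l = window M (per z) (i + 1) l := by
      rw [← Finset.add_sum_erase _ _ (Finset.mem_univ l),
        ← Finset.add_sum_erase _ (window M (per z) (i + 1)) (Finset.mem_univ l),
        Finset.sum_congr rfl hrest] at hsum
      linarith
    funext k
    by_cases hk : k = l
    · rw [hk, hlast]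
    · exact hrest k (by simp [hk])

end IsWellCost

/-! ### The transition energy in terms of slopes -/

/-- The sequence follows the pattern `z` on the left of `-N` and `z'` on the right of `N`. -/
def Connects {M : ℕ} [NeZero M] (N : ℕ) (z z' : Fin M → ℝ) (d : ℤ → ℝ) : Prop :=
  (∀ i : ℤ, i < -(N : ℤ) → d i = per z i) ∧ ∀ i : ℤ, (N : ℤ) ≤ i → d i = per z' i

theorem Connects.mono {M : ℕ} [NeZero M] {N N' : ℕ} {z z' : Fin M → ℝ} {d : ℤ → ℝ}
    (h : Connects N z z' d) (hN : N ≤ N') : Connects N' z z' d :=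
  ⟨fun i hi => h.1 i (by omega), fun i hi => h.2 i (by omega)⟩

/-- A window covers `M` sites, so one starting before `-N - M` or from `N` on lies entirely in one
of the two patterns. -/
theorem Connects.cost_eq_zero {M : ℕ} [NeZero M] {N : ℕ} {z z' : Fin M → ℝ} {d : ℤ → ℝ}
    {G : (Fin M → ℝ) → ℝ} (hG : IsWellCost G) (hz : G z = 0) (hz' : G z' = 0)
    (h : Connects N z z' d) {i : ℤ} (hi : i ∉ Finset.Ico (-(N : ℤ) - M) N) :
    G (window M d i) = 0 := by
  rw [Finset.mem_Ico, not_and_or] at hi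
  rcases hi with hi | hi
  · have : window M d i = window M (per z) i := by
      funext k
      have := k.2
      exact h.1 _ (by omega)
    rw [this, hG.window_per, hz]
  · have : window M d i = window M (per z') i := by
      funext k
      exact h.2 _ (by omega)
    rw [this, hG.window_per, hz']

section Transition
variable {M : ℕ} {ψ₁ ψM : ℝ → ℝ} {α : ℝ}

theorem tsum_cellEnergy_nonneg (hG : IsWellCost (cost M ψ₁ ψM α)) (v : ℤ → ℝ) :
    0 ≤ ∑' i, cellEnergy M ψ₁ ψM α v i :=
  tsum_nonneg fun i => by rw [cellEnergy_eq_cost]; exact hG.nonneg _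

theorem transitionEnergy_le_tsum (hG : IsWellCost (cost M ψ₁ ψM α)) {N : ℕ} {z z' : Fin M → ℝ}
    {v : ℤ → ℝ} (hl : ∀ i : ℤ, i ≤ -(N : ℤ) → v i = profile z i)
    (hr : ∀ i : ℤ, (N : ℤ) ≤ i → v i = profile z' i) :
    transitionEnergy M ψ₁ ψM α z z' ≤ ∑' i, cellEnergy M ψ₁ ψM α v i := by
  unfold transitionEnergy
  refine (ciInf_le ?_ N).trans (csInf_le ?_ ⟨v, hl, hr, rfl⟩)
  · refine ⟨0, ?_⟩
    rintro _ ⟨N, rfl⟩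
    refine Real.sInf_nonneg ?_
    rintro _ ⟨v, -, -, rfl⟩
    exact tsum_cellEnergy_nonneg hG v
  · refine ⟨0, ?_⟩
    rintro _ ⟨v, -, -, rfl⟩
    exact tsum_cellEnergy_nonneg hG v

variable [NeZero M]

theorem tsum_cellEnergy_eq (hG : IsWellCost (cost M ψ₁ ψM α)) {N : ℕ} {z z' : Fin M → ℝ}
    (hz : cost M ψ₁ ψM α z = 0) (hz' : cost M ψ₁ ψM α z' = 0) {v : ℤ → ℝ}
    (h : Connects N z z' fun i => v (i + 1) - v i) :
    ∑' i, cellEnergy M ψ₁ ψM α v i = ∑ i ∈ Finset.Ico (-(N : ℤ) - M) N,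
      cost M ψ₁ ψM α (window M (fun i => v (i + 1) - v i) i) := by
  rw [tsum_eq_sum (s := Finset.Ico (-(N : ℤ) - M) N)]
  · exact Finset.sum_congr rfl fun i _ => cellEnergy_eq_cost _ _ _ _ _ _
  · intro i hi
    rw [cellEnergy_eq_cost]
    exact h.cost_eq_zero hG hz hz' hi

theorem exists_connects_of_lt (hG : IsWellCost (cost M ψ₁ ψM α)) {z z' : Fin M → ℝ}
    (hz : cost M ψ₁ ψM α z = 0) (hz' : cost M ψ₁ ψM α z' = 0) {e : ℝ}
    (he : transitionEnergy M ψ₁ ψM α z z' < e) :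
    ∃ N : ℕ, ∃ d, Connects N z z' d ∧
      ∑ i ∈ Finset.Ico (-(N : ℤ) - M) N, cost M ψ₁ ψM α (window M d i) < e := by
  obtain ⟨N, hN⟩ := exists_lt_of_ciInf_lt he
  -- The set of energies must be nonempty for its infimum to be meaningful. The two profiles can be
  -- glued at `0` for every `N`, including `N = 0`, because both vanish there.
  obtain ⟨_, ⟨v, hl, hr, rfl⟩, hv⟩ := exists_lt_of_csInf_lt (by
    refine ⟨_, fun i => if i ≤ 0 then profile z i else profile z' i, ?_, ?_, rfl⟩
    · intro i hi
      exact if_pos (by omega)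
    · intro i hi
      dsimp only
      split_ifs with h
      · have : i = 0 := by omega
        rw [this, profile_zero, profile_zero]
      · rfl) hN
  have hc : Connects N z z' fun i => v (i + 1) - v i := by
    refine ⟨fun i hi => ?_, fun i hi => ?_⟩
    · dsimp only
      rw [hl _ (by omega), hl _ (by omega), profile_succ]
    · dsimp only
      rw [hr _ (by omega), hr _ (by omega), profile_succ]
  refine ⟨N, _, hc, ?_⟩
  rwa [← tsum_cellEnergy_eq hG hz hz' hc]

/-- A connecting sequence of slopes bounds the transition energy from above, whatever the offset
between the two profiles is: the offset is removed by a small tilt of many cells. -/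
theorem transitionEnergy_le_of_connects (hG : IsWellCost (cost M ψ₁ ψM α)) {z z' : Fin M → ℝ}
    (hz : cost M ψ₁ ψM α z = 0) (hz' : cost M ψ₁ ψM α z' = 0) {N : ℕ} {d : ℤ → ℝ}
    (hd : Connects N z z' d) :
    transitionEnergy M ψ₁ ψM α z z' ≤
      ∑ i ∈ Finset.Ico (-(N : ℤ) - M) N, cost M ψ₁ ψM α (window M d i) := by
  obtain ⟨v, hv0, hv⟩ := exists_primitive d (-(N : ℤ)) (profile z (-(N : ℤ)))
  have hvl : ∀ i : ℤ, i ≤ -(N : ℤ) → v i = profile z i := by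
    intro i hi
    have := sub_eq_of_succ_sub_eq_of_ge (v := v) (w := profile z) (a := -(N : ℤ))
      (fun j hj => by rw [hv, profile_succ, hd.1 j hj]) hi
    rw [hv0] at this; linarith
  set s := v N - profile z' N with hs
  have hvr : ∀ i : ℤ, (N : ℤ) ≤ i → v i = profile z' i + s := by
    intro i hi
    have := sub_eq_of_succ_sub_eq_of_le (v := v) (w := profile z') (a := (N : ℤ))
      (fun j hj => by rw [hv, profile_succ, hd.2 j hj]) hi
    linarith
  -- the tilted sequences
  let c : ℕ → ℤ → ℝ := fun K i => max 0 (min ((i : ℝ) - N) (K + 1))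
  let V : ℕ → ℤ → ℝ := fun K i => v i - s / (K + 1) * c K i
  let D : ℕ → ℤ → ℝ := fun K i => V K (i + 1) - V K i
  have hcstep : ∀ K i, |c K (i + 1) - c K i| ≤ 1 := by
    intro K i
    have e : ((i + 1 : ℤ) : ℝ) - N = (i : ℝ) - N + 1 := by push_cast; ring
    have h1 : |max 0 (min (((i + 1 : ℤ) : ℝ) - N) (K + 1)) - max 0 (min ((i : ℝ) - N) (K + 1))| ≤
        |min (((i + 1 : ℤ) : ℝ) - N) ((K : ℝ) + 1) - min ((i : ℝ) - N) (K + 1)| := by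
      have := abs_max_sub_max_le_abs (min (((i + 1 : ℤ) : ℝ) - N) ((K : ℝ) + 1))
        (min ((i : ℝ) - N) ((K : ℝ) + 1)) (0 : ℝ)
      rwa [max_comm 0, max_comm 0]
    have h2 := abs_min_sub_min_le_max (((i + 1 : ℤ) : ℝ) - N) ((K : ℝ) + 1) ((i : ℝ) - N)
      ((K : ℝ) + 1)
    rw [e] at h2
    simp only [add_sub_cancel_left, sub_self, abs_one, abs_zero] at h2
    rw [← e] at h2
    exact h1.trans (h2.trans (by simp))
  have hcz : ∀ K (i : ℤ), i ≤ N → c K i = 0 := by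
    intro K i hi
    have : (i : ℝ) ≤ N := by exact_mod_cast hi
    exact max_eq_left (min_le_iff.2 (Or.inl (by linarith)))
  have hcK : ∀ (K : ℕ) (i : ℤ), (N : ℤ) + (K + 1) ≤ i → c K i = K + 1 := by
    intro K i hi
    have : (N : ℝ) + (K + 1) ≤ (i : ℝ) := by exact_mod_cast hi
    have h2 : min ((i : ℝ) - N) (K + 1) = K + 1 := min_eq_right (by linarith)
    show max 0 (min ((i : ℝ) - N) (K + 1)) = K + 1
    rw [h2]; exact max_eq_right (by positivity)
  have hD : ∀ K i, D K i = d i - s / (K + 1) * (c K (i + 1) - c K i) := by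
    intro K i
    show (v (i + 1) - _) - (v i - _) = _
    rw [← hv]; ring
  have hVl : ∀ (K : ℕ) (i : ℤ), i ≤ -((N + (K + 1) : ℕ) : ℤ) → V K i = profile z i := by
    intro K i hi
    show v i - _ = _
    rw [hcz K i (by omega), hvl i (by omega)]; simp
  have hVr : ∀ (K : ℕ) (i : ℤ), ((N + (K + 1) : ℕ) : ℤ) ≤ i → V K i = profile z' i := by
    intro K i hi
    show v i - _ = _
    rw [hcK K i (by push_cast at hi; omega), hvr i (by omega)]
    field_simp; ring
  have hclose : ∀ K i, ‖window M (D K) i - window M d i‖ ≤ |s| / (K + 1) := by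
    intro K i
    refine (pi_norm_le_iff_of_nonneg (by positivity)).2 fun k => ?_
    simp only [window, Pi.sub_apply, hD]
    rw [sub_sub_cancel_left, norm_neg, Real.norm_eq_abs, abs_mul, abs_div,
      abs_of_pos (by positivity : (0 : ℝ) < K + 1)]
    have := mul_le_mul_of_nonneg_left (hcstep K (i + ((k : ℕ) : ℤ)))
      (by positivity : 0 ≤ |s| / ((K : ℝ) + 1))
    linarith
  -- The first sum has a number of cells independent of `K` and tends to the given energy; the
  -- second contains the `K + 1` cells that start on the ramp.
  have hupper : ∀ K, transitionEnergy M ψ₁ ψM α z z' ≤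
      ∑ i ∈ Finset.Ico (-(N : ℤ) - M) N, cost M ψ₁ ψM α (window M (D K) i) +
        ∑ i ∈ Finset.Ico (N : ℤ) (N + (K + 1)), cost M ψ₁ ψM α (window M (D K) i) := by
    intro K
    refine (transitionEnergy_le_tsum hG (hVl K) (hVr K)).trans ?_
    have hsupp : ∀ i ∉ Finset.Ico (-(N : ℤ) - M) N ∪ Finset.Ico (N : ℤ) (N + (K + 1)),
        cellEnergy M ψ₁ ψM α (V K) i = 0 := by
      intro i hi
      simp only [Finset.mem_union, Finset.mem_Ico, not_or, not_and_or] at hi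
      rw [cellEnergy_eq_cost]
      have hcase : i < -(N : ℤ) - M ∨ (N : ℤ) + (K + 1) ≤ i := by omega
      rcases hcase with h | h
      · have : window M (D K) i = window M (per z) i := by
          funext k
          have := k.2
          simp only [window]
          rw [hD, hcz K _ (by omega), hcz K _ (by omega), hd.1 _ (by omega)]
          simp
        exact (congrArg _ this).trans ((hG.window_per z i).trans hz)
      · have : window M (D K) i = window M (per z') i := by
          funext k
          simp only [window]
          rw [hD, hcK K _ (by omega), hcK K _ (by omega), hd.2 _ (by omega)]
          simp
        exact (congrArg _ this).trans ((hG.window_per z' i).trans hz')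
    rw [tsum_eq_sum hsupp, Finset.sum_union]
    · exact le_of_eq (congrArg₂ _ (Finset.sum_congr rfl fun i _ => cellEnergy_eq_cost _ _ _ _ _ _)
        (Finset.sum_congr rfl fun i _ => cellEnergy_eq_cost _ _ _ _ _ _))
    · rw [Finset.disjoint_left]
      intro i h1 h2
      simp only [Finset.mem_Ico] at h1 h2
      omega
  have hs0 : Tendsto (fun K : ℕ => |s| / ((K : ℝ) + 1)) atTop (𝓝 0) :=
    tendsto_const_nhds.div_atTop (tendsto_natCast_atTop_atTop.atTop_add tendsto_const_nhds)
  have hmain : Tendsto (fun K => ∑ i ∈ Finset.Ico (-(N : ℤ) - M) N,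
      cost M ψ₁ ψM α (window M (D K) i)) atTop
      (𝓝 (∑ i ∈ Finset.Ico (-(N : ℤ) - M) N, cost M ψ₁ ψM α (window M d i))) := by
    refine tendsto_finsetSum _ fun i _ => (hG.continuous.tendsto _).comp ?_
    rw [tendsto_iff_norm_sub_tendsto_zero]
    exact squeeze_zero (fun _ => norm_nonneg _) (fun K => hclose K i) hs0
  refine le_of_forall_pos_le_add fun κ hκ => ?_
  -- Each of the `K + 1` ramp cells is displaced by at most `|s|/(K + 1)`, so together they cost at
  -- most `κ |s|/(|s| + 1) ≤ κ`.
  obtain ⟨ρ, hρ, hadd⟩ := hG.add_le (κ / (|s| + 1)) (by positivity)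
  refine ge_of_tendsto (hmain.add_const κ) ?_
  filter_upwards [hs0.eventually (ge_mem_nhds hρ)] with K hK
  refine (hupper K).trans (add_le_add_right ?_ _)
  have hcell : ∀ i ∈ Finset.Ico (N : ℤ) (N + (K + 1)),
      cost M ψ₁ ψM α (window M (D K) i) ≤ κ / (|s| + 1) * (|s| / (K + 1)) := by
    intro i hi
    rw [Finset.mem_Ico] at hi
    have hw : window M d i = window M (per z') i := by
      funext k
      exact hd.2 _ (by omega)
    have h1 := hclose K i
    have h2 := hadd (window M d i) (by rw [hw, hG.window_per, hz'])
      (window M (D K) i - window M d i) (h1.trans hK)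
    rw [add_sub_cancel] at h2
    exact h2.trans (mul_le_mul_of_nonneg_left h1 (by positivity))
  refine (Finset.sum_le_card_nsmul _ _ _ hcell).trans ?_
  have hcard : (Finset.Ico (N : ℤ) (N + (K + 1))).card = K + 1 := by simp
  rw [hcard, nsmul_eq_mul]
  push_cast
  have e : ((K : ℝ) + 1) * (κ / (|s| + 1) * (|s| / (K + 1))) = κ * (|s| / (|s| + 1)) := by
    field_simp
  rw [e]
  have : |s| / (|s| + 1) ≤ 1 := by rw [div_le_one (by positivity)]; linarith
  nlinarith

/-- Cutting a sequence at two cells that are close to zeros of the cost and pasting exact patterns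
on the two sides. -/
theorem transitionEnergy_le_of_near (hG : IsWellCost (cost M ψ₁ ψM α)) {z z' : Fin M → ℝ}
    (hz : cost M ψ₁ ψM α z = 0) (hz' : cost M ψ₁ ψM α z' = 0) {κ η : ℝ} (hκ : 0 ≤ κ)
    (hη0 : 0 ≤ η) (hadd : ∀ z, cost M ψ₁ ψM α z = 0 → ∀ h, ‖h‖ ≤ η → cost M ψ₁ ψM α (z + h) ≤ κ)
    {d : ℤ → ℝ} {a b : ℤ} (hab : a ≤ b)
    (ha : ‖window M d a - window M (per z) a‖ ≤ η)
    (hb : ‖window M d b - window M (per z') b‖ ≤ η) :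
    transitionEnergy M ψ₁ ψM α z z' ≤
      ∑ i ∈ Finset.Icc a b, cost M ψ₁ ψM α (window M d i) + 2 * M * κ := by
  let D : ℤ → ℝ := fun i => if i < a then per z i else if i < b + M then d i else per z' i
  have hM := natCast_pos_of_neZero (M := M)
  have ha' : ∀ j : ℤ, a ≤ j → j < a + M → |d j - per z j| ≤ η := by
    intro j h1 h2
    have := (norm_le_pi_norm (window M d a - window M (per z) a)
      ⟨(j - a).toNat, by omega⟩).trans ha
    simp only [window, Pi.sub_apply, Real.norm_eq_abs] at this
    have e : a + (((j - a).toNat : ℕ) : ℤ) = j := by omega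
    rwa [e] at this
  have hb' : ∀ j : ℤ, b ≤ j → j < b + M → |d j - per z' j| ≤ η := by
    intro j h1 h2
    have := (norm_le_pi_norm (window M d b - window M (per z') b)
      ⟨(j - b).toNat, by omega⟩).trans hb
    simp only [window, Pi.sub_apply, Real.norm_eq_abs] at this
    have e : b + (((j - b).toNat : ℕ) : ℤ) = j := by omega
    rwa [e] at this
  obtain ⟨N, hN1, hN2⟩ : ∃ N : ℕ, -(N : ℤ) ≤ a ∧ b + M ≤ N :=
    ⟨a.natAbs + (b + M).natAbs, by omega, by omega⟩
  have hc : Connects N z z' D := by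
    refine ⟨fun i hi => if_pos (by omega), fun i hi => ?_⟩
    show ite _ _ _ = _
    rw [if_neg (by omega), if_neg (by omega)]
  refine (transitionEnergy_le_of_connects hG hz hz' hc).trans ?_
  have near : ∀ (y : Fin M → ℝ), cost M ψ₁ ψM α y = 0 → ∀ i,
      (∀ k : Fin M, |D (i + ((k : ℕ) : ℤ)) - per y (i + ((k : ℕ) : ℤ))| ≤ η) →
      cost M ψ₁ ψM α (window M D i) ≤ κ := by
    intro y hy i h
    have h1 : ‖window M D i - window M (per y) i‖ ≤ η :=
      (pi_norm_le_iff_of_nonneg hη0).2 fun k => h k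
    have := hadd (window M (per y) i) (by rw [hG.window_per, hy]) _ h1
    rwa [add_sub_cancel] at this
  -- Windows starting in `[a, b]` are unchanged. The `M` windows starting just before `a` and the
  -- `M` just after `b` mix `d` with a pattern and cost at most `κ` each, whence the error `2Mκ`.
  -- All others are exact patterns.
  have hterm : ∀ i ∈ Finset.Ico (-(N : ℤ) - M) N, cost M ψ₁ ψM α (window M D i) ≤
      (if i ∈ Finset.Icc a b then cost M ψ₁ ψM α (window M d i) else 0) +
      ((if i ∈ Finset.Ico (a - M) a then κ else 0) +
        (if i ∈ Finset.Ioc b (b + M) then κ else 0)) := by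
    intro i _
    by_cases h1 : i < a
    · by_cases h2 : a - M ≤ i
      · rw [if_neg (by simp; omega), if_pos (by simp; omega), if_neg (by simp; omega), zero_add,
          add_zero]
        -- Such a window ends before `a + M`, so whatever it takes from `d` belongs to the window at
        -- `a`, which is close to the pattern.
        refine near z hz i fun k => ?_
        have hk := k.2
        show |ite _ _ _ - _| ≤ η
        split_ifs with h3 h4
        · simpa using hη0
        · exact ha' _ (by omega) (by omega)
        · omega
      · rw [if_neg (by simp; omega), if_neg (by simp; omega), if_neg (by simp; omega), add_zero,
          add_zero]
        refine le_of_eq ?_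
        have : window M D i = window M (per z) i := by
          funext k
          have hk := k.2
          exact if_pos (by omega)
        rw [this, hG.window_per, hz]
    · by_cases h2 : i ≤ b
      · rw [if_pos (by simp; omega), if_neg (by simp; omega), if_neg (by simp; omega)]
        have : window M D i = window M d i := by
          funext k
          have hk := k.2
          show ite _ _ _ = _
          rw [if_neg (by omega), if_pos (by omega)]; rfl
        rw [this]; simp
      · rw [if_neg (by simp; omega), if_neg (by simp; omega), zero_add, zero_add]
        by_cases h3 : i ≤ b + M
        · rw [if_pos (by simp; omega)]
          refine near z' hz' i fun k => ?_
          show |ite _ _ _ - _| ≤ η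
          rw [if_neg (by omega)]
          split_ifs with h4
          · exact hb' _ (by omega) (by omega)
          · simpa using hη0
        · rw [if_neg (by simp; omega)]
          refine le_of_eq ?_
          have : window M D i = window M (per z') i := by
            funext k
            show ite _ _ _ = _
            rw [if_neg (by omega), if_neg (by omega)]; rfl
          rw [this, hG.window_per, hz']
  refine (Finset.sum_le_sum hterm).trans ?_
  rw [Finset.sum_add_distrib, Finset.sum_add_distrib, Finset.sum_ite_mem, Finset.sum_ite_mem,
    Finset.sum_ite_mem]
  have e1 : ∑ i ∈ Finset.Ico (-(N : ℤ) - M) N ∩ Finset.Icc a b, cost M ψ₁ ψM α (window M d i) ≤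
      ∑ i ∈ Finset.Icc a b, cost M ψ₁ ψM α (window M d i) :=
    Finset.sum_le_sum_of_subset_of_nonneg Finset.inter_subset_right fun i _ _ => hG.nonneg _
  have e2 : ∑ _i ∈ Finset.Ico (-(N : ℤ) - M) N ∩ Finset.Ico (a - M) a, κ ≤ M * κ := by
    refine (Finset.sum_le_sum_of_subset_of_nonneg Finset.inter_subset_right
      fun _ _ _ => hκ).trans ?_
    simp
  have e3 : ∑ _i ∈ Finset.Ico (-(N : ℤ) - M) N ∩ Finset.Ioc b (b + M), κ ≤ M * κ := by
    refine (Finset.sum_le_sum_of_subset_of_nonneg Finset.inter_subset_right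
      fun _ _ _ => hκ).trans ?_
    simp
  linarith

end Transition

/-! ### Sums of periodic sequences -/

theorem sum_range_add_of_periodic {f : ℤ → ℝ} {n : ℕ} (hf : ∀ i, f (i + n) = f i) (a : ℤ) :
    ∑ i ∈ Finset.range n, f (i + a) = ∑ i ∈ Finset.range n, f i := by
  have step : ∀ a : ℤ, ∑ i ∈ Finset.range n, f (i + (a + 1)) = ∑ i ∈ Finset.range n, f (i + a) := by
    intro a
    have h := Finset.sum_range_sub (fun i : ℕ => f (i + a)) n
    rw [Finset.sum_sub_distrib] at h
    have h0 : f ((n : ℤ) + a) = f (((0 : ℕ) : ℤ) + a) := by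
      rw [add_comm, hf]; simp
    rw [h0, sub_self, sub_eq_zero] at h
    rw [← h]
    refine Finset.sum_congr rfl fun i _ => ?_
    congr 1; push_cast; ring
  induction a using Int.induction_on with
  | zero => simp
  | succ a ih => rw [step, ih]
  | pred a ih => rw [← ih, ← step, sub_add_cancel]

theorem sum_Ico_of_periodic {f : ℤ → ℝ} {n : ℕ} (hf : ∀ i, f (i + n) = f i) (a : ℤ) :
    ∑ i ∈ Finset.Ico a (a + n), f i = ∑ i ∈ Finset.range n, f i := by
  rw [← sum_range_add_of_periodic hf a]
  symm
  refine Finset.sum_bij (fun i _ => (i : ℤ) + a) ?_ ?_ ?_ ?_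
  · intro i hi
    rw [Finset.mem_range] at hi
    rw [Finset.mem_Ico]; omega
  · intro i _ j _ h
    omega
  · intro j hj
    rw [Finset.mem_Ico] at hj
    exact ⟨(j - a).toNat, by rw [Finset.mem_range]; omega, by omega⟩
  · intro i _; rfl

/-- Averaging a periodic sequence over windows does not change its sum. -/
theorem sum_window_of_periodic {f : ℤ → ℝ} {n M : ℕ} (hM : M ≠ 0) (hf : ∀ i, f (i + n) = f i) :
    ∑ i ∈ Finset.range n, (1 / (M : ℝ)) * ∑ k : Fin M, f (i + ((k : ℕ) : ℤ)) =
      ∑ i ∈ Finset.range n, f i := by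
  rw [← Finset.mul_sum, Finset.sum_comm]
  simp_rw [sum_range_add_of_periodic hf]
  rw [Finset.sum_const, Finset.card_univ, Fintype.card_fin, nsmul_eq_mul]
  field_simp

/-! ### The renormalized energy as a sum of costs -/

/-- The slopes of `u` on the lattice intervals. -/
noncomputable def latticeSlope (L : ℝ) (n : ℕ) (u : ℝ → ℝ) (i : ℤ) : ℝ :=
  (node L n u (i + 1) - node L n u i) / eps L n

theorem eps_pos {L : ℝ} (hL : 0 < L) {n : ℕ} (hn : n ≠ 0) : 0 < eps L n := by
  unfold eps; positivity

theorem eps_mul {L : ℝ} {n : ℕ} (hn : n ≠ 0) : eps L n * n = L := by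
  unfold eps; field_simp

section Energy
variable {M : ℕ} {W₁ W₂ ψ₁ ψM : ℝ → ℝ} {c L ℓ : ℝ}

theorem node_add (hL : 0 < L) {n : ℕ} (hn : n ≠ 0) {u : ℝ → ℝ} (hu : u ∈ sobolevPer L ℓ) (i : ℤ) :
    node L n u (i + n) = node L n u i + ℓ := by
  have h := hu.2 (eps L n * i)
  unfold node
  have e : eps L n * ((i + n : ℤ) : ℝ) = eps L n * i + L := by
    push_cast; rw [mul_add, eps_mul hn]
  rw [e]
  simp only at h
  have : ℓ / L * (eps L n * i + L) = ℓ / L * (eps L n * i) + ℓ := by field_simp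
  linarith

theorem latticeSlope_add (hL : 0 < L) {n : ℕ} (hn : n ≠ 0) {u : ℝ → ℝ} (hu : u ∈ sobolevPer L ℓ)
    (i : ℤ) : latticeSlope L n u (i + n) = latticeSlope L n u i := by
  unfold latticeSlope
  rw [add_right_comm, node_add hL hn hu, node_add hL hn hu]; ring

theorem sum_latticeSlope (hL : 0 < L) {n : ℕ} (hn : n ≠ 0) {u : ℝ → ℝ} (hu : u ∈ sobolevPer L ℓ) :
    ∑ i ∈ Finset.range n, latticeSlope L n u i = n * (ℓ / L) := by
  unfold latticeSlope
  rw [← Finset.sum_div]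
  have h := Finset.sum_range_sub (fun i : ℕ => node L n u i) n
  have h1 := node_add hL hn hu 0
  push_cast at h
  rw [zero_add] at h1
  rw [h, h1, add_sub_cancel_left, div_eq_iff (eps_pos hL hn).ne']
  unfold eps; field_simp

/-- Jensen's inequality in tangent form: the integral of the tangent line along `u'` depends only on
the mean of `u'`, which is `ℓ/L`. The affine function attains the bound. -/
theorem Admissible.minBulk_eq (H : Admissible M W₁ W₂ ψ₁ ψM c (ℓ / L)) (hL : 0 < L) :
    minBulk M ψ₁ ψM L ℓ = L * psiZeroConv M ψ₁ ψM (ℓ / L) := by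
  set α := ℓ / L with hα
  have hnn := H.psiZeroConv_nonneg α
  have hlin : (fun t => α * t) ∈ sobolevPer L ℓ := by
    refine ⟨fun a b => ?_, fun t => by simp [← hα]⟩
    have : ContDiffOn ℝ 1 (fun t : ℝ => α * t) (uIcc a b) := by fun_prop
    exact this.absolutelyContinuousOnInterval
  have hinf : (⨅ u ∈ sobolevPer L ℓ,
      ∫⁻ t in Ioo 0 L, ENNReal.ofReal (psiZeroConv M ψ₁ ψM (deriv u t))) =
      ENNReal.ofReal (L * psiZeroConv M ψ₁ ψM α) := by
    refine le_antisymm ?_ (le_iInf₂ fun u hu => ?_)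
    · refine (iInf₂_le _ hlin).trans (le_of_eq ?_)
      have hd : ∀ t : ℝ, deriv (fun t => α * t) t = α := fun t => by
        simp
      simp_rw [hd]
      rw [setLIntegral_const, Real.volume_Ioo, sub_zero, ← ENNReal.ofReal_mul hnn, mul_comm]
    · have hac := hu.1 0 L
      have hint := hac.intervalIntegrable_deriv
      have hftc := hac.integral_deriv_eq_sub
      have hper : u L - u 0 = ℓ := by
        have h := hu.2 0
        simp only [zero_add, mul_zero, sub_zero] at h
        have : ℓ / L * L = ℓ := by field_simp
        rw [← hα] at this h; linarith
      set m := deriv (psiZeroConv M ψ₁ ψM) α with hm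
      have hI : Integrable (deriv u) (volume.restrict (Ioo 0 L)) := by
        have := (intervalIntegrable_iff_integrableOn_Ioo_of_le hL.le).1 hint
        exact this
      have hIt : Integrable (fun t => tangentLine M ψ₁ ψM α (deriv u t))
          (volume.restrict (Ioo 0 L)) := by
        unfold tangentLine
        exact (integrable_const _).add ((hI.sub (integrable_const _)).const_mul _)
      have hval : ∫ t in Ioo 0 L, tangentLine M ψ₁ ψM α (deriv u t) =
          L * psiZeroConv M ψ₁ ψM α := by
        have hI' : Integrable (fun t => deriv u t - α) (volume.restrict (Ioo 0 L)) :=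
          hI.sub (integrable_const _)
        unfold tangentLine
        rw [integral_add (integrable_const _) (hI'.const_mul _),
          integral_const_mul, integral_sub hI (integrable_const _)]
        rw [intervalIntegral.integral_of_le hL.le, ← integral_Ioc_eq_integral_Ioo.symm,
          hper] at hftc
        rw [hftc]
        simp only [integral_const, MeasurableSet.univ, measureReal_restrict_apply, univ_inter,
          Real.volume_real_Ioo_of_le hL.le, smul_eq_mul, sub_zero]
        rw [hα]; field_simp; ring
      rw [← hval]
      -- The tangent line may be negative. Its positive part is still below `ψ₀**`, which is
      -- nonnegative, and allows the passage from the Bochner integral to the lower integral.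
      calc ENNReal.ofReal (∫ t in Ioo 0 L, tangentLine M ψ₁ ψM α (deriv u t))
          ≤ ENNReal.ofReal (∫ t in Ioo 0 L, max (tangentLine M ψ₁ ψM α (deriv u t)) 0) :=
            ENNReal.ofReal_le_ofReal (integral_mono hIt hIt.pos_part fun t => le_max_left _ _)
        _ = ∫⁻ t in Ioo 0 L, ENNReal.ofReal (max (tangentLine M ψ₁ ψM α (deriv u t)) 0) :=
            ofReal_integral_eq_lintegral_ofReal hIt.pos_part
              (Eventually.of_forall fun t => le_max_right _ _)
        _ ≤ _ := lintegral_mono fun t => ENNReal.ofReal_le_ofReal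
            (max_le (H.tangentLine_le _) (H.psiZeroConv_nonneg _))
  unfold minBulk
  rw [hinf, ENNReal.toReal_ofReal (by positivity)]

/-- By periodicity, averaging over windows does not change the sum of the `ψ₁(d_i)`. The affine
terms add up to `n ψ₀**(ℓ/L)`, because the mean of the slopes is `ℓ/L`, and this is the bulk minimum
divided by `ε_n`. -/
theorem Admissible.renormEnergy_eq (H : Admissible M W₁ W₂ ψ₁ ψM c (ℓ / L)) (hL : 0 < L) {n : ℕ}
    (hn : n ≠ 0) {u : ℝ → ℝ} (hu : u ∈ discreteSpace L ℓ n) :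
    renormEnergy M ψ₁ ψM L ℓ n u =
      ((∑ i ∈ Finset.range n, cost M ψ₁ ψM (ℓ / L) (window M (latticeSlope L n u) i) : ℝ) :
        EReal) := by
  unfold renormEnergy
  rw [if_pos hu, EReal.coe_eq_coe_iff, H.minBulk_eq hL]
  have hε := eps_pos hL hn
  have hM := H.pos
  have hM0 : M ≠ 0 := by have := H.two_le; omega
  set d := latticeSlope L n u with hd
  have hdper : ∀ i, d (i + n) = d i := latticeSlope_add hL hn hu.1
  have hsum : ∀ i : ℤ, ∑ k, window M d i k = (node L n u (i + M) - node L n u i) / eps L n := by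
    intro i
    rw [← sum_window_diff, Finset.sum_div]; rfl
  have h1 : ∑ i ∈ Finset.range n, (1 / (M : ℝ)) * ∑ k, ψ₁ (window M d i k) =
      ∑ i ∈ Finset.range n, ψ₁ (d i) :=
    sum_window_of_periodic (f := fun i => ψ₁ (d i)) hM0 fun i => by rw [hdper]
  have h2 : ∑ i ∈ Finset.range n, (1 / (M : ℝ)) * ∑ k, window M d i k = n * (ℓ / L) :=
    (sum_window_of_periodic hM0 hdper).trans (sum_latticeSlope hL hn hu.1)
  have h3 : ∑ i ∈ Finset.range n, tangentLine M ψ₁ ψM (ℓ / L) ((∑ k, window M d i k) / M) =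
      n * psiZeroConv M ψ₁ ψM (ℓ / L) := by
    unfold tangentLine
    rw [Finset.sum_add_distrib, ← Finset.mul_sum, Finset.sum_sub_distrib]
    simp_rw [one_div_mul_eq_div] at h2
    rw [h2]; simp
  have h4 : bulkEnergy M ψ₁ ψM L n u = eps L n * (∑ i ∈ Finset.range n, ψ₁ (d i) +
      ∑ i ∈ Finset.range n, ψM ((∑ k, window M d i k) / M)) := by
    unfold bulkEnergy
    rw [← Finset.mul_sum, ← Finset.mul_sum, ← mul_add]
    congr 2
    refine Finset.sum_congr rfl fun i _ => ?_
    rw [hsum, div_div, mul_comm (eps L n)]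
  unfold cost
  rw [Finset.sum_sub_distrib, Finset.sum_add_distrib, h1, h3, h4, sub_div,
    mul_div_cancel_left₀ _ hε.ne']
  have : L * psiZeroConv M ψ₁ ψM (ℓ / L) / eps L n = n * psiZeroConv M ψ₁ ψM (ℓ / L) := by
    rw [div_eq_iff hε.ne', mul_right_comm, mul_comm (n : ℝ), eps_mul hn]
  rw [this]; ring

end Energy

/-! ### Integrals of step functions -/

section StepFunctions

theorem floor_div_eq {h : ℝ} (hh : 0 < h) {m : ℤ} {s : ℝ} (h1 : m * h ≤ s) (h2 : s < (m + 1) * h) :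
    ⌊s / h⌋ = m := by
  rw [Int.floor_eq_iff]
  exact ⟨(le_div_iff₀ hh).2 h1, (div_lt_iff₀ hh).2 h2⟩

theorem floor_mul_le {h : ℝ} (hh : 0 < h) (s : ℝ) : ⌊s / h⌋ * h ≤ s :=
  (le_div_iff₀ hh).1 (Int.floor_le _)

theorem lt_floor_mul {h : ℝ} (hh : 0 < h) (s : ℝ) : s < (⌊s / h⌋ + 1) * h :=
  (div_lt_iff₀ hh).1 (Int.lt_floor_add_one _)

theorem measurable_step (g : ℤ → ℝ) (h : ℝ) : Measurable fun s : ℝ => g ⌊s / h⌋ :=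
  (measurable_of_countable g).comp (Int.measurable_floor.comp (measurable_id.div_const h))

theorem intervalIntegrable_step (g : ℤ → ℝ) {h : ℝ} (hh : 0 < h) (a b : ℝ) :
    IntervalIntegrable (fun s => g ⌊s / h⌋) volume a b := by
  rw [intervalIntegrable_iff]
  refine Measure.integrableOn_of_bounded (M := ∑ i ∈ Finset.Icc ⌊min a b / h⌋ ⌊max a b / h⌋, |g i|)
    (by simp [uIoc]) (measurable_step g h).aestronglyMeasurable ?_
  refine (ae_restrict_iff' measurableSet_uIoc).2 (Eventually.of_forall fun s hs => ?_)
  refine Finset.single_le_sum (f := fun i => |g i|) (fun i _ => abs_nonneg _) ?_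
  rw [Finset.mem_Icc]
  constructor
  · exact Int.floor_le_floor (div_le_div_of_nonneg_right hs.1.le hh.le)
  · exact Int.floor_le_floor (div_le_div_of_nonneg_right hs.2 hh.le)

theorem integral_step_cell (g : ℤ → ℝ) {h : ℝ} (hh : 0 < h) {m : ℤ} {a b : ℝ}
    (ha : a ∈ Icc (m * h) ((m + 1) * h)) (hb : b ∈ Icc (m * h) ((m + 1) * h)) :
    ∫ s in a..b, g ⌊s / h⌋ = (b - a) * g m := by
  have : ∫ s in a..b, g ⌊s / h⌋ = ∫ _s in a..b, g m := by
    refine intervalIntegral.integral_congr_ae ?_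
    -- At the right end of the cell the integer part has already jumped to `m + 1`; this single
    -- point is negligible.
    have hne : ∀ᵐ s : ℝ, s ≠ (m + 1) * h := by simp [ae_iff, measure_singleton]
    filter_upwards [hne] with s hs hs'
    rw [floor_div_eq hh]
    · exact (le_min ha.1 hb.1).trans hs'.1.le
    · exact lt_of_le_of_ne (hs'.2.trans (max_le ha.2 hb.2)) hs
  rw [this, intervalIntegral.integral_const, smul_eq_mul]

theorem integral_step_Ico (g : ℤ → ℝ) {h : ℝ} (hh : 0 < h) {m n : ℤ} (hmn : m ≤ n) :
    ∫ s in (m * h)..(n * h), g ⌊s / h⌋ = h * ∑ i ∈ Finset.Ico m n, g i := by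
  induction n, hmn using Int.leInduction with
  | base => simp
  | succ n hn ih =>
    rw [← intervalIntegral.integral_add_adjacent_intervals (intervalIntegrable_step g hh _ (n * h))
      (intervalIntegrable_step g hh _ _), ih, integral_step_cell g hh (m := n)
      ⟨le_rfl, by nlinarith⟩ ⟨by push_cast; nlinarith, by push_cast; exact le_rfl⟩]
    have e : Finset.Ico m (n + 1) = insert n (Finset.Ico m n) := by
      ext j; simp only [Finset.mem_Ico, Finset.mem_insert]; omega
    rw [e, Finset.sum_insert (by simp)]
    push_cast; ring

theorem integral_step_shift (g : ℤ → ℝ) {h : ℝ} (hh : 0 < h) (m : ℤ) (a b : ℝ) :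
    ∫ s in (a + m * h)..(b + m * h), g ⌊s / h⌋ = ∫ s in a..b, g (⌊s / h⌋ + m) := by
  rw [← intervalIntegral.integral_comp_add_right (fun s => g ⌊s / h⌋)]
  refine intervalIntegral.integral_congr fun s _ => ?_
  refine congrArg g ?_
  rw [add_div, mul_div_cancel_right₀ _ hh.ne', Int.floor_add_intCast]

theorem norm_integral_step_le {g : ℤ → ℝ} {R : ℝ} (hR : ∀ i, |g i| ≤ R) (h a b : ℝ) :
    |∫ s in a..b, g ⌊s / h⌋| ≤ R * |b - a| := by
  rw [← Real.norm_eq_abs]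
  exact intervalIntegral.norm_integral_le_of_norm_le_const fun s _ => hR _

end StepFunctions

/-! ### Piecewise-affine functions -/

/-- `u` is affine on `[a, b]` with slope `z`. -/
def AffineOn {M : ℕ} (u : ℝ → Fin M → ℝ) (a b : ℝ) (z : Fin M → ℝ) : Prop :=
  ∀ x ∈ Icc a b, ∀ y ∈ Icc a b, u y - u x = (y - x) • z

section PiecewiseAffine
variable {M : ℕ} {u : ℝ → Fin M → ℝ} {a b t : ℝ} {z : Fin M → ℝ}

theorem AffineOn.mono (h : AffineOn u a b z) {a' b' : ℝ} (ha : a ≤ a') (hb : b' ≤ b) :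
    AffineOn u a' b' z :=
  fun x hx y hy => h x ⟨ha.trans hx.1, hx.2.trans hb⟩ y ⟨ha.trans hy.1, hy.2.trans hb⟩

theorem AffineOn.slope_unique (h : AffineOn u a b z) {y : Fin M → ℝ} (h' : AffineOn u a b y)
    (hab : a < b) : z = y := by
  have h1 := h a ⟨le_rfl, hab.le⟩ b ⟨hab.le, le_rfl⟩
  rw [h' a ⟨le_rfl, hab.le⟩ b ⟨hab.le, le_rfl⟩] at h1
  exact (smul_right_injective _ (sub_ne_zero.2 hab.ne') h1).symm

theorem hasDerivAt_affine (c z : Fin M → ℝ) (t s : ℝ) :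
    HasDerivAt (fun s : ℝ => c + (s - t) • z) z s := by
  simpa using (((hasDerivAt_id s).sub_const t).smul_const z).const_add c

theorem AffineOn.rightSlope_eq (h : AffineOn u a b z) (hat : a ≤ t) (htb : t < b) :
    rightSlope u t = z := by
  have h1 : HasDerivWithinAt u z (Ioi t) t := by
    refine (hasDerivAt_affine (u t) z t t).hasDerivWithinAt.congr_of_eventuallyEq ?_ (by simp)
    filter_upwards [Ioo_mem_nhdsGT htb] with s hs
    have := h t ⟨hat, htb.le⟩ s ⟨hat.trans hs.1.le, hs.2.le⟩
    rw [← this]; simp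
  exact h1.derivWithin (uniqueDiffWithinAt_Ioi t)

theorem AffineOn.leftSlope_eq (h : AffineOn u a b z) (hat : a < t) (htb : t ≤ b) :
    leftSlope u t = z := by
  have h1 : HasDerivWithinAt u z (Iio t) t := by
    refine (hasDerivAt_affine (u t) z t t).hasDerivWithinAt.congr_of_eventuallyEq ?_ (by simp)
    filter_upwards [Ioo_mem_nhdsLT hat] with s hs
    have := h t ⟨hat.le, htb⟩ s ⟨hs.1.le, hs.2.le.trans htb⟩
    rw [← this]; simp
  exact h1.derivWithin (uniqueDiffWithinAt_Iio t)

theorem AffineOn.notMem_jumpSet (h : AffineOn u a b z) (hat : a < t) (htb : t < b) :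
    t ∉ jumpSet u := by
  intro ht
  exact ht ((h.leftSlope_eq hat htb.le).trans (h.rightSlope_eq hat.le htb).symm)

/-- The derivative is locally constant on the open interval, which is connected, so it is constant;
continuity extends the affine formula to the endpoints. -/
theorem exists_affineOn (hu : Continuous u) (hab : a < b)
    (h : ∀ t ∈ Ioo a b, ∃ z : Fin M → ℝ, ∀ᶠ s in 𝓝 t, u s = u t + (s - t) • z) :
    ∃ z, AffineOn u a b z := by
  have hloc : ∀ t ∈ Ioo a b, DifferentiableAt ℝ u t ∧ ∃ z, ∀ᶠ s in 𝓝 t, deriv u s = z := by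
    intro t ht
    obtain ⟨z, hz⟩ := h t ht
    refine ⟨((hasDerivAt_affine (u t) z t t).congr_of_eventuallyEq hz).differentiableAt, z, ?_⟩
    filter_upwards [hz.eventually_nhds] with s hs
    exact ((hasDerivAt_affine (u t) z t s).congr_of_eventuallyEq hs).deriv
  set m := (a + b) / 2 with hm
  have hmab : m ∈ Ioo a b := ⟨by linarith, by linarith⟩
  have hconst : ∀ t ∈ Ioo a b, deriv u t = deriv u m := by
    intro t ht
    have hev : ∀ s ∈ Ioo a b, HasDerivAt (deriv u) 0 s := by
      intro s hs
      obtain ⟨-, z, hz⟩ := hloc s hs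
      exact (hasDerivAt_const s z).congr_of_eventuallyEq hz
    exact isOpen_Ioo.is_const_of_deriv_eq_zero isPreconnected_Ioo
      (fun s hs => (hev s hs).differentiableAt.differentiableWithinAt)
      (fun s hs => (hev s hs).deriv) ht hmab
  have hlin : ∀ t ∈ Ioo a b, u t = u m + (t - m) • deriv u m := by
    intro t ht
    have hev : ∀ s ∈ Ioo a b, HasDerivAt (fun s => u s - (s - m) • deriv u m) 0 s := by
      intro s hs
      have h1 := (hloc s hs).1.hasDerivAt
      rw [hconst s hs] at h1
      have h2 : HasDerivAt (fun s : ℝ => (s - m) • deriv u m) (deriv u m) s := by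
        simpa using ((hasDerivAt_id s).sub_const m).smul_const (deriv u m)
      simpa using h1.fun_sub h2
    have := isOpen_Ioo.is_const_of_deriv_eq_zero isPreconnected_Ioo
      (fun s hs => (hev s hs).differentiableAt.differentiableWithinAt)
      (fun s hs => (hev s hs).deriv) ht hmab
    simp only [sub_self, zero_smul, sub_zero] at this
    rw [← this]; simp
  have hcl : ∀ t ∈ Icc a b, u t = u m + (t - m) • deriv u m := by
    have : EqOn u (fun t => u m + (t - m) • deriv u m) (closure (Ioo a b)) :=
      EqOn.closure (fun t ht => hlin t ht) hu (by fun_prop)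
    rwa [closure_Ioo hab.ne] at this
  refine ⟨deriv u m, fun x hx y hy => ?_⟩
  rw [hcl x hx, hcl y hy, add_sub_add_left_eq_sub, ← sub_smul]
  congr 1; ring

theorem exists_Ioo_disjoint {S : Set ℝ} (hS : ∀ a b : ℝ, (S ∩ Icc a b).Finite) (t : ℝ) :
    ∃ δ > 0, ∀ s ∈ S, s ∈ Ioo (t - δ) (t + δ) → s = t := by
  have hfin : ((S ∩ Icc (t - 1) (t + 1)) \ {t}).Finite := (hS _ _).sdiff
  have hev := hfin.isClosed.isOpen_compl.mem_nhds (x := t) (by simp)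
  obtain ⟨δ, hδ, hball⟩ := Metric.mem_nhds_iff.1 hev
  refine ⟨min δ 1, by positivity, fun s hs hst => ?_⟩
  by_contra hne
  have h1 := min_le_left δ 1
  have h2 := min_le_right δ 1
  have hsb : s ∈ Metric.ball t δ := by
    rw [Real.ball_eq_Ioo]
    exact ⟨by linarith [hst.1], by linarith [hst.2]⟩
  exact hball hsb ⟨⟨hs, by linarith [hst.1], by linarith [hst.2]⟩, hne⟩

theorem IsPiecewiseAffine.exists_slopes (hu : IsPiecewiseAffine u) (t : ℝ) :
    ∃ δ > 0, AffineOn u t (t + δ) (rightSlope u t) ∧ AffineOn u (t - δ) t (leftSlope u t) := by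
  obtain ⟨hc, S, hS, haff⟩ := hu
  obtain ⟨δ, hδ, hiso⟩ := exists_Ioo_disjoint hS t
  obtain ⟨z, hz⟩ := exists_affineOn hc (a := t) (b := t + δ) (by linarith) fun s hs =>
    haff s fun hsS => hs.1.ne' (hiso s hsS ⟨by linarith [hs.1], hs.2⟩)
  obtain ⟨y, hy⟩ := exists_affineOn hc (a := t - δ) (b := t) (by linarith) fun s hs =>
    haff s fun hsS => hs.2.ne (hiso s hsS ⟨hs.1, by linarith [hs.2]⟩)
  refine ⟨δ, hδ, ?_, ?_⟩
  · rwa [hz.rightSlope_eq le_rfl (by linarith)]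
  · rwa [hy.leftSlope_eq (by linarith) le_rfl]

theorem IsPiecewiseAffine.finite_jumpSet (hu : IsPiecewiseAffine u) (a b : ℝ) :
    (jumpSet u ∩ Icc a b).Finite := by
  obtain ⟨hc, S, hS, haff⟩ := hu
  refine (hS a b).subset (inter_subset_inter_left _ fun t ht => ?_)
  by_contra htS
  obtain ⟨z, hz⟩ := haff t htS
  have h1 := (hasDerivAt_affine (u t) z t t).congr_of_eventuallyEq hz
  exact ht ((h1.hasDerivWithinAt.derivWithin (uniqueDiffWithinAt_Iio t)).trans
    (h1.hasDerivWithinAt.derivWithin (uniqueDiffWithinAt_Ioi t)).symm)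

theorem IsPiecewiseAffine.hasDerivAt (hu : IsPiecewiseAffine u) (ht : t ∉ jumpSet u) :
    HasDerivAt u (rightSlope u t) t := by
  obtain ⟨δ, hδ, h1, h2⟩ := hu.exists_slopes t
  have hlr : leftSlope u t = rightSlope u t := not_not.1 ht
  rw [hlr] at h2
  refine (hasDerivAt_affine (u t) (rightSlope u t) t t).congr_of_eventuallyEq ?_
  filter_upwards [Ioo_mem_nhds (by linarith : t - δ < t) (by linarith : t < t + δ)] with s hs
  rcases le_total s t with h | h
  · have := h2 t ⟨by linarith, le_rfl⟩ s ⟨hs.1.le, h⟩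
    rw [← this]; simp
  · have := h1 t ⟨le_rfl, by linarith⟩ s ⟨h, hs.2.le⟩
    rw [← this]; simp

theorem IsPiecewiseAffine.eventually_eq (hu : IsPiecewiseAffine u) (ht : t ∉ jumpSet u) :
    ∀ᶠ s in 𝓝 t, u s = u t + (s - t) • rightSlope u t := by
  obtain ⟨δ, hδ, h1, h2⟩ := hu.exists_slopes t
  have hlr : leftSlope u t = rightSlope u t := not_not.1 ht
  rw [hlr] at h2
  filter_upwards [Ioo_mem_nhds (by linarith : t - δ < t) (by linarith : t < t + δ)] with s hs
  rcases le_total s t with h | h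
  · have := h2 t ⟨by linarith, le_rfl⟩ s ⟨hs.1.le, h⟩
    rw [← this]; simp
  · have := h1 t ⟨le_rfl, by linarith⟩ s ⟨h, hs.2.le⟩
    rw [← this]; simp

/-- Between two consecutive jumps of the derivative the function is affine. -/
theorem IsPiecewiseAffine.affineOn (hu : IsPiecewiseAffine u) (hab : a < b)
    (h : ∀ t ∈ Ioo a b, t ∉ jumpSet u) : AffineOn u a b (rightSlope u a) := by
  obtain ⟨z, hz⟩ := exists_affineOn hu.1 hab fun t ht => ⟨_, hu.eventually_eq (h t ht)⟩
  rwa [hz.rightSlope_eq le_rfl hab]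

end PiecewiseAffine

/-! ### Compactness -/

/-- The continuous function with the value `x` at `0` and the slope `d (M I + k)` on the `I`-th
block `[I M h, (I + 1) M h)`. -/
noncomputable def blockInterp (M : ℕ) (h : ℝ) (d : ℤ → ℝ) (x : ℝ) (k : Fin M) (t : ℝ) : ℝ :=
  x + ∫ s in (0 : ℝ)..t, d (M * ⌊s / (M * h)⌋ + ((k : ℕ) : ℤ))

theorem blockInterp_sub {M : ℕ} {h : ℝ} (hMh : 0 < M * h) (d : ℤ → ℝ) (x : ℝ) (k : Fin M)
    (s t : ℝ) : blockInterp M h d x k t - blockInterp M h d x k s =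
      ∫ r in s..t, d (M * ⌊r / (M * h)⌋ + ((k : ℕ) : ℤ)) := by
  unfold blockInterp
  have hi := intervalIntegrable_step (fun I => d (M * I + ((k : ℕ) : ℤ))) hMh
  rw [add_sub_add_left_eq_sub, intervalIntegral.integral_interval_sub_left (hi _ _) (hi _ _)]

theorem abs_blockInterp_sub_le {M : ℕ} {h : ℝ} (hMh : 0 < M * h) {d : ℤ → ℝ} {R : ℝ}
    (hR : ∀ i, |d i| ≤ R) (x : ℝ) (k : Fin M) (s t : ℝ) :
    |blockInterp M h d x k t - blockInterp M h d x k s| ≤ R * |t - s| := by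
  rw [blockInterp_sub hMh]
  exact norm_integral_step_le (g := fun I => d (M * I + ((k : ℕ) : ℤ))) (fun I => hR _) _ _ _

/-- Sequences of periodic slopes `d n` with bounded energy whose block interpolations converge
pointwise along an ultrafilter. -/
structure LimitSetting {M : ℕ} (G : (Fin M → ℝ) → ℝ) (L α C : ℝ) (q : ℕ) (𝒰 : Ultrafilter ℕ)
    (d : ℕ → ℤ → ℝ) (x : ℕ → ℝ) (U : ℝ → Fin M → ℝ) : Prop where
  L_pos : 0 < L
  le_atTop : (𝒰 : Filter ℕ) ≤ atTop
  mod : ∀ᶠ n in (𝒰 : Filter ℕ), n % M = q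
  periodic : ∀ᶠ n in (𝒰 : Filter ℕ), ∀ i, d n (i + n) = d n i
  sum_eq : ∀ᶠ n in (𝒰 : Filter ℕ), ∑ i ∈ Finset.range n, d n i = n * α
  energy : ∀ᶠ n in (𝒰 : Filter ℕ), ∑ i ∈ Finset.range n, G (window M (d n) i) ≤ C
  tendsto : ∀ t k, Tendsto (fun n => blockInterp M (eps L n) (d n) (x n) k t) 𝒰 (𝓝 (U t k))

theorem window_add_of_periodic {M n : ℕ} {d : ℤ → ℝ} (hd : ∀ i, d (i + n) = d i) (i : ℤ) :
    window M d (i + n) = window M d i := by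
  funext k
  simp only [window]
  rw [add_right_comm, hd]

theorem sum_range_mul_of_periodic {f : ℤ → ℝ} {n : ℕ} (hf : ∀ i, f (i + n) = f i) (p : ℕ) :
    ∑ i ∈ Finset.range (p * n), f i = p * ∑ i ∈ Finset.range n, f i := by
  induction p with
  | zero => simp
  | succ p ih =>
    rw [Nat.add_mul, one_mul, Finset.sum_range_add, ih]
    have := sum_range_add_of_periodic hf ((p * n : ℕ) : ℤ)
    have e : ∑ i ∈ Finset.range n, f (((p * n + i : ℕ) : ℤ)) = ∑ i ∈ Finset.range n, f i := by
      rw [← this]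
      refine Finset.sum_congr rfl fun i _ => ?_
      congr 1; push_cast; ring
    rw [e]; push_cast; ring

theorem sum_le_of_periodic {f : ℤ → ℝ} {n : ℕ} (hf : ∀ i, f (i + n) = f i) (h0 : ∀ i, 0 ≤ f i)
    (p : ℕ) {s : Finset ℤ} (hs : ∀ i ∈ s, -((p * n : ℕ) : ℤ) ≤ i ∧ i < ((p * n : ℕ) : ℤ)) :
    ∑ i ∈ s, f i ≤ 2 * p * ∑ i ∈ Finset.range n, f i := by
  have hper : ∀ (m : ℕ) (i : ℤ), f (i + (m * n : ℕ)) = f i := by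
    intro m
    induction m with
    | zero => simp
    | succ m ih =>
      intro i
      rw [← ih i, ← hf (i + (m * n : ℕ))]
      congr 1; push_cast; ring
  have h1 := sum_Ico_of_periodic (hper (2 * p)) (-((p * n : ℕ) : ℤ))
  rw [sum_range_mul_of_periodic hf] at h1
  push_cast at h1
  rw [← h1]
  refine Finset.sum_le_sum_of_subset_of_nonneg (fun i hi => ?_) fun i _ _ => h0 i
  obtain ⟨h2, h3⟩ := hs i hi
  rw [Finset.mem_Ico]
  push_cast at h2 h3
  constructor <;> linarith

/-! ### Slope estimates from the energy -/

namespace IsWellCost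

/-- If the cost of `w` is below a threshold `δ`, then `w` is within `η` of a zero, which separation
identifies with `z`. Otherwise `(η₀/δ) G w` already exceeds `η₀`. Summed over cells, this turns an
energy bound into control of the total deviation from a pattern. -/
theorem norm_sub_le {M : ℕ} {G : (Fin M → ℝ) → ℝ} (hG : IsWellCost G) {η₀ : ℝ} (hη₀ : 0 < η₀)
    (hsep : ∀ z y, G z = 0 → G y = 0 → ∀ j k, |z j - y k| ≤ 2 * η₀ → z j = y k)
    {η : ℝ} (hη : 0 < η) : ∃ A : ℝ, 0 ≤ A ∧ ∀ z w, G z = 0 → ‖w - z‖ ≤ η₀ →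
      ‖w - z‖ ≤ η + A * G w := by
  obtain ⟨δ, hδ, hnear⟩ := hG.exists_near (lt_min hη hη₀)
  refine ⟨η₀ / δ, by positivity, fun z w hz hw => ?_⟩
  rcases lt_or_ge (G w) δ with h | h
  · obtain ⟨y, hy0, hy⟩ := hnear w h
    have hzy : z = y := by
      funext k
      refine hsep z y hz hy0 k k ?_
      have h1 := (norm_le_pi_norm (w - z) k).trans hw
      have h2 := (norm_le_pi_norm (w - y) k).trans (hy.le.trans (min_le_right _ _))
      simp only [Pi.sub_apply, Real.norm_eq_abs] at h1 h2
      rw [abs_le] at h1 h2 ⊢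
      constructor <;> linarith
    rw [hzy]
    have : 0 ≤ η₀ / δ * G w := mul_nonneg (by positivity) (hG.nonneg w)
    linarith [min_le_left η η₀]
  · have : η₀ ≤ η₀ / δ * G w := by
      rw [div_mul_eq_mul_div, le_div_iff₀ hδ]
      exact mul_le_mul_of_nonneg_left h hη₀.le
    linarith

/-- Every window costs at most the energy of a period, and coercivity bounds its entries. -/
theorem exists_bound {M : ℕ} {G : (Fin M → ℝ) → ℝ} (hG : IsWellCost G) (C : ℝ) :
    ∃ R : ℝ, 0 ≤ R ∧ ∀ {n : ℕ} {d : ℤ → ℝ}, n ≠ 0 → (∀ i, d (i + n) = d i) →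
      ∑ i ∈ Finset.range n, G (window M d i) ≤ C → ∀ i, |d i| ≤ R := by
  obtain ⟨A, hA, hco⟩ := hG.coercive
  have := hG.neZero
  refine ⟨A * (1 + max C 0), by positivity, fun {n d} hn hper hE i => ?_⟩
  have h1 : G (window M d i) ≤ C := by
    refine le_trans ?_ hE
    rw [← sum_Ico_of_periodic (f := fun i => G (window M d i))
      (fun i => by rw [window_add_of_periodic hper]) i]
    refine Finset.single_le_sum (f := fun i => G (window M d i)) (fun j _ => hG.nonneg _) ?_
    rw [Finset.mem_Ico]; omega
  have h2 := norm_le_pi_norm (window M d i) 0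
  simp only [window, Fin.val_zero, Nat.cast_zero, add_zero, Real.norm_eq_abs] at h2
  exact h2.trans ((hco _).trans (mul_le_mul_of_nonneg_left
    (by linarith [le_max_left C 0]) hA.le))

end IsWellCost

theorem exists_separation_finset (T : Finset ℝ) {δ : ℝ} (hδ : 0 < δ) :
    ∃ r > 0, r ≤ δ ∧ ∀ s ∈ T, ∀ t ∈ T, s ≠ t → 2 * r ≤ |s - t| := by
  have hfin : ((fun p : ℝ × ℝ => |p.1 - p.2|) '' ((T : Set ℝ) ×ˢ (T : Set ℝ)) \ {0}).Finite :=
    ((T.finite_toSet.prod T.finite_toSet).image _).sdiff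
  have hev := hfin.isClosed.isOpen_compl.mem_nhds (x := (0 : ℝ)) (by simp)
  obtain ⟨r, hr, hball⟩ := Metric.nhds_basis_closedBall.mem_iff.1 hev
  refine ⟨min (r / 2) δ, by positivity, min_le_right _ _, fun s hs t ht hst => ?_⟩
  by_contra! hlt
  have h1 : |s - t| ∈ Metric.closedBall (0 : ℝ) r := by
    have := min_le_left (r / 2) δ
    simpa using (by linarith : |s - t| ≤ r)
  exact hball h1 ⟨⟨(s, t), ⟨hs, ht⟩, rfl⟩, by simpa [sub_eq_zero] using hst⟩

/-- Eventually all the cells near `t` are close to zeros of the cost. -/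
def Regular {M : ℕ} (G : (Fin M → ℝ) → ℝ) (L : ℝ) (𝒰 : Ultrafilter ℕ) (d : ℕ → ℤ → ℝ)
    (η t : ℝ) : Prop :=
  ∃ r > 0, ∀ᶠ n in (𝒰 : Filter ℕ), ∀ i : ℤ, t - r < eps L n * i → eps L n * i < t + r →
    ∃ z, G z = 0 ∧ ‖window M (d n) i - z‖ ≤ η

/-! ### Regular points of sequences with bounded energy -/

namespace LimitSetting

variable {M : ℕ} {G : (Fin M → ℝ) → ℝ} {L α C : ℝ} {q : ℕ} {𝒰 : Ultrafilter ℕ}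
  {d : ℕ → ℤ → ℝ} {x : ℕ → ℝ} {U : ℝ → Fin M → ℝ}

theorem ne_zero (h : LimitSetting G L α C q 𝒰 d x U) : ∀ᶠ n in (𝒰 : Filter ℕ), n ≠ 0 :=
  h.le_atTop (eventually_ne_atTop 0)

theorem tendsto_eps (h : LimitSetting G L α C q 𝒰 d x U) : Tendsto (eps L) 𝒰 (𝓝 0) :=
  (tendsto_const_nhds.div_atTop tendsto_natCast_atTop_atTop).mono_left h.le_atTop

theorem eps_pos (h : LimitSetting G L α C q 𝒰 d x U) : ∀ᶠ n in (𝒰 : Filter ℕ), 0 < eps L n := by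
  filter_upwards [h.ne_zero] with n hn
  exact LatticeGamma.eps_pos h.L_pos hn

theorem eps_lt (h : LimitSetting G L α C q 𝒰 d x U) {r : ℝ} (hr : 0 < r) :
    ∀ᶠ n in (𝒰 : Filter ℕ), eps L n < r := h.tendsto_eps.eventually (gt_mem_nhds hr)

/-- A bounded interval is covered by a number of periods independent of `n`, each carrying energy at
most `C`. -/
theorem sum_le (h : LimitSetting G L α C q 𝒰 d x U) (hG : IsWellCost G) (T : ℝ) :
    ∃ B : ℝ, 0 ≤ B ∧ ∀ᶠ n in (𝒰 : Filter ℕ), ∀ s : Finset ℤ, (∀ i ∈ s, |eps L n * i| ≤ T) →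
      ∑ i ∈ s, G (window M (d n) i) ≤ B := by
  obtain ⟨p, hp⟩ := exists_nat_gt (T / L)
  rw [div_lt_iff₀ h.L_pos] at hp
  refine ⟨2 * p * max C 0, by positivity, ?_⟩
  filter_upwards [h.ne_zero, h.eps_pos, h.periodic, h.energy] with n hn hε hper hE s hs
  refine (sum_le_of_periodic (f := fun i => G (window M (d n) i)) (n := n)
    (fun i => by rw [window_add_of_periodic hper]) (fun i => hG.nonneg _) p fun i hi => ?_).trans
    (mul_le_mul_of_nonneg_left (hE.trans (le_max_left _ _)) (by positivity))
  have h1 : |eps L n * i| < eps L n * ((p * n : ℕ) : ℝ) := by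
    refine (hs i hi).trans_lt (hp.trans_eq ?_)
    rw [← eps_mul (L := L) hn]
    simp only [eps_mul hn]
    push_cast
    rw [mul_left_comm, eps_mul hn]
  rw [abs_mul, abs_of_pos hε, mul_lt_mul_iff_right₀ hε] at h1
  have h2 : |i| < ((p * n : ℕ) : ℤ) := by exact_mod_cast h1
  rw [abs_lt] at h2
  exact ⟨h2.1.le, h2.2⟩

theorem bounded (h : LimitSetting G L α C q 𝒰 d x U) (hG : IsWellCost G) :
    ∃ R : ℝ, 0 ≤ R ∧ ∀ᶠ n in (𝒰 : Filter ℕ), ∀ i, |d n i| ≤ R := by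
  obtain ⟨R, hR0, hR⟩ := hG.exists_bound C
  refine ⟨R, hR0, ?_⟩
  filter_upwards [h.ne_zero, h.periodic, h.energy] with n hn hper hE
  exact hR hn hper hE

theorem lipschitz (h : LimitSetting G L α C q 𝒰 d x U) (hG : IsWellCost G) :
    ∃ R : ℝ, 0 ≤ R ∧ ∀ s t k, |U t k - U s k| ≤ R * |t - s| := by
  obtain ⟨R, hR0, hR⟩ := h.bounded hG
  have hM : (0 : ℝ) < M := by
    have := hG.two_le
    exact_mod_cast (by omega : 0 < M)
  refine ⟨R, hR0, fun s t k => ?_⟩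
  refine le_of_tendsto ((h.tendsto t k).sub (h.tendsto s k)).abs ?_
  filter_upwards [hR, h.eps_pos] with n hn hε
  exact abs_blockInterp_sub_le (by positivity) hn _ _ _ _

theorem continuous (h : LimitSetting G L α C q 𝒰 d x U) (hG : IsWellCost G) : Continuous U := by
  obtain ⟨R, hR0, hR⟩ := h.lipschitz hG
  refine continuous_pi fun k => ?_
  have : LipschitzWith (Real.toNNReal R) fun t => U t k := by
    refine LipschitzWith.of_dist_le_mul fun s t => ?_
    rw [Real.coe_toNNReal _ hR0, Real.dist_eq, Real.dist_eq]
    exact hR t s k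
  exact this.continuous

theorem apply_zero (h : LimitSetting G L α C q 𝒰 d x U) (k k' : Fin M) : U 0 k = U 0 k' := by
  refine tendsto_nhds_unique (h.tendsto 0 k) ((h.tendsto 0 k').congr fun n => ?_)
  simp [blockInterp]

/-- Near a point that is not regular there is a cell of cost at least a fixed `δ`. Cells near `m`
separated points are distinct, so `m δ` is at most the energy bound of the interval. -/
theorem finite_not_regular (h : LimitSetting G L α C q 𝒰 d x U) (hG : IsWellCost G) {η : ℝ}
    (hη : 0 < η) (a b : ℝ) : ({t | ¬ Regular G L 𝒰 d η t} ∩ Icc a b).Finite := by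
  classical
  obtain ⟨δ, hδ, hnear⟩ := hG.exists_near hη
  obtain ⟨B, hB, hsum⟩ := h.sum_le hG (|a| + |b| + 1)
  by_contra hinf
  obtain ⟨m, hm⟩ := exists_nat_gt (B / δ)
  rw [div_lt_iff₀ hδ] at hm
  obtain ⟨T, hT, hcard⟩ := Set.Infinite.exists_subset_card_eq hinf m
  -- disjoint neighbourhoods
  obtain ⟨r, hr, hr1, hrT⟩ := exists_separation_finset T one_pos
  have hbad : ∀ᶠ n in (𝒰 : Filter ℕ), ∀ t ∈ T, ∃ i : ℤ, t - r < eps L n * i ∧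
      eps L n * i < t + r ∧ δ ≤ G (window M (d n) i) := by
    rw [Filter.eventually_all_finset]
    intro t ht
    have h1 : ¬ Regular G L 𝒰 d η t := (hT ht).1
    have h2 : ¬ ∀ᶠ n in (𝒰 : Filter ℕ), ∀ i : ℤ, t - r < eps L n * i → eps L n * i < t + r →
        ∃ z, G z = 0 ∧ ‖window M (d n) i - z‖ ≤ η := fun h2 => h1 ⟨r, hr, h2⟩
    -- Along an ultrafilter the negation of an eventual property holds eventually, so that the bad
    -- cells near all the points of `T` exist for a common `n`.
    filter_upwards [Ultrafilter.eventually_not.2 h2] with n hn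
    push Not at hn
    obtain ⟨i, hi1, hi2, hi3⟩ := hn
    refine ⟨i, hi1, hi2, ?_⟩
    by_contra! hlt
    obtain ⟨z, hz0, hz⟩ := hnear _ hlt
    exact absurd hz.le (not_le.2 (hi3 z hz0))
  obtain ⟨n, hn, hns⟩ := (hbad.and hsum).exists
  choose! i hi1 hi2 hi3 using hn
  have hinj : Set.InjOn i T := by
    intro s hs t ht hst
    by_contra hne
    have h1 := hrT s hs t ht hne
    have h2 := hi1 s hs
    have h3 := hi2 s hs
    rw [hst] at h2 h3
    have h4 := hi1 t ht
    have h5 := hi2 t ht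
    have : |s - t| < 2 * r := by rw [abs_lt]; constructor <;> linarith
    linarith
  have h1 := hns (T.image i) (by
    intro j hj
    obtain ⟨t, ht, rfl⟩ := Finset.mem_image.1 hj
    have h2 := hi1 t ht
    have h3 := hi2 t ht
    have h4 := (hT ht).2
    rw [abs_le]
    constructor
    · linarith [h4.1, neg_abs_le a, abs_nonneg b]
    · linarith [h4.2, le_abs_self b, abs_nonneg a])
  rw [Finset.sum_image hinj] at h1
  have h2 := Finset.card_nsmul_le_sum T (fun t => G (window M (d n) (i t))) δ fun t ht => hi3 t ht
  rw [hcard, nsmul_eq_mul] at h2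
  linarith

/-- Near a regular point the slopes follow a single pattern. -/
theorem exists_pattern [NeZero M] (h : LimitSetting G L α C q 𝒰 d x U) (hG : IsWellCost G) {η t : ℝ}
    (hsep : ∀ z y, G z = 0 → G y = 0 → ∀ j k, |z j - y k| ≤ 2 * η → z j = y k)
    (ht : Regular G L 𝒰 d η t) : ∃ r > 0, ∃ z, G z = 0 ∧ ∀ᶠ n in (𝒰 : Filter ℕ), ∀ i : ℤ,
      t - r < eps L n * i → eps L n * i < t + r →
        ‖window M (d n) i - window M (per z) i‖ ≤ η := by
  obtain ⟨r, hr, hreg⟩ := ht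
  refine ⟨r, hr, ?_⟩
  -- For each `n` there is some pattern; as the zeros are finitely many, the ultrafilter selects one
  -- that does not depend on `n`.
  refine (Ultrafilter.eventually_exists_mem_iff hG.finite_zeros (P := fun z n => ∀ i : ℤ,
      t - r < eps L n * i → eps L n * i < t + r →
        ‖window M (d n) i - window M (per z) i‖ ≤ η)).1 ?_
  filter_upwards [hreg, h.eps_pos, h.eps_lt hr] with n hn hε hεr
  have hiff : ∀ i : ℤ, ⌊(t - r) / eps L n⌋ + 1 ≤ i ∧ i ≤ ⌈(t + r) / eps L n⌉ - 1 ↔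
      t - r < eps L n * i ∧ eps L n * i < t + r := by
    intro i
    rw [Int.add_one_le_iff, Int.floor_lt, Int.le_sub_one_iff, Int.lt_ceil, div_lt_iff₀ hε,
      lt_div_iff₀ hε, mul_comm]
  have hab : ⌊(t - r) / eps L n⌋ + 1 ≤ ⌈(t + r) / eps L n⌉ - 1 := by
    have h1 := (hiff ⌊t / eps L n⌋).2 ⟨?_, ?_⟩
    · exact h1.1.trans h1.2
    · have := lt_floor_mul hε t
      linarith
    · have := floor_mul_le hε t
      linarith
  obtain ⟨z, hz0, hz⟩ := hG.exists_pattern hsep (d n) hab fun i hi1 hi2 => by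
    obtain ⟨h1, h2⟩ := (hiff i).1 ⟨hi1, hi2⟩
    exact hn i h1 h2
  refine ⟨z, hz0, fun i hi1 hi2 => ?_⟩
  obtain ⟨h1, h2⟩ := (hiff i).2 ⟨hi1, hi2⟩
  exact hz i h1 h2

/-- Close to a regular point there are cells that are as close to the pattern as one likes. -/
theorem exists_cell [NeZero M] (h : LimitSetting G L α C q 𝒰 d x U) (hG : IsWellCost G) {η₀ t r : ℝ}
    (hη₀ : 0 < η₀) (hsep : ∀ z y, G z = 0 → G y = 0 → ∀ j k, |z j - y k| ≤ 2 * η₀ → z j = y k)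
    (hr : 0 < r) {z : Fin M → ℝ} (hz : G z = 0)
    (hpat : ∀ᶠ n in (𝒰 : Filter ℕ), ∀ i : ℤ, t - r < eps L n * i → eps L n * i < t + r →
      ‖window M (d n) i - window M (per z) i‖ ≤ η₀) {η : ℝ} (hη : 0 < η) :
    ∀ᶠ n in (𝒰 : Filter ℕ), ∃ i : ℤ, t - r < eps L n * i ∧ eps L n * i < t + r ∧
      ‖window M (d n) i - window M (per z) i‖ ≤ η := by
  obtain ⟨A, hA, hnear⟩ := hG.norm_sub_le hη₀ hsep (half_pos hη)
  obtain ⟨B, hB, hsum⟩ := h.sum_le hG (|t| + r)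
  -- If `m` consecutive cells all deviated by more than `η`, then `A` times the cost of each would
  -- be at least `η/2`, and their total would exceed `A B`. For small `ε_n` the `m` cells after `t`
  -- stay within `r` of `t`.
  obtain ⟨m, hm⟩ := exists_nat_gt (A * B / (η / 2))
  rw [div_lt_iff₀ (half_pos hη)] at hm
  filter_upwards [hpat, hsum, h.eps_pos, h.eps_lt (r := r / (m + 1)) (by positivity)] with
    n hn hs hε hεm
  rw [lt_div_iff₀ (by positivity)] at hεm
  by_contra! hcon
  set i₀ := ⌊t / eps L n⌋ with hi₀
  have hrange : ∀ i ∈ Finset.Ico i₀ (i₀ + m), t - r < eps L n * i ∧ eps L n * i < t + r := by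
    intro i hi
    rw [Finset.mem_Ico] at hi
    have h1 := lt_floor_mul hε t
    have h2 := floor_mul_le hε t
    rw [← hi₀] at h1 h2
    have h3 : (i₀ : ℝ) ≤ i := by exact_mod_cast hi.1
    have h4 : (i : ℝ) ≤ i₀ + m := by exact_mod_cast hi.2.le
    have h5 := mul_le_mul_of_nonneg_left h3 hε.le
    have h6 := mul_le_mul_of_nonneg_left h4 hε.le
    have h7 : 0 ≤ eps L n * m := by positivity
    constructor <;> nlinarith
  have h1 := hs (Finset.Ico i₀ (i₀ + m)) fun i hi => by
    obtain ⟨h2, h3⟩ := hrange i hi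
    rw [abs_le]
    constructor
    · linarith [neg_abs_le t]
    · linarith [le_abs_self t]
  have h2 : ∀ i ∈ Finset.Ico i₀ (i₀ + m), η / 2 ≤ A * G (window M (d n) i) := by
    intro i hi
    obtain ⟨h3, h4⟩ := hrange i hi
    have h5 := hcon i h3 h4
    have h6 := hnear (window M (per z) i) _ (by rw [hG.window_per, hz]) (hn i h3 h4)
    linarith
  have h3 := Finset.card_nsmul_le_sum _ _ _ h2
  rw [← Finset.mul_sum, nsmul_eq_mul] at h3
  have h4 : ((Finset.Ico i₀ (i₀ + m)).card : ℝ) = m := by simp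
  rw [h4] at h3
  have := mul_le_mul_of_nonneg_left h1 hA
  linarith

/-- Near a regular point the limit is affine. -/
theorem affineOn_of_pattern [NeZero M] (h : LimitSetting G L α C q 𝒰 d x U) (hG : IsWellCost G)
    {η₀ t r : ℝ} (hη₀ : 0 < η₀)
    (hsep : ∀ z y, G z = 0 → G y = 0 → ∀ j k, |z j - y k| ≤ 2 * η₀ → z j = y k)
    {z : Fin M → ℝ} (hz : G z = 0)
    (hpat : ∀ᶠ n in (𝒰 : Filter ℕ), ∀ i : ℤ, t - r < eps L n * i → eps L n * i < t + r →
      ‖window M (d n) i - window M (per z) i‖ ≤ η₀) {r' : ℝ} (hr' : r' < r) :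
    AffineOn U (t - r') (t + r') z := by
  have hM : (0 : ℝ) < M := by
    have := hG.two_le
    exact_mod_cast (by omega : 0 < M)
  have key : ∀ a b, t - r' ≤ a → a ≤ b → b ≤ t + r' → U b - U a = (b - a) • z := by
    intro a b ha hab hb
    funext k
    simp only [Pi.sub_apply, Pi.smul_apply, smul_eq_mul]
    refine eq_of_forall_dist_le fun η hη => ?_
    rw [Real.dist_eq]
    obtain ⟨A, hA, hnear⟩ := hG.norm_sub_le hη₀ hsep
      (η := η / (2 * (b - a + 1))) (by have : 0 ≤ b - a := by linarith
                                       positivity)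
    obtain ⟨B, hB, hsum⟩ := h.sum_le hG (|t| + |r| + 1)
    refine le_of_tendsto (((h.tendsto b k).sub (h.tendsto a k)).sub_const _).abs ?_
    filter_upwards [hpat, hsum, h.eps_pos, h.eps_lt (r := (r - r') / M)
      (div_pos (by linarith) hM), h.eps_lt (r := 1 / M) (by positivity),
      h.eps_lt (r := η / 2 / (M * (A * B) + 1)) (by positivity)] with n hn hs hε hε1 hε2 hε3
    rw [lt_div_iff₀ hM] at hε1 hε2
    rw [lt_div_iff₀ (by positivity)] at hε3
    have hMε : 0 < M * eps L n := by positivity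
    rw [blockInterp_sub hMε]
    have hi := intervalIntegrable_step (fun I => d n (M * I + ((k : ℕ) : ℤ))) hMε a b
    have hiG := intervalIntegrable_step (fun I => G (window M (d n) (M * I))) hMε
    have e1 : ∫ s in a..b, (d n (M * ⌊s / (M * eps L n)⌋ + ((k : ℕ) : ℤ)) - z k) =
        (∫ s in a..b, d n (M * ⌊s / (M * eps L n)⌋ + ((k : ℕ) : ℤ))) - (b - a) * z k := by
      rw [intervalIntegral.integral_sub hi intervalIntegrable_const,
        intervalIntegral.integral_const, smul_eq_mul]
    rw [← e1]
    have hpos : ∀ I : ℤ, eps L n * ((M * I : ℤ) : ℝ) = I * (M * eps L n) := fun I => by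
      push_cast; ring
    -- The deviation of the slope from `z k` is at most a small constant plus `A` times the cost of
    -- the window of its block.
    have hpt : ∀ s ∈ Icc a b, |d n (M * ⌊s / (M * eps L n)⌋ + ((k : ℕ) : ℤ)) - z k| ≤
        η / (2 * (b - a + 1)) + A * G (window M (d n) (M * ⌊s / (M * eps L n)⌋)) := by
      intro s hs'
      have h1 := floor_mul_le hMε s
      have h2 := lt_floor_mul hMε s
      have h3 := hn (M * ⌊s / (M * eps L n)⌋) (by rw [hpos]; linarith [hs'.1])
        (by rw [hpos]; linarith [hs'.2])
      rw [window_per_mul] at h3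
      exact (norm_le_pi_norm (window M (d n) (M * ⌊s / (M * eps L n)⌋) - z) k).trans
        (hnear z _ hz h3)
    have h4 : |∫ s in a..b, (d n (M * ⌊s / (M * eps L n)⌋ + ((k : ℕ) : ℤ)) - z k)| ≤
        ∫ s in a..b, (η / (2 * (b - a + 1)) +
          A * G (window M (d n) (M * ⌊s / (M * eps L n)⌋))) := by
      refine (intervalIntegral.abs_integral_le_integral_abs hab).trans ?_
      exact intervalIntegral.integral_mono_on hab (hi.sub intervalIntegrable_const).abs
        (intervalIntegrable_const.add ((hiG a b).const_mul A)) hpt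
    refine h4.trans ?_
    rw [intervalIntegral.integral_add intervalIntegrable_const ((hiG a b).const_mul A),
      intervalIntegral.integral_const, smul_eq_mul, intervalIntegral.integral_const_mul]
    -- The integral of the block costs is `M ε_n` times a sum of costs, which stays bounded, so it
    -- vanishes in the limit.
    have h5 : ∫ s in a..b, G (window M (d n) (M * ⌊s / (M * eps L n)⌋)) ≤ M * eps L n * B := by
      set I₁ := ⌊a / (M * eps L n)⌋ with hI₁
      set I₂ := ⌊b / (M * eps L n)⌋ + 1 with hI₂
      have h6 := floor_mul_le hMε a
      have h7 := lt_floor_mul hMε b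
      have h6' := lt_floor_mul hMε a
      have h7' := floor_mul_le hMε b
      rw [← hI₁] at h6 h6'
      have hI12 : I₁ ≤ I₂ := by
        have : ⌊a / (M * eps L n)⌋ ≤ ⌊b / (M * eps L n)⌋ :=
          Int.floor_le_floor (div_le_div_of_nonneg_right hab hMε.le)
        omega
      have h8 : ∫ s in a..b, G (window M (d n) (M * ⌊s / (M * eps L n)⌋)) ≤
          ∫ s in (I₁ * (M * eps L n))..(I₂ * (M * eps L n)),
            G (window M (d n) (M * ⌊s / (M * eps L n)⌋)) := by
        refine intervalIntegral.integral_mono_interval h6 hab (by push_cast [hI₂]; linarith)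
          (Eventually.of_forall fun s => hG.nonneg _) (hiG _ _)
      refine h8.trans ?_
      rw [integral_step_Ico (fun I => G (window M (d n) (M * I))) hMε hI12]
      refine mul_le_mul_of_nonneg_left ?_ hMε.le
      have h9 := hs ((Finset.Ico I₁ I₂).image fun I => (M : ℤ) * I) (by
        intro i hi
        obtain ⟨I, hI, rfl⟩ := Finset.mem_image.1 hi
        rw [Finset.mem_Ico] at hI
        rw [hpos]
        have h10 : (I₁ : ℝ) ≤ I := by exact_mod_cast hI.1
        have h11 : (I : ℝ) ≤ ⌊b / (M * eps L n)⌋ := by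
          have : I ≤ ⌊b / (M * eps L n)⌋ := by omega
          exact_mod_cast this
        have h12 := mul_le_mul_of_nonneg_right h10 hMε.le
        have h13 := mul_le_mul_of_nonneg_right h11 hMε.le
        rw [abs_le]
        constructor
        · linarith [neg_abs_le t, le_abs_self r]
        · linarith [le_abs_self t, le_abs_self r])
      rw [Finset.sum_image (fun i _ j _ hij => by
        have : (M : ℤ) ≠ 0 := natCast_pos_of_neZero.ne'
        exact mul_left_cancel₀ this hij)] at h9
      exact h9
    have h14 : (b - a) * (η / (2 * (b - a + 1))) ≤ η / 2 := by
      have : 0 ≤ b - a := by linarith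
      rw [← mul_div_assoc, div_le_div_iff₀ (by positivity) two_pos]
      nlinarith
    have h15 := mul_le_mul_of_nonneg_left h5 hA
    nlinarith
  intro a ha b hb
  rcases le_total a b with hab | hab
  · exact key a b ha.1 hab hb.2
  · have := key b a hb.1 hab ha.2
    rw [← neg_sub, this, ← neg_smul, neg_sub]

end LimitSetting

theorem sum_range_blocks (M : ℕ) (d : ℤ → ℝ) (m : ℕ) :
    ∑ I ∈ Finset.Ico (0 : ℤ) m, ∑ k : Fin M, d (M * I + ((k : ℕ) : ℤ)) =
      ∑ i ∈ Finset.range (M * m), d i := by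
  induction m with
  | zero => simp
  | succ m ih =>
    have e : Finset.Ico (0 : ℤ) ((m + 1 : ℕ) : ℤ) = insert (m : ℤ) (Finset.Ico (0 : ℤ) m) := by
      ext j; simp only [Finset.mem_Ico, Finset.mem_insert]; omega
    rw [e, Finset.sum_insert (by simp), ih, Nat.mul_succ, Finset.sum_range_add, add_comm,
      Fin.sum_univ_eq_sum_range (fun k => d (M * (m : ℤ) + (k : ℤ)))]
    push_cast; rfl

/-! ### Structure of the limit function -/

namespace LimitSetting

section Abstract
variable {M : ℕ} [NeZero M] {G : (Fin M → ℝ) → ℝ} {L α C : ℝ} {q : Fin M} {𝒰 : Ultrafilter ℕ}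
  {d : ℕ → ℤ → ℝ} {x : ℕ → ℝ} {U : ℝ → Fin M → ℝ}

/-- Only finitely many points of the interval fail to be regular. Near a regular one the limit is
affine with the prevailing pattern as slope, so that pattern must be `z`. -/
theorem exists_cell_of_affineOn (h : LimitSetting G L α C q 𝒰 d x U) (hG : IsWellCost G) {a b : ℝ}
    (hab : a < b) {z : Fin M → ℝ} (hz : AffineOn U a b z) :
    G z = 0 ∧ ∀ η > 0, ∀ᶠ n in (𝒰 : Filter ℕ), ∃ i : ℤ, a < eps L n * i ∧ eps L n * i < b ∧
      ‖window M (d n) i - window M (per z) i‖ ≤ η := by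
  obtain ⟨η₀, hη₀, hsep⟩ := hG.exists_separation
  obtain ⟨t, ht, hreg⟩ : ∃ t ∈ Ioo a b, Regular G L 𝒰 d η₀ t := by
    by_contra! hcon
    exact (Ioo_infinite hab) ((h.finite_not_regular hG hη₀ a b).subset
      fun t ht => ⟨hcon t ht, Ioo_subset_Icc_self ht⟩)
  obtain ⟨r, hr, y, hy, hpat⟩ := h.exists_pattern hG hsep hreg
  obtain ⟨r', hr', hr1, hr2, hr3⟩ : ∃ r' > 0, r' < r ∧ a ≤ t - r' ∧ t + r' ≤ b := by
    refine ⟨min (r / 2) (min (t - a) (b - t)), ?_, ?_, ?_, ?_⟩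
    · exact lt_min (half_pos hr) (lt_min (sub_pos.2 ht.1) (sub_pos.2 ht.2))
    · exact (min_le_left _ _).trans_lt (half_lt_self hr)
    · linarith [(min_le_right (r / 2) (min (t - a) (b - t))).trans (min_le_left _ _)]
    · linarith [(min_le_right (r / 2) (min (t - a) (b - t))).trans (min_le_right _ _)]
  have hy' := h.affineOn_of_pattern hG hη₀ hsep hy hpat hr1
  have hyz : y = z := hy'.slope_unique (hz.mono hr2 hr3) (by linarith)
  subst hyz
  refine ⟨hy, fun η hη => ?_⟩
  have hpat' : ∀ᶠ n in (𝒰 : Filter ℕ), ∀ i : ℤ, t - r' < eps L n * i → eps L n * i < t + r' →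
      ‖window M (d n) i - window M (per y) i‖ ≤ η₀ := by
    filter_upwards [hpat] with n hn i h1 h2
    exact hn i (by linarith) (by linarith)
  filter_upwards [h.exists_cell hG hη₀ hsep hr' hy hpat' hη] with n hn
  obtain ⟨i, h1, h2, h3⟩ := hn
  exact ⟨i, by linarith, by linarith, h3⟩

theorem isPiecewiseAffine (h : LimitSetting G L α C q 𝒰 d x U) (hG : IsWellCost G) :
    IsPiecewiseAffine U := by
  obtain ⟨η₀, hη₀, hsep⟩ := hG.exists_separation
  refine ⟨h.continuous hG, _, fun a b => h.finite_not_regular hG hη₀ a b, fun t ht => ?_⟩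
  obtain ⟨r, hr, y, hy, hpat⟩ := h.exists_pattern hG hsep (not_not.1 ht)
  have hy' := h.affineOn_of_pattern hG hη₀ hsep hy hpat (half_lt_self hr)
  refine ⟨y, ?_⟩
  filter_upwards [Ioo_mem_nhds (by linarith : t - r / 2 < t) (by linarith : t < t + r / 2)] with
    s hs
  have := hy' t ⟨by linarith, by linarith⟩ s ⟨hs.1.le, hs.2.le⟩
  rw [← this]; simp

theorem cost_rightSlope (h : LimitSetting G L α C q 𝒰 d x U) (hG : IsWellCost G) (t : ℝ) :
    G (rightSlope U t) = 0 := by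
  obtain ⟨δ, hδ, h1, -⟩ := (h.isPiecewiseAffine hG).exists_slopes t
  exact (h.exists_cell_of_affineOn hG (by linarith) h1).1

/-- The slopes of a shift of the limit by `L` are those of the limit, rotated by `q`. -/
theorem apply_add (h : LimitSetting G L α C q 𝒰 d x U) (hG : IsWellCost G) (t : ℝ) (k : Fin M) :
    U (t + L) (k + q) = U L (k + q) + (U t k - U 0 k) := by
  have hM : (0 : ℝ) < M := by exact_mod_cast Nat.pos_of_ne_zero (NeZero.ne M)
  obtain ⟨R, hR0, hR⟩ := h.bounded hG
  have hlim := ((h.tendsto (t + L) (k + q)).sub (h.tendsto L (k + q))).sub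
    ((h.tendsto t k).sub (h.tendsto 0 k))
  suffices U (t + L) (k + q) - U L (k + q) - (U t k - U 0 k) = 0 by linarith
  refine tendsto_nhds_unique hlim ?_
  have h0 : Tendsto (fun n => R * (M * eps L n) + R * (M * eps L n)) 𝒰 (𝓝 0) := by
    have := ((h.tendsto_eps.const_mul (M : ℝ)).const_mul R)
    simpa using this.add this
  refine squeeze_zero_norm' ?_ h0
  filter_upwards [h.eps_pos, h.ne_zero, h.mod, h.periodic, hR] with n hε hn hmod hper hRn
  have hMε : 0 < M * eps L n := by positivity
  -- Moving by a period of `n` sites sends the `k`-th entry of a block to the entry `k + q` (modulo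
  -- `M`) of the block `m` places further. The length `m M ε_n` of these blocks differs from `L` by
  -- at most `M ε_n`, which only produces an error that vanishes.
  obtain ⟨m, hm⟩ : ∃ m : ℕ, n + k = M * m + (k + q : Fin M) := by
    have h1 : (n + k) % M = (k + q : Fin M) := by
      rw [Fin.val_add, Nat.add_mod, hmod, Nat.add_mod_mod, Nat.add_comm]
    exact ⟨(n + k) / M, by rw [← h1, Nat.div_add_mod]⟩
  have hk := k.2
  have hkq := (k + q).2
  set τ := L - m * (M * eps L n) with hτ
  have hτ' : |τ| ≤ M * eps L n := by
    have e : τ = eps L n * ((n : ℝ) - M * m) := by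
      rw [hτ]; nth_rewrite 1 [← eps_mul (L := L) hn]; ring
    have h1 : |(n : ℝ) - M * m| ≤ M := by
      rw [abs_le]
      have h2 : (n : ℝ) + (k : ℕ) = M * m + ((k + q : Fin M) : ℕ) := by exact_mod_cast hm
      have h3 : ((k : ℕ) : ℝ) < M := by exact_mod_cast hk
      have h4 : (((k + q : Fin M) : ℕ) : ℝ) < M := by exact_mod_cast hkq
      have h5 : (0 : ℝ) ≤ ((k : ℕ) : ℝ) := by positivity
      have h6 : (0 : ℝ) ≤ (((k + q : Fin M) : ℕ) : ℝ) := by positivity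
      constructor <;> linarith
    rw [e, abs_mul, abs_of_pos hε, mul_comm]
    exact mul_le_mul_of_nonneg_right h1 hε.le
  set B := fun (j : Fin M) s => blockInterp M (eps L n) (d n) (x n) j s with hB
  have hshift : B (k + q) (t + L) - B (k + q) (m * (M * eps L n)) = B k (t + τ) - B k 0 := by
    simp only [hB]
    rw [blockInterp_sub hMε, blockInterp_sub hMε]
    have h1 := integral_step_shift (fun I => d n (M * I + (((k + q : Fin M) : ℕ) : ℤ))) hMε m 0
      (t + τ)
    have e1 : t + τ + ((m : ℤ) : ℝ) * (M * eps L n) = t + L := by rw [hτ]; push_cast; ring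
    have e2 : (0 : ℝ) + ((m : ℤ) : ℝ) * (M * eps L n) = m * (M * eps L n) := by push_cast; ring
    rw [e1, e2] at h1
    rw [h1]
    refine intervalIntegral.integral_congr fun s _ => ?_
    show d n _ = d n _
    rw [← hper (M * ⌊s / (M * eps L n)⌋ + ((k : ℕ) : ℤ))]
    congr 1
    have : (n : ℤ) + (k : ℕ) = M * m + ((k + q : Fin M) : ℕ) := by exact_mod_cast hm
    linarith
  have h1 := abs_blockInterp_sub_le hMε hRn (x n) (k + q) L (m * (M * eps L n))
  have h2 := abs_blockInterp_sub_le hMε hRn (x n) k t (t + τ)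
  have e3 : |m * (M * eps L n) - L| = |τ| := by rw [hτ, abs_sub_comm]
  rw [e3] at h1
  rw [add_sub_cancel_left] at h2
  have h1' := h1.trans (mul_le_mul_of_nonneg_left hτ' hR0)
  have h2' := h2.trans (mul_le_mul_of_nonneg_left hτ' hR0)
  have e4 : B (k + q) (t + L) - B (k + q) L - (B k t - B k 0) =
      (B (k + q) (m * (M * eps L n)) - B (k + q) L) + (B k (t + τ) - B k t) := by linarith
  rw [Real.norm_eq_abs]
  show |B (k + q) (t + L) - B (k + q) L - (B k t - B k 0)| ≤ _
  rw [e4]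
  exact (abs_add_le _ _).trans (add_le_add h1' h2')

/-- Together the `M` interpolations use every slope of the first `⌊n/M⌋` blocks, each for a length
`M ε_n`. The fewer than `M` sites left over in the period contribute `O(ε_n)`. -/
theorem sum_apply_sub (h : LimitSetting G L α C q 𝒰 d x U) (hG : IsWellCost G) :
    ∑ k, U L k - ∑ k, U 0 k = M * (L * α) := by
  have hM : (0 : ℝ) < M := by exact_mod_cast Nat.pos_of_ne_zero (NeZero.ne M)
  obtain ⟨R, hR0, hR⟩ := h.bounded hG
  have hlim := (tendsto_finsetSum Finset.univ fun k _ =>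
    (h.tendsto L k).sub (h.tendsto 0 k)).sub_const (M * (L * α))
  rw [← Finset.sum_sub_distrib, ← sub_eq_zero]
  refine tendsto_nhds_unique hlim ?_
  have h0 : Tendsto (fun n => M * (R * (M * eps L n)) + M * eps L n * (M * R)) 𝒰 (𝓝 0) := by
    have h1 := h.tendsto_eps.const_mul (M : ℝ)
    simpa using ((h1.const_mul R).const_mul (M : ℝ)).add (h1.mul_const (M * R))
  refine squeeze_zero_norm' ?_ h0
  filter_upwards [h.eps_pos, h.ne_zero, h.sum_eq, hR] with n hε hn hsum hRn
  have hMε : 0 < M * eps L n := by positivity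
  set m := n / M with hm
  have hmn : M * m + n % M = n := Nat.div_add_mod n M
  have hlt : n % M < M := Nat.mod_lt _ (Nat.pos_of_ne_zero (NeZero.ne M))
  set B := fun (j : Fin M) s => blockInterp M (eps L n) (d n) (x n) j s with hB
  have h1 : ∀ k, |B k L - B k (m * (M * eps L n))| ≤ R * (M * eps L n) := by
    intro k
    refine (abs_blockInterp_sub_le hMε hRn (x n) k _ _).trans ?_
    refine mul_le_mul_of_nonneg_left ?_ hR0
    have e : L - m * (M * eps L n) = eps L n * ((n % M : ℕ) : ℝ) := by
      have : (n : ℝ) = M * m + ((n % M : ℕ) : ℝ) := by exact_mod_cast hmn.symm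
      nth_rewrite 1 [← eps_mul (L := L) hn]
      rw [this]
      rw [← this]; ring_nf
      rw [this]; ring
    rw [e, abs_of_nonneg (by positivity), mul_comm]
    refine mul_le_mul_of_nonneg_right ?_ hε.le
    exact_mod_cast hlt.le
  have h2 : ∑ k, (B k (m * (M * eps L n)) - B k 0) =
      M * eps L n * ∑ i ∈ Finset.range (M * m), d n i := by
    rw [← sum_range_blocks, Finset.sum_comm, Finset.mul_sum]
    refine Finset.sum_congr rfl fun k _ => ?_
    simp only [hB]
    rw [blockInterp_sub hMε]
    have := integral_step_Ico (fun I => d n (M * I + ((k : ℕ) : ℤ))) hMε (m := 0) (n := m)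
      (by positivity)
    simpa using this
  have h3 : |∑ i ∈ Finset.range (M * m), d n i - n * α| ≤ M * R := by
    have h4 := Finset.sum_range_add (fun i : ℕ => d n i) (M * m) (n % M)
    rw [hmn, hsum] at h4
    rw [h4, sub_add_cancel_left, abs_neg]
    refine (Finset.abs_sum_le_sum_abs _ _).trans
      ((Finset.sum_le_card_nsmul _ _ R fun i _ => hRn _).trans ?_)
    rw [Finset.card_range, nsmul_eq_mul]
    refine mul_le_mul_of_nonneg_right ?_ hR0
    exact_mod_cast hlt.le
  have e5 : ∑ k, (B k L - B k 0) - M * (L * α) = ∑ k, (B k L - B k (m * (M * eps L n))) +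
      M * eps L n * (∑ i ∈ Finset.range (M * m), d n i - n * α) := by
    have h6 : M * (L * α) = M * eps L n * (n * α) := by
      nth_rewrite 1 [← eps_mul (L := L) hn]; ring
    rw [mul_sub, ← h2, h6, ← add_sub_assoc, ← Finset.sum_add_distrib]
    congr 1
    exact Finset.sum_congr rfl fun k _ => by ring
  rw [Real.norm_eq_abs]
  show |∑ k, (B k L - B k 0) - M * (L * α)| ≤ _
  rw [e5]
  refine (abs_add_le _ _).trans (add_le_add ?_ ?_)
  · refine (Finset.abs_sum_le_sum_abs _ _).trans
      ((Finset.sum_le_card_nsmul _ _ _ fun k _ => h1 k).trans ?_)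
    simp
  · rw [abs_mul, abs_of_pos hMε]
    exact mul_le_mul_of_nonneg_left h3 hMε.le

end Abstract

/-! ### Membership in the limit domain and energy of the jumps -/

section Interfaces
variable {M : ℕ} [NeZero M] {ψ₁ ψM : ℝ → ℝ} {L ℓ C : ℝ} {q : Fin M} {𝒰 : Ultrafilter ℕ}
  {d : ℕ → ℤ → ℝ} {x : ℕ → ℝ} {U : ℝ → Fin M → ℝ}

theorem mem_limitDomain (h : LimitSetting (cost M ψ₁ ψM (ℓ / L)) L (ℓ / L) C q 𝒰 d x U)
    (hG : IsWellCost (cost M ψ₁ ψM (ℓ / L)))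
    (hZ : minimalSlopes M ψ₁ ψM (ℓ / L) = {z | cost M ψ₁ ψM (ℓ / L) z = 0}) :
    U ∈ limitDomain M ψ₁ ψM L ℓ q := by
  have hpa := h.isPiecewiseAffine hG
  refine ⟨hpa, h.apply_zero, fun t ht => ?_, ?_, fun t => ?_, fun t ht htL k => ?_⟩
  · rw [(hpa.hasDerivAt ht).deriv, hZ]
    exact h.cost_rightSlope hG t
  · exact (hpa.finite_jumpSet 0 L).subset (inter_subset_inter_right _ Ioc_subset_Icc_self)
  -- The rotation by `q` permutes the components, so it disappears from the sum over them.
  · have h1 : ∑ k, U (t + L) k = ∑ k, U (t + L) (k + q) :=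
      (Equiv.sum_comp (Equiv.addRight q) fun k => U (t + L) k).symm
    have h2 : ∑ k, U L k = ∑ k, U L (k + q) :=
      (Equiv.sum_comp (Equiv.addRight q) fun k => U L k).symm
    have h3 := h.sum_apply_sub hG
    simp_rw [h.apply_add hG] at h1
    rw [Finset.sum_add_distrib, Finset.sum_sub_distrib, ← h2] at h1
    have h4 : L * (ℓ / L) = ℓ := by have := h.L_pos; field_simp
    show ∑ k, U (t + L) k - M * (ℓ / L) * (t + L) = ∑ k, U t k - M * (ℓ / L) * t
    rw [h1]; linarith
  · have h1 := hasDerivAt_pi.1 (hpa.hasDerivAt ht) k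
    have h2 : HasDerivAt (fun s => U (s + L) (k + q)) (rightSlope U (t + L) (k + q)) t :=
      (hasDerivAt_pi.1 (hpa.hasDerivAt htL) (k + q)).comp_add_const t L
    have h3 : (fun s => U (s + L) (k + q)) = fun s => U L (k + q) + (U s k - U 0 k) :=
      funext fun s => h.apply_add hG s k
    rw [h3] at h2
    rw [(hpa.hasDerivAt ht).deriv, (hpa.hasDerivAt htL).deriv]
    exact ((h1.sub_const _).const_add _).unique h2

/-- The energy of the cells around a jump is asymptotically at least the transition energy. -/
theorem transitionEnergy_le {α : ℝ} (h : LimitSetting (cost M ψ₁ ψM α) L α C q 𝒰 d x U)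
    (hG : IsWellCost (cost M ψ₁ ψM α)) (t : ℝ) {δ e : ℝ} (hδ : 0 < δ) (he : 0 < e) :
    ∀ᶠ n in (𝒰 : Filter ℕ), ∃ a b : ℤ, t - δ < eps L n * a ∧ a ≤ b ∧ eps L n * b < t + δ ∧
      transitionEnergy M ψ₁ ψM α (leftSlope U t) (rightSlope U t) ≤
        ∑ i ∈ Finset.Icc a b, cost M ψ₁ ψM α (window M (d n) i) + e := by
  have hM : (0 : ℝ) < M := by exact_mod_cast Nat.pos_of_ne_zero (NeZero.ne M)
  obtain ⟨δ', hδ', h1, h2⟩ := (h.isPiecewiseAffine hG).exists_slopes t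
  set r := min δ δ' with hr
  have hr0 : 0 < r := lt_min hδ hδ'
  have h1' := h1.mono le_rfl (by linarith [min_le_right δ δ'] : t + r ≤ t + δ')
  have h2' := h2.mono (by linarith [min_le_right δ δ'] : t - δ' ≤ t - r) le_rfl
  -- Cutting and pasting costs `2Mκ`, which is to be `e`; the bound `η ≤ 1` below replaces `κ ‖h‖`
  -- by `κ`.
  set κ := e / (2 * M) with hκ
  have hκ0 : 0 < κ := by positivity
  obtain ⟨ρ, hρ, hadd⟩ := hG.add_le κ hκ0
  set η := min ρ 1 with hη
  have hη0 : 0 < η := by positivity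
  have hadd' : ∀ z, cost M ψ₁ ψM α z = 0 → ∀ h, ‖h‖ ≤ η → cost M ψ₁ ψM α (z + h) ≤ κ := by
    intro z hz w hw
    refine (hadd z hz w (hw.trans (min_le_left _ _))).trans ?_
    have := hw.trans (min_le_right _ _)
    nlinarith
  obtain ⟨hz', hcell'⟩ := h.exists_cell_of_affineOn hG (by linarith) h1'
  obtain ⟨hz, hcell⟩ := h.exists_cell_of_affineOn hG (by linarith) h2'
  filter_upwards [hcell' η hη0, hcell η hη0, h.eps_pos] with n hn' hn hε
  obtain ⟨a, ha1, ha2, ha3⟩ := hn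
  obtain ⟨b, hb1, hb2, hb3⟩ := hn'
  have hab : a ≤ b := by
    have : (a : ℝ) < b := lt_of_mul_lt_mul_left (ha2.trans hb1) hε.le
    exact_mod_cast this.le
  refine ⟨a, b, by linarith [min_le_left δ δ'], hab, by linarith [min_le_left δ δ'], ?_⟩
  have := transitionEnergy_le_of_near hG hz hz' hκ0.le hη0.le hadd' hab ha3 hb3
  have e1 : 2 * M * κ = e := by rw [hκ]; field_simp
  rwa [e1] at this

/-- The cells that account for different jumps are disjoint and fit in one period, so their energies
add up to at most `C`. -/
theorem interfaceEnergy_le (h : LimitSetting (cost M ψ₁ ψM (ℓ / L)) L (ℓ / L) C q 𝒰 d x U)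
    (hG : IsWellCost (cost M ψ₁ ψM (ℓ / L))) : interfaceEnergy M ψ₁ ψM L ℓ U ≤ C := by
  classical
  have hfin : (jumpSet U ∩ Ioc 0 L).Finite :=
    ((h.isPiecewiseAffine hG).finite_jumpSet 0 L).subset
      (inter_subset_inter_right _ Ioc_subset_Icc_self)
  unfold interfaceEnergy
  rw [finsum_mem_eq_finite_toFinset_sum _ hfin]
  set J := hfin.toFinset with hJ
  have hJmem : ∀ t ∈ J, 0 < t ∧ t ≤ L := fun t ht => ((hfin.mem_toFinset).1 ht).2
  -- A jump may sit at `L`, with cells beyond `L`. Starting the period at `r₀` instead of `0`, with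
  -- neighbourhoods of radius at most `r₀`, includes them and loses none near the first jump.
  obtain ⟨r₀, hr₀, hr₀J⟩ : ∃ r₀ > 0, ∀ t ∈ J, 2 * r₀ ≤ t := by
    obtain ⟨r, hr, -, hr'⟩ := exists_separation_finset (insert 0 J) one_pos
    refine ⟨r, hr, fun t ht => ?_⟩
    have := hr' t (Finset.mem_insert_of_mem ht) 0 (Finset.mem_insert_self _ _) (hJmem t ht).1.ne'
    rwa [sub_zero, abs_of_pos (hJmem t ht).1] at this
  obtain ⟨δ, hδ, hδr, hδJ⟩ := exists_separation_finset J hr₀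
  refine le_of_forall_pos_le_add fun e he => ?_
  have hcard : (0 : ℝ) < J.card + 1 := by positivity
  have hev : ∀ᶠ n in (𝒰 : Filter ℕ), ∀ t ∈ J, ∃ a b : ℤ, t - δ < eps L n * a ∧ a ≤ b ∧
      eps L n * b < t + δ ∧
      transitionEnergy M ψ₁ ψM (ℓ / L) (leftSlope U t) (rightSlope U t) ≤
        ∑ i ∈ Finset.Icc a b, cost M ψ₁ ψM (ℓ / L) (window M (d n) i) + e / (J.card + 1) := by
    rw [Filter.eventually_all_finset]
    exact fun t _ => h.transitionEnergy_le hG t hδ (by positivity)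
  obtain ⟨n, hn, hε, hne, hper, hE⟩ :=
    (hev.and (h.eps_pos.and (h.ne_zero.and (h.periodic.and h.energy)))).exists
  choose! a b h1 h2 h3 h4 using hn
  have hmem : ∀ t ∈ J, ∀ i ∈ Finset.Icc (a t) (b t), t - δ < eps L n * i ∧
      eps L n * i < t + δ := by
    intro t ht i hi
    rw [Finset.mem_Icc] at hi
    have h5 : (a t : ℝ) ≤ i := by exact_mod_cast hi.1
    have h6 : (i : ℝ) ≤ b t := by exact_mod_cast hi.2
    have h7 := mul_le_mul_of_nonneg_left h5 hε.le
    have h8 := mul_le_mul_of_nonneg_left h6 hε.le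
    exact ⟨(h1 t ht).trans_le h7, h8.trans_lt (h3 t ht)⟩
  have hdisj : (J : Set ℝ).PairwiseDisjoint fun t => Finset.Icc (a t) (b t) := by
    intro s hs t ht hst
    rw [Function.onFun, Finset.disjoint_left]
    intro i his hit
    obtain ⟨h5, h6⟩ := hmem s hs i his
    obtain ⟨h7, h8⟩ := hmem t ht i hit
    have h9 := hδJ s hs t ht hst
    have : |s - t| < 2 * δ := by rw [abs_lt]; constructor <;> linarith
    linarith
  have hsub : J.biUnion (fun t => Finset.Icc (a t) (b t)) ⊆
      Finset.Ico ⌈r₀ / eps L n⌉ (⌈r₀ / eps L n⌉ + n) := by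
    intro i hi
    obtain ⟨t, ht, hi⟩ := Finset.mem_biUnion.1 hi
    obtain ⟨h5, h6⟩ := hmem t ht i hi
    have h7 := hr₀J t ht
    have h8 := (hJmem t ht).2
    rw [Finset.mem_Ico]
    constructor
    · rw [Int.ceil_le, div_le_iff₀ hε]; linarith
    · have h9 : (i : ℝ) < r₀ / eps L n + n := by
        rw [← lt_div_iff₀' hε] at h6
        refine h6.trans_le ?_
        rw [div_add' _ _ _ hε.ne', mul_comm, eps_mul hne]
        exact div_le_div_of_nonneg_right (by linarith) hε.le
      have h10 := Int.le_ceil (r₀ / eps L n)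
      have : (i : ℝ) < ((⌈r₀ / eps L n⌉ + n : ℤ) : ℝ) := by push_cast; linarith
      exact_mod_cast this
  have h11 : ∑ t ∈ J, ∑ i ∈ Finset.Icc (a t) (b t), cost M ψ₁ ψM (ℓ / L) (window M (d n) i) ≤ C := by
    rw [← Finset.sum_biUnion hdisj]
    refine (Finset.sum_le_sum_of_subset_of_nonneg hsub fun i _ _ => hG.nonneg _).trans ?_
    rw [sum_Ico_of_periodic (f := fun i => cost M ψ₁ ψM (ℓ / L) (window M (d n) i))
      (fun i => by rw [window_add_of_periodic hper])]
    exact hE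
  refine (Finset.sum_le_sum fun t ht => h4 t ht).trans ?_
  rw [Finset.sum_add_distrib, Finset.sum_const, nsmul_eq_mul]
  have h12 : (J.card : ℝ) * (e / (J.card + 1)) ≤ e := by
    rw [mul_div_assoc', div_le_iff₀ hcard]; nlinarith
  linarith

end Interfaces
end LimitSetting

/-! ### The lower bound -/

theorem interpolation_eq (M : ℕ) (L : ℝ) (n : ℕ) (u : ℝ → ℝ) (k : Fin M) (t : ℝ) :
    interpolation M L n u k t =
      blockInterp M (eps L n) (latticeSlope L n u) (node L n u 0) k t := rfl

/-- Convergence in `L^∞` implies convergence almost everywhere. -/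
theorem InterpConverges.ae_tendsto {M : ℕ} {L : ℝ} {l : Filter ℕ} {u : ℕ → ℝ → ℝ}
    {v : ℝ → Fin M → ℝ} (h : InterpConverges M L l u v) :
    ∀ᵐ t ∂(volume.restrict (Ioo 0 L)), ∀ k : Fin M,
      Tendsto (fun n => interpolation M L n (u n) k t) l (𝓝 (v t k)) := by
  rw [ae_all_iff]
  intro k
  have h1 : ∀ᵐ t ∂(volume.restrict (Ioo 0 L)), ∀ n,
      ‖interpolation M L n (u n) k t - v t k‖ₑ ≤
        eLpNorm (fun t => interpolation M L n (u n) k t - v t k) ⊤ (volume.restrict (Ioo 0 L)) := by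
    rw [ae_all_iff]
    intro n
    rw [eLpNorm_exponent_top]
    exact enorm_ae_le_eLpNormEssSup _ _
  filter_upwards [h1] with t ht
  have h2 : Tendsto (fun n => ‖interpolation M L n (u n) k t - v t k‖ₑ) l (𝓝 0) :=
    tendsto_of_tendsto_of_tendsto_of_le_of_le tendsto_const_nhds (h k) (fun _ => bot_le) ht
  have h3 := tendsto_zero_iff_enorm_tendsto_zero.2 h2
  simpa using h3.add_const (v t k)

/-- Otherwise the energies are frequently below a real `C` that is less than the limit value. An
ultrafilter on those indices produces a limit in the domain that agrees with `v` almost everywhere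
and has interface energy at most `C`, a contradiction. -/
theorem Admissible.limitEnergy_le_liminf {M : ℕ} {W₁ W₂ ψ₁ ψM : ℝ → ℝ} {c L ℓ : ℝ}
    (H : Admissible M W₁ W₂ ψ₁ ψM c (ℓ / L)) (hL : 0 < L) (q : Fin M) {v : ℝ → Fin M → ℝ}
    {u : ℕ → ℝ → ℝ}
    (hconv : InterpConverges M L (atTop ⊓ 𝓟 {n : ℕ | n % M = q}) u v) :
    limitEnergy M ψ₁ ψM L ℓ q v ≤
      liminf (fun n => renormEnergy M ψ₁ ψM L ℓ n (u n)) (atTop ⊓ 𝓟 {n : ℕ | n % M = q}) := by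
  have hG := H.isWellCost
  have := hG.neZero
  have hM := H.pos
  by_contra! hlt
  obtain ⟨C, hC1, hC2⟩ := EReal.lt_iff_exists_real_btwn.1 hlt
  have hfreq := frequently_lt_of_liminf_lt (by isBoundedDefault) hC1
  set l : Filter ℕ := atTop ⊓ 𝓟 {n : ℕ | n % M = q} with hl
  have : NeBot (l ⊓ 𝓟 {n | renormEnergy M ψ₁ ψM L ℓ n (u n) < C}) :=
    frequently_iff_neBot.1 hfreq
  set 𝒰 : Ultrafilter ℕ := Ultrafilter.of (l ⊓ 𝓟 {n | renormEnergy M ψ₁ ψM L ℓ n (u n) < C})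
    with h𝒰
  have h𝒰le : (𝒰 : Filter ℕ) ≤ l ⊓ 𝓟 {n | renormEnergy M ψ₁ ψM L ℓ n (u n) < C} :=
    Ultrafilter.of_le _
  have h𝒰l : (𝒰 : Filter ℕ) ≤ l := h𝒰le.trans inf_le_left
  have h𝒰top : (𝒰 : Filter ℕ) ≤ atTop := h𝒰l.trans inf_le_left
  have hne : ∀ᶠ n in (𝒰 : Filter ℕ), n ≠ 0 := h𝒰top (eventually_ne_atTop 0)
  have hmod : ∀ᶠ n in (𝒰 : Filter ℕ), n % M = q :=
    h𝒰l.trans inf_le_right (mem_principal_self _)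
  have hEC : ∀ᶠ n in (𝒰 : Filter ℕ), renormEnergy M ψ₁ ψM L ℓ n (u n) < C :=
    h𝒰le.trans inf_le_right (mem_principal_self _)
  have hmem : ∀ᶠ n in (𝒰 : Filter ℕ), u n ∈ discreteSpace L ℓ n := by
    filter_upwards [hEC] with n hn
    by_contra hnot
    unfold renormEnergy at hn
    rw [if_neg hnot] at hn
    exact not_top_lt hn
  have hper : ∀ᶠ n in (𝒰 : Filter ℕ), ∀ i, latticeSlope L n (u n) (i + n) =
      latticeSlope L n (u n) i := by
    filter_upwards [hne, hmem] with n hn hu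
    exact latticeSlope_add hL hn hu.1
  have hE : ∀ᶠ n in (𝒰 : Filter ℕ), ∑ i ∈ Finset.range n,
      cost M ψ₁ ψM (ℓ / L) (window M (latticeSlope L n (u n)) i) ≤ C := by
    filter_upwards [hne, hmem, hEC] with n hn hu hlt
    rw [H.renormEnergy_eq hL hn hu, EReal.coe_lt_coe_iff] at hlt
    exact hlt.le
  have hae := hconv.ae_tendsto
  -- the values of the interpolations are bounded
  obtain ⟨R, hR0, hR⟩ := hG.exists_bound C
  have hd : ∀ᶠ n in (𝒰 : Filter ℕ), ∀ i, |latticeSlope L n (u n) i| ≤ R := by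
    filter_upwards [hne, hper, hE] with n h1 h2 h3
    exact hR h1 h2 h3
  have : NeBot (ae (volume.restrict (Ioo 0 L))) := by
    rw [ae_neBot, Ne, Measure.restrict_eq_zero, Real.volume_Ioo, ENNReal.ofReal_eq_zero]
    linarith
  obtain ⟨t₀, ht₀⟩ := hae.exists
  have hbd : ∀ t k, ∃ y, Tendsto (fun n => blockInterp M (eps L n) (latticeSlope L n (u n))
      (node L n (u n) 0) k t) 𝒰 (𝓝 y) := by
    intro t k
    -- Convergence is given only on `(0, L)`. Boundedness at one point `t₀` of it, together with the
    -- common Lipschitz bound, gives boundedness at every real `t`, and ultrafilters on compact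
    -- intervals converge.
    set K := |v t₀ k| + 1 + R * |t - t₀| with hK
    have hin : ∀ᶠ n in (𝒰 : Filter ℕ), blockInterp M (eps L n) (latticeSlope L n (u n))
        (node L n (u n) 0) k t ∈ Icc (-K) K := by
      have h1 := (ht₀ k).abs.eventually (gt_mem_nhds (lt_add_one |v t₀ k|))
      filter_upwards [h𝒰l h1, hd, hne] with n hn hdn hn0
      have hε := eps_pos hL hn0
      have h2 := abs_blockInterp_sub_le (M := M) (h := eps L n) (by positivity) hdn
        (node L n (u n) 0) k t₀ t
      rw [interpolation_eq] at hn
      rw [mem_Icc, ← abs_le]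
      calc _ = |blockInterp M (eps L n) (latticeSlope L n (u n)) (node L n (u n) 0) k t₀ +
          (blockInterp M (eps L n) (latticeSlope L n (u n)) (node L n (u n) 0) k t -
          blockInterp M (eps L n) (latticeSlope L n (u n)) (node L n (u n) 0) k t₀)| := by
            rw [add_sub_cancel]
        _ ≤ _ := abs_add_le _ _
        _ ≤ _ := add_le_add hn.le h2
    obtain ⟨y, -, hy⟩ := (isCompact_Icc (a := -K) (b := K)).ultrafilter_le_nhds
      (𝒰.map fun n => blockInterp M (eps L n) (latticeSlope L n (u n)) (node L n (u n) 0) k t)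
      (le_principal_iff.2 hin)
    exact ⟨y, hy⟩
  choose U hU using hbd
  have hset : LimitSetting (cost M ψ₁ ψM (ℓ / L)) L (ℓ / L) C q 𝒰
      (fun n => latticeSlope L n (u n)) (fun n => node L n (u n) 0) U := by
    refine ⟨hL, h𝒰top, hmod, hper, ?_, hE, hU⟩
    filter_upwards [hne, hmem] with n hn hu
    exact sum_latticeSlope hL hn hu.1
  have hUD := hset.mem_limitDomain hG H.minimalSlopes_eq
  have hvU : ∀ᵐ t ∂(volume.restrict (Ioo 0 L)), v t = U t := by
    filter_upwards [hae] with t ht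
    funext k
    exact tendsto_nhds_unique ((ht k).mono_left h𝒰l) (hU t k)
  have h1 : limitEnergy M ψ₁ ψM L ℓ q v ≤ ((interfaceEnergy M ψ₁ ψM L ℓ U : ℝ) : EReal) :=
    iInf₂_le U ⟨hUD, hvU⟩
  have h2 : ((interfaceEnergy M ψ₁ ψM L ℓ U : ℝ) : EReal) ≤ C :=
    EReal.coe_le_coe_iff.2 (hset.interfaceEnergy_le hG)
  exact absurd hC2 (not_lt.2 (h1.trans h2))


/-! ### The limit domain -/

/-- The properties of the elements of the limit domain that the construction of recovery sequences
uses. -/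
structure IsTwisted {M : ℕ} (G : (Fin M → ℝ) → ℝ) (L α : ℝ) (q : Fin M) (u : ℝ → Fin M → ℝ) :
    Prop where
  L_pos : 0 < L
  pa : IsPiecewiseAffine u
  zero_right : ∀ t, G (rightSlope u t) = 0
  zero_left : ∀ t, G (leftSlope u t) = 0
  shift_right : ∀ t k, rightSlope u (t + L) (k + q) = rightSlope u t k
  shift_left : ∀ t k, leftSlope u (t + L) (k + q) = leftSlope u t k
  sum_shift : ∀ t, ∑ k, u (t + L) k - ∑ k, u t k = M * (L * α)
  apply_zero : ∀ k k', u 0 k = u 0 k'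

/-- The conditions of the domain concern points off the jump set. Jumps are isolated, so the
one-sided slopes at any point are slopes at nearby points that are no jumps, and the conditions pass
to them. -/
theorem isTwisted_of_mem_limitDomain {M : ℕ} {G : (Fin M → ℝ) → ℝ} {ψ₁ ψM : ℝ → ℝ} {L ℓ : ℝ}
    {q : Fin M} {u : ℝ → Fin M → ℝ} (hL : 0 < L)
    (hZ : minimalSlopes M ψ₁ ψM (ℓ / L) = {z | G z = 0}) (hu : u ∈ limitDomain M ψ₁ ψM L ℓ q) :
    IsTwisted G L (ℓ / L) q u := by
  obtain ⟨hpa, h0, hmin, -, hper, hshift⟩ := hu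
  have hzero : ∀ s ∉ jumpSet u, G (rightSlope u s) = 0 := by
    intro s hs
    have := hmin s hs
    rwa [(hpa.hasDerivAt hs).deriv, hZ] at this
  have hsh : ∀ s ∉ jumpSet u, s + L ∉ jumpSet u → ∀ k,
      rightSlope u (s + L) (k + q) = rightSlope u s k := by
    intro s hs hsL k
    have := hshift s hs hsL k
    rw [(hpa.hasDerivAt hs).deriv, (hpa.hasDerivAt hsL).deriv] at this
    exact this.symm
  have hnear : ∀ t, ∃ δ > 0, ∀ r ∈ Ioo 0 δ,
      (t + r ∉ jumpSet u ∧ rightSlope u (t + r) = rightSlope u t) ∧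
      (t - r ∉ jumpSet u ∧ rightSlope u (t - r) = leftSlope u t) := by
    intro t
    obtain ⟨δ, hδ, h1, h2⟩ := hpa.exists_slopes t
    refine ⟨δ, hδ, fun r hr => ⟨⟨?_, ?_⟩, ?_, ?_⟩⟩
    · exact h1.notMem_jumpSet (by linarith [hr.1]) (by linarith [hr.2])
    · exact h1.rightSlope_eq (by linarith [hr.1]) (by linarith [hr.2])
    · exact h2.notMem_jumpSet (by linarith [hr.2]) (by linarith [hr.1])
    · exact h2.rightSlope_eq (by linarith [hr.2]) (by linarith [hr.1])
  refine ⟨hL, hpa, fun t => ?_, fun t => ?_, fun t k => ?_, fun t k => ?_, fun t => ?_, h0⟩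
  · obtain ⟨δ, hδ, h⟩ := hnear t
    obtain ⟨⟨h1, h2⟩, -⟩ := h (δ / 2) ⟨by linarith, by linarith⟩
    rw [← h2]; exact hzero _ h1
  · obtain ⟨δ, hδ, h⟩ := hnear t
    obtain ⟨-, h1, h2⟩ := h (δ / 2) ⟨by linarith, by linarith⟩
    rw [← h2]; exact hzero _ h1
  · obtain ⟨δ, hδ, h⟩ := hnear t
    obtain ⟨δ', hδ', h'⟩ := hnear (t + L)
    have hr : 0 < min δ δ' / 2 := by positivity
    have hr1 := min_le_left δ δ'
    have hr2 := min_le_right δ δ'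
    obtain ⟨⟨h1, h2⟩, -⟩ := h (min δ δ' / 2) ⟨hr, by linarith⟩
    obtain ⟨⟨h3, h4⟩, -⟩ := h' (min δ δ' / 2) ⟨hr, by linarith⟩
    rw [← h2, ← h4]
    rw [add_right_comm] at h3 ⊢
    exact hsh _ h1 h3 k
  · obtain ⟨δ, hδ, h⟩ := hnear t
    obtain ⟨δ', hδ', h'⟩ := hnear (t + L)
    have hr : 0 < min δ δ' / 2 := by positivity
    have hr1 := min_le_left δ δ'
    have hr2 := min_le_right δ δ'
    obtain ⟨-, h1, h2⟩ := h (min δ δ' / 2) ⟨hr, by linarith⟩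
    obtain ⟨-, h3, h4⟩ := h' (min δ δ' / 2) ⟨hr, by linarith⟩
    rw [← h2, ← h4]
    rw [add_sub_right_comm] at h3 ⊢
    exact hsh _ h1 h3 k
  · have h1 : ∑ k, u (t + L) k - M * (ℓ / L) * (t + L) = ∑ k, u t k - M * (ℓ / L) * t := hper t
    linarith

/-- Since `n ≡ q` modulo `M`, a translation by `n` acts on patterns as the rotation by `q`. -/
theorem per_add_of_shift {M n : ℕ} [NeZero M] {q : Fin M} (hn : n % M = q) {z z' : Fin M → ℝ}
    (h : ∀ k, z' (k + q) = z k) (i : ℤ) : per z' (i + n) = per z i := by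
  have hM := natCast_pos_of_neZero (M := M)
  have h0 := Int.emod_nonneg i hM.ne'
  have h1 := Int.emod_lt_of_pos i hM
  obtain ⟨k, hk⟩ : ∃ k : Fin M, i % (M : ℤ) = ((k : ℕ) : ℤ) :=
    ⟨⟨(i % (M : ℤ)).toNat, by omega⟩, by simp [h0]⟩
  rw [per_of_emod hk, ← h k]
  refine per_of_emod ?_
  rw [Int.add_emod, hk, Fin.val_add, ← hn]
  push_cast
  simp

/-! ### Consequences of twisted periodicity -/

namespace IsTwisted

section Basic
variable {M : ℕ} {G : (Fin M → ℝ) → ℝ} {L α : ℝ} {q : Fin M} {u : ℝ → Fin M → ℝ}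

theorem eq_of_add [NeZero M] {z z' y y' : Fin M → ℝ} (h : ∀ k, z' (k + q) = z k)
    (h' : ∀ k, y' (k + q) = y k) : z' = y' ↔ z = y := by
  constructor
  · intro e; funext k; rw [← h, ← h', e]
  · intro e; funext k
    have h1 := h (k - q)
    have h2 := h' (k - q)
    rw [sub_add_cancel] at h1 h2
    rw [h1, h2, e]

theorem add_mem_jumpSet [NeZero M] (hu : IsTwisted G L α q u) (t : ℝ) :
    t + L ∈ jumpSet u ↔ t ∈ jumpSet u :=
  not_congr (eq_of_add (hu.shift_left t) (hu.shift_right t))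

theorem add_zsmul_mem_jumpSet [NeZero M] (hu : IsTwisted G L α q u) (t : ℝ) (p : ℤ) :
    t + p * L ∈ jumpSet u ↔ t ∈ jumpSet u := by
  induction p using Int.induction_on with
  | zero => simp
  | succ p ih => rw [← ih, ← hu.add_mem_jumpSet (t + ((p : ℤ) : ℝ) * L)]; push_cast; ring_nf
  | pred p ih => rw [← ih, ← hu.add_mem_jumpSet]; push_cast; ring_nf

theorem per_right [NeZero M] (hu : IsTwisted G L α q u) {n : ℕ} (hn : n % M = q) (t : ℝ) (p i : ℤ) :
    per (rightSlope u (t + p * L)) (i + p * n) = per (rightSlope u t) i := by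
  have step : ∀ (p : ℤ), per (rightSlope u (t + (p + 1 : ℤ) * L)) (i + (p + 1) * n) =
      per (rightSlope u (t + p * L)) (i + p * n) := by
    intro p
    rw [← per_add_of_shift hn (hu.shift_right (t + p * L))]
    push_cast; ring_nf
  induction p using Int.induction_on with
  | zero => simp
  | succ p ih => rw [step, ih]
  | pred p ih => rw [← ih, ← step, sub_add_cancel]

theorem per_left [NeZero M] (hu : IsTwisted G L α q u) {n : ℕ} (hn : n % M = q) (t : ℝ) (p i : ℤ) :
    per (leftSlope u (t + p * L)) (i + p * n) = per (leftSlope u t) i := by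
  have step : ∀ (p : ℤ), per (leftSlope u (t + (p + 1 : ℤ) * L)) (i + (p + 1) * n) =
      per (leftSlope u (t + p * L)) (i + p * n) := by
    intro p
    rw [← per_add_of_shift hn (hu.shift_left (t + p * L))]
    push_cast; ring_nf
  induction p using Int.induction_on with
  | zero => simp
  | succ p ih => rw [step, ih]
  | pred p ih => rw [← ih, ← step, sub_add_cancel]

/-- The jump set is invariant under translation by `L`. Moving `s` into `(0, L]` brings a close pair
into `[-L, 2L]`, where there are finitely many jumps. -/
theorem exists_separation [NeZero M] (hu : IsTwisted G L α q u) :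
    ∃ σ > 0, ∀ s ∈ jumpSet u, ∀ t ∈ jumpSet u, s ≠ t → σ ≤ |s - t| := by
  have hL := hu.L_pos
  have hfin := hu.pa.finite_jumpSet (-L) (2 * L)
  obtain ⟨r, hr, hrL, h⟩ := exists_separation_finset hfin.toFinset (half_pos hL)
  refine ⟨2 * r, by positivity, fun s hs t ht hst => ?_⟩
  by_contra! hlt
  set p := toIocDiv hL 0 s with hp
  have h1 := toIocMod_mem_Ioc hL 0 s
  have e1 : toIocMod hL 0 s = s + (-p : ℤ) * L := by
    rw [toIocMod, ← hp]; simp [sub_eq_add_neg]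
  rw [e1] at h1
  have h2 : s + (-p : ℤ) * L ∈ jumpSet u := (hu.add_zsmul_mem_jumpSet s _).2 hs
  have h3 : t + (-p : ℤ) * L ∈ jumpSet u := (hu.add_zsmul_mem_jumpSet t _).2 ht
  rw [abs_lt] at hlt
  have h4 := h _ (hfin.mem_toFinset.2 ⟨h2, by linarith [h1.1], by linarith [h1.2]⟩) _
    (hfin.mem_toFinset.2 ⟨h3, by linarith [h1.1], by linarith [h1.2]⟩)
    (fun e => hst (add_right_cancel e))
  rw [add_sub_add_right_eq_sub] at h4
  have : |s - t| < 2 * r := abs_lt.2 hlt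
  linarith

theorem measurable_rightSlope : Measurable fun s => rightSlope u s := measurable_derivWithin_Ioi u

theorem exists_slope_bound (hu : IsTwisted G L α q u) (hG : IsWellCost G) :
    ∃ R : ℝ, 0 ≤ R ∧ (∀ z, G z = 0 → ∀ k, |z k| ≤ R) ∧
      (∀ a b k, IntervalIntegrable (fun s => rightSlope u s k) volume a b) ∧
      ∀ a b k, u b k - u a k = ∫ s in a..b, rightSlope u s k := by
  obtain ⟨A, hA, hco⟩ := hG.coercive
  have hz : ∀ z, G z = 0 → ∀ k, |z k| ≤ A := by
    intro z hz k
    have := (norm_le_pi_norm z k).trans (hco z)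
    rwa [hz, add_zero, mul_one, Real.norm_eq_abs] at this
  have hint : ∀ a b k, IntervalIntegrable (fun s => rightSlope u s k) volume a b := by
    intro a b k
    rw [intervalIntegrable_iff]
    refine Measure.integrableOn_of_bounded (M := A) (by simp [uIoc])
      ((measurable_pi_apply k).comp measurable_rightSlope).aestronglyMeasurable ?_
    exact Eventually.of_forall fun s => hz _ (hu.zero_right s) k
  refine ⟨A, hA.le, hz, hint, fun a b k => ?_⟩
  symm
  refine intervalIntegral.integral_eq_sub_of_hasDeriv_right
    (continuous_pi_iff.1 hu.pa.1 k).continuousOn (fun t _ => ?_) (hint a b k)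
  obtain ⟨δ, hδ, h1, -⟩ := hu.pa.exists_slopes t
  have h2 : HasDerivWithinAt u (rightSlope u t) (Ioi t) t := by
    refine (hasDerivAt_affine (u t) (rightSlope u t) t t).hasDerivWithinAt.congr_of_eventuallyEq
      ?_ (by simp)
    filter_upwards [Ioo_mem_nhdsGT (by linarith : t < t + δ)] with s hs
    have := h1 t ⟨le_rfl, by linarith⟩ s ⟨hs.1.le, hs.2.le⟩
    rw [← this]; simp
  exact hasDerivWithinAt_pi.1 h2 k

end Basic
end IsTwisted

/-! ### Splicing transitions into the pattern of a limit function -/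

/-- The first lattice site of the block of the jump at `T`, computed modulo the period. -/
noncomputable def center {L : ℝ} (hL : 0 < L) (M n : ℕ) (T : ℝ) : ℤ :=
  toIocDiv hL 0 T * n + M * ⌊toIocMod hL 0 T / (M * eps L n)⌋

/-- This is the reason for reducing modulo the period first: `n` need not be a multiple of `M`, so
rounding the jump itself to a block would not commute with the translation by `n`. -/
theorem center_add {L : ℝ} (hL : 0 < L) (M n : ℕ) (T : ℝ) :
    center hL M n (T + L) = center hL M n T + n := by
  unfold center
  rw [toIocDiv_add_right, toIocMod_add_right]; ring

theorem toIocMod_eq {L : ℝ} (hL : 0 < L) (T : ℝ) :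
    T = toIocMod hL 0 T + toIocDiv hL 0 T * L := by
  have := toIocMod_add_toIocDiv_zsmul hL 0 T
  rw [zsmul_eq_mul] at this
  exact this.symm

theorem center_le {L : ℝ} (hL : 0 < L) {M n : ℕ} (hM : M ≠ 0) (hn : n ≠ 0) (T : ℝ) :
    eps L n * center hL M n T ≤ T ∧ T < eps L n * center hL M n T + M * eps L n := by
  have hε := eps_pos hL hn
  have hMε : 0 < M * eps L n := by positivity
  have h1 := floor_mul_le hMε (toIocMod hL 0 T)
  have h2 := lt_floor_mul hMε (toIocMod hL 0 T)
  have h3 := toIocMod_eq hL T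
  have e : eps L n * center hL M n T =
      toIocDiv hL 0 T * L + ⌊toIocMod hL 0 T / (M * eps L n)⌋ * (M * eps L n) := by
    unfold center
    push_cast
    have : (toIocDiv hL 0 T : ℝ) * L = toIocDiv hL 0 T * (eps L n * n) := by rw [eps_mul hn]
    rw [this]; ring
  rw [e]
  constructor <;> linarith

open Classical in
/-- The pattern of `u` sampled at the lattice sites, with the sequences `e` in place of it near the
jumps. -/
noncomputable def splice {M : ℕ} [NeZero M] {L : ℝ} (hL : 0 < L) (n : ℕ) (u : ℝ → Fin M → ℝ)
    (e : ℝ → ℤ → ℝ) (A : ℤ) (i : ℤ) : ℝ :=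
  if h : ∃ T ∈ jumpSet u, |i - center hL M n T| < A then
    e (toIocMod hL 0 h.choose) (i - center hL M n h.choose)
  else per (rightSlope u (eps L n * i)) i

/-- A bound for sums over a period of a function supported near the jumps. -/
theorem sum_range_le_of_support {L : ℝ} (hL : 0 < L) {M n : ℕ} {S : Set ℝ} {J : Finset ℝ}
    (hJ : ∀ T ∈ S, toIocMod hL 0 T ∈ J) {A : ℤ} {f : ℤ → ℝ} {g : ℝ → ℤ → ℝ}
    (hg : ∀ t x, 0 ≤ g t x)
    (hf : ∀ i, f i ≤ 0 ∨ ∃ T ∈ S, |i - center hL M n T| < A ∧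
      f i ≤ g (toIocMod hL 0 T) (i - center hL M n T)) :
    ∑ i ∈ Finset.range n, f i ≤ ∑ t ∈ J, ∑ x ∈ Finset.Ioo (-A) A, g t x := by
  classical
  let c : ℝ → ℤ := fun t => M * ⌊t / (M * eps L n)⌋
  -- Near a jump, `i` is determined modulo `n` by the representative `t` of the jump in `(0, L]` and
  -- the offset `x`. Each pair `(t, x)` is thus met at most once in a period.
  have h1 : ∀ i ∈ Finset.range n, f i ≤ ∑ t ∈ J, ∑ x ∈ Finset.Ioo (-A) A,
      if (n : ℤ) ∣ i - (c t + x) then g t x else 0 := by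
    intro i _
    have hnn : ∀ t ∈ J, 0 ≤ ∑ x ∈ Finset.Ioo (-A) A,
        if (n : ℤ) ∣ i - (c t + x) then g t x else 0 := fun t _ =>
      Finset.sum_nonneg fun x _ => by split_ifs; exacts [hg _ _, le_rfl]
    rcases hf i with h | ⟨T, hT, hiT, h⟩
    · exact h.trans (Finset.sum_nonneg hnn)
    · rw [abs_lt] at hiT
      refine h.trans (le_trans ?_ (Finset.single_le_sum hnn (hJ T hT)))
      refine le_trans ?_ (Finset.single_le_sum (f := fun x =>
        if (n : ℤ) ∣ i - (c (toIocMod hL 0 T) + x) then g (toIocMod hL 0 T) x else 0)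
        (fun x _ => by split_ifs; exacts [hg _ _, le_rfl]) (Finset.mem_Ioo.2 hiT))
      rw [if_pos]
      refine ⟨toIocDiv hL 0 T, ?_⟩
      simp only [c, center]; ring
  refine (Finset.sum_le_sum h1).trans ?_
  rw [Finset.sum_comm]
  refine Finset.sum_le_sum fun t _ => ?_
  rw [Finset.sum_comm]
  refine Finset.sum_le_sum fun x _ => ?_
  rw [← Finset.sum_filter, Finset.sum_const, nsmul_eq_mul]
  have hcard : (Finset.filter (fun i : ℕ => (n : ℤ) ∣ i - (c t + x)) (Finset.range n)).card ≤ 1 := by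
    rw [Finset.card_le_one]
    intro a ha b hb
    simp only [Finset.mem_filter, Finset.mem_range] at ha hb
    have h2 : (n : ℤ) ∣ (a : ℤ) - b := by
      have := dvd_sub ha.2 hb.2
      rwa [sub_sub_sub_cancel_right] at this
    have h3 := Int.eq_zero_of_abs_lt_dvd h2 (by rw [abs_lt]; omega)
    omega
  have : ((Finset.filter (fun i : ℕ => (n : ℤ) ∣ i - (c t + x)) (Finset.range n)).card : ℝ) ≤ 1 := by
    exact_mod_cast hcard
  have := mul_le_mul_of_nonneg_right this (hg t x)
  linarith

/-! ### Windows of the spliced sequence -/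

namespace IsTwisted

section Splice
variable {M : ℕ} [NeZero M] {G : (Fin M → ℝ) → ℝ} {L α σ : ℝ} {q : Fin M} {u : ℝ → Fin M → ℝ}
  {n N : ℕ} {e : ℝ → ℤ → ℝ}

/-- A center is less than `M ε_n` to the left of its jump and two centers near `i` differ by at most
`2(N + 3M)` sites, so the jumps are closer than `(2N + 7M) ε_n ≤ σ`. -/
theorem eq_of_center_near (hu : IsTwisted G L α q u) (hn : n ≠ 0)
    (hσ : ∀ s ∈ jumpSet u, ∀ t ∈ jumpSet u, s ≠ t → σ ≤ |s - t|)
    (hfine : (2 * N + 7 * M) * eps L n ≤ σ) {T T' : ℝ} (hT : T ∈ jumpSet u) (hT' : T' ∈ jumpSet u)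
    {i : ℤ} (h : |i - center hu.L_pos M n T| < N + 3 * M)
    (h' : |i - center hu.L_pos M n T'| < N + 3 * M) : T = T' := by
  by_contra hne
  have h1 := hσ T hT T' hT' hne
  obtain ⟨h2, h3⟩ := center_le hu.L_pos (NeZero.ne M) hn T
  obtain ⟨h4, h5⟩ := center_le hu.L_pos (NeZero.ne M) hn T'
  have hε := eps_pos hu.L_pos hn
  have h6 : |(center hu.L_pos M n T : ℝ) - center hu.L_pos M n T'| ≤ 2 * (N + 3 * M) := by
    rw [abs_lt] at h h'
    have : |center hu.L_pos M n T - center hu.L_pos M n T'| ≤ 2 * (N + 3 * M) := by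
      rw [abs_le]; constructor <;> linarith [h.1, h.2, h'.1, h'.2]
    exact_mod_cast this
  rw [abs_le] at h6
  have h7 := mul_le_mul_of_nonneg_left h6.1 hε.le
  have h8 := mul_le_mul_of_nonneg_left h6.2 hε.le
  have : |T - T'| < σ := by rw [abs_lt]; constructor <;> nlinarith
  linarith

theorem splice_of_near (hu : IsTwisted G L α q u) (hn : n ≠ 0)
    (hσ : ∀ s ∈ jumpSet u, ∀ t ∈ jumpSet u, s ≠ t → σ ≤ |s - t|)
    (hfine : (2 * N + 7 * M) * eps L n ≤ σ) {T : ℝ} (hT : T ∈ jumpSet u)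
    {i : ℤ} (h : |i - center hu.L_pos M n T| < N + 2 * M) :
    splice hu.L_pos n u e (N + 2 * M) i =
      e (toIocMod hu.L_pos 0 T) (i - center hu.L_pos M n T) := by
  have hex : ∃ T ∈ jumpSet u, |i - center hu.L_pos M n T| < N + 2 * M := ⟨T, hT, h⟩
  unfold splice
  rw [dif_pos hex]
  obtain ⟨h1, h2⟩ := hex.choose_spec
  rw [hu.eq_of_center_near hn hσ hfine h1 hT (by omega) (by omega : |i - _| < _)]

theorem splice_of_not_near (hL : 0 < L) {i : ℤ}
    (h : ∀ T ∈ jumpSet u, ¬ |i - center hL M n T| < N + 2 * M) :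
    splice hL n u e (N + 2 * M) i = per (rightSlope u (eps L n * i)) i := by
  unfold splice
  rw [dif_neg]
  push Not at h ⊢
  exact h

theorem splice_add (hu : IsTwisted G L α q u) (hn : n ≠ 0) (hq : n % M = q)
    (hσ : ∀ s ∈ jumpSet u, ∀ t ∈ jumpSet u, s ≠ t → σ ≤ |s - t|)
    (hfine : (2 * N + 7 * M) * eps L n ≤ σ) (i : ℤ) :
    splice hu.L_pos n u e (N + 2 * M) (i + n) = splice hu.L_pos n u e (N + 2 * M) i := by
  by_cases h : ∃ T ∈ jumpSet u, |i - center hu.L_pos M n T| < N + 2 * M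
  · obtain ⟨T, hT, hi⟩ := h
    have e1 : i + n - center hu.L_pos M n (T + L) = i - center hu.L_pos M n T := by
      rw [center_add]; ring
    rw [hu.splice_of_near hn hσ hfine hT hi, hu.splice_of_near hn hσ hfine
      ((hu.add_mem_jumpSet T).2 hT) (by rwa [e1]), e1, toIocMod_add_right]
  · have h2 : ¬ ∃ T ∈ jumpSet u, |i + n - center hu.L_pos M n T| < N + 2 * M := by
      rintro ⟨T, hT, hi⟩
      refine h ⟨T - L, (hu.add_mem_jumpSet _).1 (by rwa [sub_add_cancel]), ?_⟩
      have e1 := center_add hu.L_pos M n (T - L)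
      rw [sub_add_cancel] at e1
      rw [e1] at hi
      rwa [add_sub_add_right_eq_sub] at hi
    push Not at h h2
    rw [splice_of_not_near _ (fun T hT => not_lt.2 (h T hT)),
      splice_of_not_near _ (fun T hT => not_lt.2 (h2 T hT))]
    have := hu.per_right hq (eps L n * i) 1 i
    rw [← this]
    push_cast
    rw [mul_add, eps_mul hn, one_mul, one_mul]

/-- Around a jump the spliced sequence is the inserted one. -/
theorem splice_eq (hu : IsTwisted G L α q u) (hn : n ≠ 0) (hq : n % M = q)
    (hσ : ∀ s ∈ jumpSet u, ∀ t ∈ jumpSet u, s ≠ t → σ ≤ |s - t|)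
    (hfine : (2 * N + 7 * M) * eps L n ≤ σ)
    (he : ∀ t ∈ jumpSet u ∩ Ioc 0 L, Connects N (leftSlope u t) (rightSlope u t) (e t))
    {T : ℝ} (hT : T ∈ jumpSet u) {i : ℤ} (h : |i - center hu.L_pos M n T| < N + 3 * M) :
    splice hu.L_pos n u e (N + 2 * M) i =
      e (toIocMod hu.L_pos 0 T) (i - center hu.L_pos M n T) := by
  have hMpos := natCast_pos_of_neZero (M := M)
  have hMR : (0 : ℝ) < M := by exact_mod_cast hMpos
  -- Up to distance `N + 2M` this is the definition. Between `N + 2M` and `N + 3M` the inserted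
  -- sequence already follows its pattern, and the sampled slopes of `u` must be shown to be the
  -- same. This margin lets whole windows be read from the inserted sequence.
  by_cases h1 : |i - center hu.L_pos M n T| < N + 2 * M
  · exact hu.splice_of_near hn hσ hfine hT h1
  have hnot : ∀ T' ∈ jumpSet u, ¬ |i - center hu.L_pos M n T'| < N + 2 * M := by
    intro T' hT' h2
    have := hu.eq_of_center_near hn hσ hfine hT hT' h (by omega)
    subst this
    exact h1 h2
  rw [splice_of_not_near _ hnot]
  have hε := eps_pos hu.L_pos hn
  obtain ⟨hc1, hc2⟩ := center_le hu.L_pos (NeZero.ne M) hn T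
  set c := center hu.L_pos M n T with hc
  set τ := toIocMod hu.L_pos 0 T with hτ
  have hTτ := toIocMod_eq hu.L_pos T
  rw [← hτ] at hTτ
  have hτJ : τ ∈ jumpSet u ∩ Ioc 0 L := by
    refine ⟨(hu.add_zsmul_mem_jumpSet τ (toIocDiv hu.L_pos 0 T)).1 (by rwa [← hTτ]), ?_⟩
    simpa using toIocMod_mem_Ioc hu.L_pos 0 T
  have hci : i = (M * ⌊τ / (M * eps L n)⌋ + (i - c)) + toIocDiv hu.L_pos 0 T * n := by
    rw [hc]; unfold center; ring
  rw [abs_lt] at h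
  have hi : eps L n * (i : ℝ) = eps L n * c + eps L n * ((i - c : ℤ) : ℝ) := by push_cast; ring
  have hfree : ∀ s, s ≠ T → |s - T| < σ → s ∉ jumpSet u := fun s hs hlt hmem =>
    absurd (hσ s hmem T hT hs) (not_le.2 hlt)
  have hσ0 : 0 < σ := lt_of_lt_of_le (by positivity) hfine
  rw [not_lt, le_abs] at h1
  -- On either side the site lies strictly beyond the jump and within `σ` of it, so the sampled
  -- slope is the one-sided slope at `T`. The phases agree because in `(0, L]` the center is a
  -- multiple of `M`, and translating by periods rotates the slopes accordingly.
  rcases h1 with h1 | h1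
  · have h2 : ((N : ℝ) + 2 * M) ≤ ((i - c : ℤ) : ℝ) := by exact_mod_cast h1
    have h3 : ((i - c : ℤ) : ℝ) ≤ (N : ℝ) + 3 * M := by exact_mod_cast h.2.le
    have h4 := mul_le_mul_of_nonneg_left h2 hε.le
    have h5 := mul_le_mul_of_nonneg_left h3 hε.le
    have haff := hu.pa.affineOn (a := T) (b := T + σ) (by linarith) fun s hs =>
      hfree s hs.1.ne' (by rw [abs_lt]; constructor <;> linarith [hs.1, hs.2])
    have hN0 : 0 ≤ eps L n * N := by positivity
    have hM0 : 0 < eps L n * M := by positivity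
    rw [haff.rightSlope_eq (by rw [hi]; nlinarith) (by rw [hi]; nlinarith),
      (he τ hτJ).2 _ (by omega)]
    nth_rewrite 1 [hTτ]
    nth_rewrite 1 [hci]
    rw [hu.per_right hq, per_mul_add]
  · have h1' : i - c ≤ -(N + 2 * M) := by linarith
    have h2 : ((i - c : ℤ) : ℝ) ≤ -((N : ℝ) + 2 * M) := by exact_mod_cast h1'
    have h3 : -((N : ℝ) + 3 * M) ≤ ((i - c : ℤ) : ℝ) := by exact_mod_cast h.1.le
    have h4 := mul_le_mul_of_nonneg_left h2 hε.le
    have h5 := mul_le_mul_of_nonneg_left h3 hε.le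
    have haff := hu.pa.affineOn (a := T - σ) (b := T) (by linarith) fun s hs =>
      hfree s hs.2.ne (by rw [abs_lt]; constructor <;> linarith [hs.1, hs.2])
    have hN0 : 0 ≤ eps L n * N := by positivity
    have hM0 : 0 < eps L n * M := by positivity
    rw [← haff.leftSlope_eq (by linarith) le_rfl] at haff
    rw [haff.rightSlope_eq (by rw [hi]; nlinarith) (by rw [hi]; nlinarith),
      (he τ hτJ).1 _ (by omega)]
    nth_rewrite 1 [hTτ]
    nth_rewrite 1 [hci]
    rw [hu.per_left hq, per_mul_add]

/-- Every window of the spliced sequence is either a window of an inserted sequence or an exact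
pattern. -/
theorem window_splice (hu : IsTwisted G L α q u) (hn : n ≠ 0) (hq : n % M = q)
    (hσ : ∀ s ∈ jumpSet u, ∀ t ∈ jumpSet u, s ≠ t → σ ≤ |s - t|)
    (hfine : (2 * N + 7 * M) * eps L n ≤ σ) (hM : 2 ≤ M)
    (he : ∀ t ∈ jumpSet u ∩ Ioc 0 L, Connects N (leftSlope u t) (rightSlope u t) (e t)) (i : ℤ) :
    (∃ z, G z = 0 ∧ window M (splice hu.L_pos n u e (N + 2 * M)) i = window M (per z) i ∧
      AffineOn u (eps L n * i) (eps L n * (i + 1 : ℤ)) z) ∨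
    ∃ T ∈ jumpSet u, |i - center hu.L_pos M n T| < N + 3 * M ∧
      window M (splice hu.L_pos n u e (N + 2 * M)) i =
        window M (e (toIocMod hu.L_pos 0 T)) (i - center hu.L_pos M n T) := by
  have hMpos := natCast_pos_of_neZero (M := M)
  have hε := eps_pos hu.L_pos hn
  -- If one site of the window is within `N + 2M` of a center, all its sites are within `N + 3M`.
  by_cases h : ∃ k : Fin M, ∃ T ∈ jumpSet u,
      |i + ((k : ℕ) : ℤ) - center hu.L_pos M n T| < N + 2 * M
  · obtain ⟨k, T, hT, hk⟩ := h
    have hkM := k.2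
    rw [abs_lt] at hk
    refine Or.inr ⟨T, hT, by rw [abs_lt]; omega, ?_⟩
    funext j
    have hjM := j.2
    simp only [window]
    rw [hu.splice_eq hn hq hσ hfine he hT (by rw [abs_lt]; omega)]
    congr 1; ring
  · push Not at h
    -- A jump in the stretch covered by the window would have its center fewer than `M` sites from
    -- `i`.
    have hfree : ∀ T ∈ Ioo (eps L n * i) (eps L n * (i + M : ℤ)), T ∉ jumpSet u := by
      intro T hTI hT
      have h1 := h 0 T hT
      obtain ⟨hc1, hc2⟩ := center_le hu.L_pos (NeZero.ne M) hn T
      have h2 : (i : ℝ) < center hu.L_pos M n T + M := by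
        refine lt_of_mul_lt_mul_left (a := eps L n) ?_ hε.le
        linarith [hTI.1]
      have h3 : (center hu.L_pos M n T : ℝ) < (i + M : ℤ) :=
        lt_of_mul_lt_mul_left (hc1.trans_lt hTI.2) hε.le
      have h2' : i < center hu.L_pos M n T + M := by exact_mod_cast h2
      have h3' : center hu.L_pos M n T < i + M := by exact_mod_cast h3
      refine absurd h1 (not_le.2 ?_)
      rw [abs_lt]
      simp only [Fin.val_zero, Nat.cast_zero]
      omega
    have haff := hu.pa.affineOn (mul_lt_mul_of_pos_left
      (by push_cast; linarith [(Int.cast_pos (R := ℝ)).2 hMpos, Int.cast_natCast (R := ℝ) M]) hε)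
      hfree
    refine Or.inl ⟨_, hu.zero_right (eps L n * i), ?_, haff.mono le_rfl ?_⟩
    · funext k
      have hk : ((k : ℕ) : ℝ) < M := by exact_mod_cast k.2
      simp only [window]
      rw [splice_of_not_near _ fun T hT => not_lt.2 (h k T hT), haff.rightSlope_eq]
      · exact mul_le_mul_of_nonneg_left (by push_cast; linarith [(k : ℕ).cast_nonneg (α := ℝ)])
          hε.le
      · exact mul_lt_mul_of_pos_left (by push_cast; linarith) hε
    · refine mul_le_mul_of_nonneg_left ?_ hε.le
      have : i + 1 ≤ i + (M : ℤ) := by omega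
      exact_mod_cast this

/-- Away from the jumps the spliced sequence is eventually the pattern of `u`. -/
theorem splice_block_eq (hu : IsTwisted G L α q u) (hn : n ≠ 0) {s ρ : ℝ}
    (hρ : ∀ T ∈ jumpSet u, ρ ≤ |s - T|) (hfine : (N + 4 * M) * eps L n < ρ) (k : Fin M) :
    splice hu.L_pos n u e (N + 2 * M) (M * ⌊s / (M * eps L n)⌋ + ((k : ℕ) : ℤ)) =
      rightSlope u s k := by
  have hMR : (0 : ℝ) < M := by exact_mod_cast natCast_pos_of_neZero (M := M)
  have hε := eps_pos hu.L_pos hn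
  have hMε : 0 < M * eps L n := by positivity
  have h1 := floor_mul_le hMε s
  have h2 := lt_floor_mul hMε s
  have hk : ((k : ℕ) : ℝ) < M := by exact_mod_cast k.2
  have hk0 : (0 : ℝ) ≤ ((k : ℕ) : ℝ) := by positivity
  set i : ℤ := M * ⌊s / (M * eps L n)⌋ + ((k : ℕ) : ℤ) with hi
  have hεi : eps L n * i = ⌊s / (M * eps L n)⌋ * (M * eps L n) + eps L n * ((k : ℕ) : ℝ) := by
    rw [hi]; push_cast; ring
  have h3 := mul_lt_mul_of_pos_left hk hε
  have h4 := mul_nonneg hε.le hk0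
  have hs1 : s - M * eps L n < eps L n * i := by rw [hεi]; linarith
  have hs2 : eps L n * i < s + M * eps L n := by rw [hεi]; linarith
  have hN0 : 0 ≤ N * eps L n := by positivity
  rw [splice_of_not_near]
  · have haff := hu.pa.affineOn (a := s - ρ) (b := s + ρ) (by nlinarith) fun T hT hTJ => by
      have := hρ T hTJ
      have h5 : |s - T| < ρ := by rw [abs_lt]; constructor <;> linarith [hT.1, hT.2]
      linarith
    have hs : rightSlope u s = rightSlope u (s - ρ) :=
      haff.rightSlope_eq (t := s) (by nlinarith) (by nlinarith)
    rw [haff.rightSlope_eq (t := eps L n * i) (by nlinarith) (by nlinarith), hs, hi, per_mul_add,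
      per_coe]
  · intro T hT hnear
    obtain ⟨hc1, hc2⟩ := center_le hu.L_pos (NeZero.ne M) hn T
    have h5 : |(i : ℝ) - center hu.L_pos M n T| ≤ N + 2 * M := by exact_mod_cast hnear.le
    rw [abs_le] at h5
    have h6 := mul_le_mul_of_nonneg_left h5.1 hε.le
    have h7 := mul_le_mul_of_nonneg_left h5.2 hε.le
    have h8 := hρ T hT
    have h9 : |s - T| < ρ := by
      rw [abs_lt]
      constructor <;> nlinarith
    linarith

end Splice
end IsTwisted

/-! ### Discrete functions with given slopes -/

/-- The continuous function with the value `x` at `0` and the slope `d i` on `[i h, (i + 1) h)`. -/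
noncomputable def latticePrimitive (h : ℝ) (d : ℤ → ℝ) (x t : ℝ) : ℝ :=
  x + ∫ s in (0 : ℝ)..t, d ⌊s / h⌋

section LatticePrimitive
variable {h : ℝ} {d : ℤ → ℝ} {x : ℝ}

theorem latticePrimitive_sub (hh : 0 < h) (a b : ℝ) :
    latticePrimitive h d x b - latticePrimitive h d x a = ∫ s in a..b, d ⌊s / h⌋ := by
  unfold latticePrimitive
  rw [add_sub_add_left_eq_sub, intervalIntegral.integral_interval_sub_left
    (intervalIntegrable_step d hh _ _) (intervalIntegrable_step d hh _ _)]

theorem latticePrimitive_zero : latticePrimitive h d x 0 = x := by simp [latticePrimitive]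

theorem latticeSlope_latticePrimitive {L : ℝ} (hL : 0 < L) {n : ℕ} (hn : n ≠ 0) :
    latticeSlope L n (latticePrimitive (eps L n) d x) = d := by
  have hε := eps_pos hL hn
  funext i
  unfold latticeSlope node
  rw [latticePrimitive_sub hε, integral_step_cell d hε (m := i)]
  · rw [div_eq_iff hε.ne']; push_cast; ring
  · constructor <;> nlinarith
  · constructor <;> push_cast <;> nlinarith

theorem latticePrimitive_mem_discreteSpace {L ℓ : ℝ} (hL : 0 < L) {n : ℕ} (hn : n ≠ 0) {R : ℝ}
    (hR : ∀ i, |d i| ≤ R) (hper : ∀ i, d (i + n) = d i)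
    (hsum : ∑ i ∈ Finset.range n, d i = n * (ℓ / L)) :
    latticePrimitive (eps L n) d x ∈ discreteSpace L ℓ n := by
  have hε := eps_pos hL hn
  have hR0 : 0 ≤ R := (abs_nonneg _).trans (hR 0)
  have hlip : LipschitzWith R.toNNReal (latticePrimitive (eps L n) d x) := by
    refine LipschitzWith.of_dist_le_mul fun a b => ?_
    rw [Real.coe_toNNReal _ hR0, Real.dist_eq, Real.dist_eq, latticePrimitive_sub hε]
    exact norm_integral_step_le hR _ _ _
  refine ⟨⟨fun a b => hlip.lipschitzOnWith.absolutelyContinuousOnInterval, fun t => ?_⟩,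
    hlip.continuous.continuousOn, fun i hi => ?_⟩
  · have h1 : latticePrimitive (eps L n) d x (t + L) - latticePrimitive (eps L n) d x L =
        latticePrimitive (eps L n) d x t - latticePrimitive (eps L n) d x 0 := by
      have h2 := integral_step_shift d hε n 0 t
      rw [Int.cast_natCast, mul_comm, eps_mul hn, zero_add] at h2
      simp_rw [hper] at h2
      rw [latticePrimitive_sub hε, latticePrimitive_sub hε, h2]
    have h3 : latticePrimitive (eps L n) d x L - latticePrimitive (eps L n) d x 0 = ℓ := by
      have h4 := integral_step_Ico d hε (m := 0) (n := n) (by positivity)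
      rw [Int.cast_zero, zero_mul, Int.cast_natCast, mul_comm, eps_mul hn] at h4
      have h5 := sum_Ico_of_periodic hper 0
      rw [zero_add] at h5
      rw [latticePrimitive_sub hε, h4, h5, hsum, ← mul_assoc, eps_mul hn]
      field_simp
    have h6 : ℓ / L * (t + L) = ℓ / L * t + ℓ := by field_simp
    simp only
    linarith
  · refine ⟨latticePrimitive (eps L n) d x (i * eps L n) - i * eps L n * d i, d i, fun t ht => ?_⟩
    have h1 := integral_step_cell d hε (m := i) (a := i * eps L n) (b := t)
      ⟨by simp, by push_cast; nlinarith⟩ ⟨by simpa using ht.1.le, by simpa using ht.2.le⟩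
    rw [← latticePrimitive_sub hε (x := x)] at h1
    linarith

end LatticePrimitive

/-! ### The upper bound -/

namespace IsTwisted

section Estimates
variable {M : ℕ} [NeZero M] {G : (Fin M → ℝ) → ℝ} {L α σ R : ℝ} {q : Fin M} {u : ℝ → Fin M → ℝ}
  {n N : ℕ} {e : ℝ → ℤ → ℝ} {J : Finset ℝ}

theorem toIocMod_mem (hu : IsTwisted G L α q u) {T : ℝ} (hT : T ∈ jumpSet u) :
    toIocMod hu.L_pos 0 T ∈ jumpSet u ∩ Ioc 0 L := by
  have hTτ := toIocMod_eq hu.L_pos T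
  refine ⟨(hu.add_zsmul_mem_jumpSet _ (toIocDiv hu.L_pos 0 T)).1 (by rwa [← hTτ]), ?_⟩
  simpa using toIocMod_mem_Ioc hu.L_pos 0 T

theorem abs_splice_le (hu : IsTwisted G L α q u) (hR : ∀ z, G z = 0 → ∀ k, |z k| ≤ R)
    (heR : ∀ t ∈ jumpSet u ∩ Ioc 0 L, ∀ i, |e t i| ≤ R) (A i : ℤ) :
    |splice hu.L_pos n u e A i| ≤ R := by
  unfold splice
  split_ifs with h
  · exact heR _ (hu.toIocMod_mem h.choose_spec.1) _
  · exact hR _ (hu.zero_right _) _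

/-- Window averages of the spliced slopes are compared with the mean over `k` of the increments of
`u k` across one lattice interval. The latter telescope to exactly `n α`, and the two agree wherever
the window is an exact pattern of `u`. The remaining windows of a period are bounded in number
independently of `n`, each with error at most `2R`. -/
theorem abs_sum_splice_sub_le (hu : IsTwisted G L α q u) (hG : IsWellCost G) (hn : n ≠ 0)
    (hq : n % M = q) (hσ : ∀ s ∈ jumpSet u, ∀ t ∈ jumpSet u, s ≠ t → σ ≤ |s - t|)
    (hfine : (2 * N + 7 * M) * eps L n ≤ σ)
    (he : ∀ t ∈ jumpSet u ∩ Ioc 0 L, Connects N (leftSlope u t) (rightSlope u t) (e t))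
    (hJ : ∀ t ∈ jumpSet u ∩ Ioc 0 L, t ∈ J) (hR : ∀ z, G z = 0 → ∀ k, |z k| ≤ R)
    (heR : ∀ t ∈ jumpSet u ∩ Ioc 0 L, ∀ i, |e t i| ≤ R)
    (hLip : ∀ a b k, |u b k - u a k| ≤ R * |b - a|) :
    |∑ i ∈ Finset.range n, splice hu.L_pos n u e (N + 2 * M) i - n * α| ≤
      ∑ _t ∈ J, ∑ _x ∈ Finset.Ioo (-(N + 3 * M : ℤ)) (N + 3 * M), 2 * R := by
  have hMpos := natCast_pos_of_neZero (M := M)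
  have hMR : (0 : ℝ) < M := by exact_mod_cast hMpos
  have hε := eps_pos hu.L_pos hn
  set d := splice hu.L_pos n u e (N + 2 * M) with hd
  have hdR : ∀ i, |d i| ≤ R := hu.abs_splice_le hR heR _
  have hR0 : 0 ≤ R := (abs_nonneg _).trans (hdR 0)
  have hdper : ∀ i, d (i + n) = d i := hu.splice_add hn hq hσ hfine
  let m : ℤ → ℝ := fun i => (1 / (M : ℝ)) * ∑ k, window M d i k -
    (1 / (M : ℝ)) * ∑ k, (u (eps L n * (i + 1 : ℤ)) k - u (eps L n * i) k) / eps L n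
  have hsum : ∑ i ∈ Finset.range n, d i - n * α = ∑ i ∈ Finset.range n, m i := by
    have h1 := sum_window_of_periodic (NeZero.ne M) hdper
    have h2 : ∑ i ∈ Finset.range n, (1 / (M : ℝ)) *
        ∑ k, (u (eps L n * ((i : ℤ) + 1 : ℤ)) k - u (eps L n * (i : ℤ)) k) / eps L n = n * α := by
      have h3 : ∀ k, ∑ i ∈ Finset.range n,
          (u (eps L n * ((i : ℤ) + 1 : ℤ)) k - u (eps L n * (i : ℤ)) k) = u L k - u 0 k := by
        intro k
        have := Finset.sum_range_sub (fun i : ℕ => u (eps L n * i) k) n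
        rw [eps_mul hn, Nat.cast_zero, mul_zero] at this
        rw [← this]
        push_cast
        rfl
      rw [← Finset.mul_sum, Finset.sum_comm]
      simp_rw [← Finset.sum_div, h3]
      rw [Finset.sum_sub_distrib]
      have h4 := hu.sum_shift 0
      rw [zero_add] at h4
      rw [h4]
      rw [one_div_mul_eq_div, div_div, div_eq_iff (by positivity)]
      linear_combination (-(M * α)) * eps_mul (L := L) hn
    simp only [m]
    rw [Finset.sum_sub_distrib, h2]
    congr 1
    exact h1.symm
  rw [hsum]
  refine (Finset.abs_sum_le_sum_abs _ _).trans ?_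
  refine sum_range_le_of_support (M := M) (f := fun i => |m i|) (g := fun _ _ => 2 * R) hu.L_pos
    (fun T hT => hJ _ (hu.toIocMod_mem hT)) (fun _ _ => by positivity) fun i => ?_
  rcases hu.window_splice hn hq hσ hfine hG.two_le he i with ⟨z, hz, hw, haff⟩ | ⟨T, hT, hi, -⟩
  · left
    have hi1 : (i : ℝ) ≤ (i + 1 : ℤ) := by push_cast; linarith
    have h1 := haff _ ⟨le_rfl, mul_le_mul_of_nonneg_left hi1 hε.le⟩ _
      ⟨mul_le_mul_of_nonneg_left hi1 hε.le, le_rfl⟩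
    have h2 : ∀ k, (u (eps L n * (i + 1 : ℤ)) k - u (eps L n * i) k) / eps L n = z k := by
      intro k
      have := congrFun h1 k
      simp only [Pi.sub_apply, Pi.smul_apply, smul_eq_mul] at this
      rw [this]; push_cast; field_simp; ring
    have h3 : ∑ k, window M d i k = ∑ k, z k := by
      rw [hd, hw, window_per_eq]
      exact Equiv.sum_comp _ _
    simp only [m]
    simp_rw [h2, h3, sub_self, abs_zero, le_refl]
  · refine Or.inr ⟨T, hT, hi, ?_⟩
    have havg : ∀ w : Fin M → ℝ, (∀ k, |w k| ≤ R) → |(1 / (M : ℝ)) * ∑ k, w k| ≤ R := by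
      intro w hw
      rw [abs_mul, abs_of_pos (by positivity), one_div_mul_eq_div, div_le_iff₀ hMR]
      refine (Finset.abs_sum_le_sum_abs _ _).trans ((Finset.sum_le_sum fun k _ => hw k).trans ?_)
      simp [mul_comm]
    refine (abs_sub _ _).trans ?_
    rw [two_mul]
    refine add_le_add (havg _ fun k => hdR _) (havg _ fun k => ?_)
    rw [abs_div, abs_of_pos hε, div_le_iff₀ hε]
    refine (hLip _ _ _).trans (le_of_eq ?_)
    congr 1
    rw [← mul_sub]; push_cast
    rw [add_sub_cancel_left, mul_one, abs_of_pos hε]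

/-- Adding a constant `r` to all slopes costs at most `κ |r|` in each exact window. The inserted
windows are finitely many up to periodicity, so continuity bounds their total change by `κ`. For `r`
of order `1/n` both contributions are of order `κ`. -/
theorem exists_sum_cost_le (hu : IsTwisted G L α q u) (hG : IsWellCost G)
    (hσ : ∀ s ∈ jumpSet u, ∀ t ∈ jumpSet u, s ≠ t → σ ≤ |s - t|)
    (he : ∀ t ∈ jumpSet u ∩ Ioc 0 L, Connects N (leftSlope u t) (rightSlope u t) (e t))
    (hJ : ∀ t, t ∈ J ↔ t ∈ jumpSet u ∩ Ioc 0 L) {κ : ℝ} (hκ : 0 < κ) :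
    ∃ ρ > 0, ∀ n : ℕ, n ≠ 0 → n % M = q → (2 * N + 7 * M) * eps L n ≤ σ → ∀ r, |r| ≤ ρ →
      ∑ i ∈ Finset.range n, G (window M (fun j => splice hu.L_pos n u e (N + 2 * M) j + r) i) ≤
        n * (κ * |r|) +
        (∑ t ∈ J, ∑ x ∈ Finset.Ico (-(N : ℤ) - M) N, G (window M (e t) x) + κ) := by
  have hMpos := natCast_pos_of_neZero (M := M)
  obtain ⟨ρ₁, hρ₁, hadd⟩ := hG.add_le κ hκ
  set I := Finset.Ioo (-(N + 3 * M : ℤ)) (N + 3 * M) with hI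
  -- There are at most `J.card * I.card` inserted windows in a period, so an error `κ'` in each adds
  -- up to at most `κ`.
  set κ' := κ / (J.card * I.card + 1) with hκ'
  have hκ'0 : 0 < κ' := by positivity
  have hcont : ∀ᶠ r : ℝ in 𝓝 0, ∀ t ∈ J, ∀ x ∈ I,
      G (window M (e t) x + fun _ => r) < G (window M (e t) x) + κ' := by
    rw [J.eventually_all]
    intro t _
    rw [I.eventually_all]
    intro x _
    have hc : Continuous fun r : ℝ => G (window M (e t) x + fun _ => r) :=
      hG.continuous.comp (continuous_const.add (continuous_pi fun _ => continuous_id))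
    refine hc.continuousAt.eventually_lt continuousAt_const ?_
    have : (window M (e t) x + fun _ => (0 : ℝ)) = window M (e t) x := by funext; simp
    rw [this]; linarith
  obtain ⟨ρ₂, hρ₂, hcont⟩ := Metric.eventually_nhds_iff_ball.1 hcont
  refine ⟨min ρ₁ (ρ₂ / 2), by positivity, fun n hn hq hfine r hr => ?_⟩
  set d := splice hu.L_pos n u e (N + 2 * M) with hd
  have hw : ∀ i, window M (fun j => d j + r) i = window M d i + fun _ => r := fun i => rfl
  have h1 : ∑ i ∈ Finset.range n, (G (window M (fun j => d j + r) i) - κ * |r|) ≤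
      ∑ t ∈ J, ∑ x ∈ I, (G (window M (e t) x) + κ') := by
    refine sum_range_le_of_support (M := M) (f := fun i => G (window M (fun j => d j + r) i) - κ * |r|)
      (g := fun t x => G (window M (e t) x) + κ') hu.L_pos
      (fun T hT => (hJ _).2 (hu.toIocMod_mem hT)) (fun t x => add_nonneg (hG.nonneg _) hκ'0.le)
      fun i => ?_
    rcases hu.window_splice hn hq hσ hfine hG.two_le he i with ⟨z, hz, hwi, -⟩ | ⟨T, hT, hi, hwi⟩
    · left
      have hnorm : ‖(fun _ : Fin M => r)‖ = |r| := by
        rw [pi_norm_const, Real.norm_eq_abs]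
      have h2 := hadd (window M (per z) i) (by rw [hG.window_per, hz]) (fun _ => r)
        (by rw [hnorm]; exact hr.trans (min_le_left _ _))
      rw [hnorm] at h2
      rw [hw, hd, hwi]
      linarith
    · refine Or.inr ⟨T, hT, hi, ?_⟩
      have h2 := hcont r (by
        rw [Metric.mem_ball, dist_zero_right, Real.norm_eq_abs]
        linarith [min_le_right ρ₁ (ρ₂ / 2)]) _ ((hJ _).2 (hu.toIocMod_mem hT)) _
        (Finset.mem_Ioo.2 (abs_lt.1 hi))
      rw [hw, hd, hwi]
      have := mul_nonneg hκ.le (abs_nonneg r)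
      linarith
  rw [Finset.sum_sub_distrib, Finset.sum_const, Finset.card_range, nsmul_eq_mul] at h1
  have h2 : ∑ t ∈ J, ∑ x ∈ I, (G (window M (e t) x) + κ') ≤
      ∑ t ∈ J, ∑ x ∈ Finset.Ico (-(N : ℤ) - M) N, G (window M (e t) x) + κ := by
    simp_rw [Finset.sum_add_distrib, Finset.sum_const, nsmul_eq_mul]
    refine add_le_add (Finset.sum_le_sum fun t ht => le_of_eq ?_) ?_
    · symm
      -- The additional offsets in `I` see only exact patterns and contribute nothing.
      refine Finset.sum_subset (fun x hx => ?_) fun x _ hx => ?_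
      · rw [Finset.mem_Ico] at hx
        rw [hI, Finset.mem_Ioo]; omega
      · exact (he t ((hJ t).1 ht)).cost_eq_zero hG (hu.zero_left t) (hu.zero_right t) hx
    · rw [← mul_assoc, hκ', mul_div_assoc', div_le_iff₀ (by positivity)]
      nlinarith
  linarith

end Estimates
end IsTwisted

theorem tendsto_eps_atTop (L : ℝ) : Tendsto (eps L) atTop (𝓝 0) :=
  tendsto_const_nhds.div_atTop tendsto_natCast_atTop_atTop

/-! ### Convergence of the interpolations and construction of approximations -/

namespace IsTwisted

section Convergence
variable {M : ℕ} {G : (Fin M → ℝ) → ℝ} {L α R : ℝ} {q : Fin M} {u : ℝ → Fin M → ℝ}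
  {e : ℝ → ℤ → ℝ}

theorem exists_le_abs_sub (hu : IsTwisted G L α q u) {s : ℝ} (hs : s ∉ jumpSet u) :
    ∃ ρ > 0, ∀ T ∈ jumpSet u, ρ ≤ |s - T| := by
  obtain ⟨δ, hδ, h1, h2⟩ := hu.pa.exists_slopes s
  refine ⟨δ, hδ, fun T hT => ?_⟩
  by_contra! hlt
  rw [abs_lt] at hlt
  rcases lt_trichotomy T s with h | h | h
  · exact h2.notMem_jumpSet (by linarith) h hT
  · exact hs (h ▸ hT)
  · exact h1.notMem_jumpSet h (by linarith) hT

/-- Dominated convergence: at a point that is not a jump the integrand is eventually zero, and it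
never exceeds `2R`. -/
theorem tendsto_integral_splice [NeZero M] (hu : IsTwisted G L α q u) (hR : ∀ z, G z = 0 → ∀ k, |z k| ≤ R)
    (heR : ∀ t ∈ jumpSet u ∩ Ioc 0 L, ∀ i, |e t i| ≤ R) (N : ℕ) (k : Fin M) :
    Tendsto (fun n : ℕ => ∫ s in (0 : ℝ)..L,
      |splice hu.L_pos n u e (N + 2 * M) (M * ⌊s / (M * eps L n)⌋ + ((k : ℕ) : ℤ)) -
        rightSlope u s k|) atTop (𝓝 0) := by
  rw [show 𝓝 (0 : ℝ) = 𝓝 (∫ _s in (0 : ℝ)..L, (0 : ℝ)) by simp]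
  refine intervalIntegral.tendsto_integral_filter_of_dominated_convergence (fun _ => R + R)
    (Eventually.of_forall fun n => ?_) (Eventually.of_forall fun n => ?_) ?_ ?_
  · have h1 := measurable_step
      (fun I => splice hu.L_pos n u e (N + 2 * M) (M * I + ((k : ℕ) : ℤ))) (M * eps L n)
    exact ((h1.sub ((measurable_pi_apply k).comp
      (measurable_rightSlope (u := u)))).abs).aestronglyMeasurable
  · refine Eventually.of_forall fun s _ => ?_
    rw [Real.norm_eq_abs, abs_abs]
    exact (abs_sub _ _).trans (add_le_add (hu.abs_splice_le hR heR _ _) (hR _ (hu.zero_right s) k))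
  · exact intervalIntegrable_const
  · have hfin := (hu.pa.finite_jumpSet 0 L).measure_zero (volume : Measure ℝ)
    have hae : ∀ᵐ s : ℝ, s ∉ jumpSet u ∩ Icc 0 L := measure_eq_zero_iff_ae_notMem.1 hfin
    filter_upwards [hae] with s hs hsI
    rw [uIoc_of_le hu.L_pos.le] at hsI
    have hsJ : s ∉ jumpSet u := fun h => hs ⟨h, hsI.1.le, hsI.2⟩
    obtain ⟨ρ, hρ, hsρ⟩ := hu.exists_le_abs_sub hsJ
    have hfine : ∀ᶠ n : ℕ in atTop, (N + 4 * M) * eps L n < ρ := by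
      have := (tendsto_eps_atTop L).const_mul ((N : ℝ) + 4 * M)
      rw [mul_zero] at this
      exact this.eventually (gt_mem_nhds hρ)
    refine tendsto_const_nhds.congr' ?_
    filter_upwards [hfine, eventually_ne_atTop 0] with n h1 h2
    rw [hu.splice_block_eq h2 hsρ h1, sub_self, abs_zero]

end Convergence
end IsTwisted

theorem Connects.exists_bound {M : ℕ} [NeZero M] {N : ℕ} {z z' : Fin M → ℝ} {d : ℤ → ℝ}
    (h : Connects N z z' d) : ∃ R, ∀ i, |d i| ≤ R := by
  refine ⟨‖z‖ + ‖z'‖ + ∑ i ∈ Finset.Ico (-(N : ℤ)) N, |d i|, fun i => ?_⟩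
  have h0 : 0 ≤ ∑ i ∈ Finset.Ico (-(N : ℤ)) N, |d i| := Finset.sum_nonneg fun _ _ => abs_nonneg _
  have h1 := norm_nonneg z
  have h2 := norm_nonneg z'
  rcases lt_or_ge i (-(N : ℤ)) with hi | hi
  · rw [h.1 i hi]
    have : |per z i| ≤ ‖z‖ := norm_le_pi_norm z _
    linarith
  · rcases le_or_gt (N : ℤ) i with hi' | hi'
    · rw [h.2 i hi']
      have : |per z' i| ≤ ‖z'‖ := norm_le_pi_norm z' _
      linarith
    · have := Finset.single_le_sum (f := fun i => |d i|) (fun _ _ => abs_nonneg _)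
        (Finset.mem_Ico.2 ⟨hi, hi'⟩)
      linarith

/-- Sequences of optimal transitions between the slopes on the two sides of the jumps. -/
theorem exists_transitions {M : ℕ} [NeZero M] {ψ₁ ψM : ℝ → ℝ} {L α : ℝ} {q : Fin M}
    {u : ℝ → Fin M → ℝ} (hG : IsWellCost (cost M ψ₁ ψM α))
    (hu : IsTwisted (cost M ψ₁ ψM α) L α q u) (J : Finset ℝ) {η : ℝ} (hη : 0 < η) :
    ∃ (N : ℕ) (e : ℝ → ℤ → ℝ) (R : ℝ),
      (∀ t ∈ J, Connects N (leftSlope u t) (rightSlope u t) (e t)) ∧ (∀ t ∈ J, ∀ i, |e t i| ≤ R) ∧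
      ∀ t ∈ J, ∑ i ∈ Finset.Ico (-(N : ℤ) - M) N, cost M ψ₁ ψM α (window M (e t) i) ≤
        transitionEnergy M ψ₁ ψM α (leftSlope u t) (rightSlope u t) + η := by
  choose Nf e hconn hsum using fun t =>
    exists_connects_of_lt hG (hu.zero_left t) (hu.zero_right t) (lt_add_of_pos_right _ hη)
  choose Rf hRf using fun t => (hconn t).exists_bound
  -- As `J` is finite, one `N` serves all the jumps; enlarging it only adds windows of zero cost.
  refine ⟨J.sup Nf, e, ∑ t ∈ J, Rf t, fun t ht => (hconn t).mono (Finset.le_sup ht),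
    fun t ht i => (hRf t i).trans (Finset.single_le_sum
      (fun s _ => (abs_nonneg _).trans (hRf s 0)) ht), fun t ht => ?_⟩
  refine le_trans (le_of_eq ?_) (hsum t).le
  have hN : Nf t ≤ J.sup Nf := Finset.le_sup ht
  symm
  refine Finset.sum_subset (fun x hx => ?_) fun x _ hx =>
    (hconn t).cost_eq_zero hG (hu.zero_left t) (hu.zero_right t) hx
  rw [Finset.mem_Ico] at hx ⊢
  omega

/-- The approximation has the spliced slopes plus a constant. The constant is `O(1/n)` because the
length error of the splicing is bounded, so it alters neither the energy nor the interpolations in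
the limit. -/
theorem Admissible.eventually_exists_near {M : ℕ} {W₁ W₂ ψ₁ ψM : ℝ → ℝ} {c L ℓ : ℝ}
    (H : Admissible M W₁ W₂ ψ₁ ψM c (ℓ / L)) {q : Fin M} {u : ℝ → Fin M → ℝ}
    (hu : IsTwisted (cost M ψ₁ ψM (ℓ / L)) L (ℓ / L) q u) {η : ℝ} (hη : 0 < η) :
    ∀ᶠ n in atTop ⊓ 𝓟 {n : ℕ | n % M = q}, ∃ w : ℝ → ℝ,
      renormEnergy M ψ₁ ψM L ℓ n w ≤ ((interfaceEnergy M ψ₁ ψM L ℓ u + η : ℝ) : EReal) ∧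
      ∀ k, ∀ t ∈ Ioo 0 L, |interpolation M L n w k t - u t k| ≤ η := by
  have hG := H.isWellCost
  have := hG.neZero
  have hL := hu.L_pos
  set α := ℓ / L with hα
  have hfin : (jumpSet u ∩ Ioc 0 L).Finite := (hu.pa.finite_jumpSet 0 L).subset
    (inter_subset_inter_right _ Ioc_subset_Icc_self)
  unfold interfaceEnergy
  rw [finsum_mem_eq_finite_toFinset_sum _ hfin]
  set J := hfin.toFinset with hJdef
  have hJ : ∀ t, t ∈ J ↔ t ∈ jumpSet u ∩ Ioc 0 L := fun t => hfin.mem_toFinset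
  obtain ⟨N, e, R₁, hconn, heR₁, hE⟩ := exists_transitions hG hu J
    (η := η / (3 * (J.card + 1))) (by positivity)
  obtain ⟨R₀, hR₀, hzR₀, hint, hftc⟩ := hu.exists_slope_bound hG
  obtain ⟨σ, hσ, hsep⟩ := hu.exists_separation
  have he : ∀ t ∈ jumpSet u ∩ Ioc 0 L, Connects N (leftSlope u t) (rightSlope u t) (e t) :=
    fun t ht => hconn t ((hJ t).2 ht)
  set R := max R₀ R₁ with hR
  have hzR : ∀ z, cost M ψ₁ ψM α z = 0 → ∀ k, |z k| ≤ R := fun z hz k =>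
    (hzR₀ z hz k).trans (le_max_left _ _)
  have heR : ∀ t ∈ jumpSet u ∩ Ioc 0 L, ∀ i, |e t i| ≤ R := fun t ht i =>
    (heR₁ t ((hJ t).2 ht) i).trans (le_max_right _ _)
  have hLip : ∀ a b k, |u b k - u a k| ≤ R * |b - a| := by
    intro a b k
    rw [hftc, ← Real.norm_eq_abs]
    exact intervalIntegral.norm_integral_le_of_norm_le_const fun s _ => hzR _ (hu.zero_right s) k
  set Λ := ∑ _t ∈ J, ∑ _x ∈ Finset.Ioo (-(N + 3 * M : ℤ)) (N + 3 * M), 2 * R with hΛ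
  have hΛ0 : 0 ≤ Λ := Finset.sum_nonneg fun _ _ => Finset.sum_nonneg fun _ _ =>
    mul_nonneg zero_le_two (hR₀.trans (le_max_left _ _))
  -- With this `κ` the correction costs at most `n κ |r| + κ ≤ κ (Λ + 1) = η/3`, since `n |r| ≤ Λ`;
  -- the inserted transitions lose another `η/3` at most.
  obtain ⟨ρ, hρ, hcost⟩ := hu.exists_sum_cost_le (N := N) (e := e) hG hsep he hJ
    (κ := η / (3 * (Λ + 1))) (by positivity)
  have hΛn : Tendsto (fun n : ℕ => Λ / n) atTop (𝓝 0) :=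
    tendsto_const_nhds.div_atTop tendsto_natCast_atTop_atTop
  have hfine : ∀ᶠ n : ℕ in atTop, (2 * N + 7 * M) * eps L n < σ := by
    have := (tendsto_eps_atTop L).const_mul (2 * (N : ℝ) + 7 * M)
    rw [mul_zero] at this
    exact this.eventually (gt_mem_nhds hσ)
  have hconv : ∀ᶠ n : ℕ in atTop, ∀ k : Fin M, (∫ s in (0 : ℝ)..L,
      |splice hu.L_pos n u e (N + 2 * M) (M * ⌊s / (M * eps L n)⌋ + ((k : ℕ) : ℤ)) -
        rightSlope u s k|) < η / 2 := by
    rw [eventually_all]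
    exact fun k => (hu.tendsto_integral_splice hzR heR N k).eventually
      (gt_mem_nhds (half_pos hη))
  refine eventually_inf_principal.2 ?_
  filter_upwards [eventually_ne_atTop 0, hfine, hconv, hΛn.eventually (gt_mem_nhds hρ),
    hΛn.eventually (gt_mem_nhds (show 0 < η / (2 * L) by positivity))] with n hn hfine hconv h1 h2 hq
  replace hq : n % M = q := hq
  have hnR : (0 : ℝ) < n := by exact_mod_cast Nat.pos_of_ne_zero hn
  have hMε : 0 < M * eps L n :=
    mul_pos (by exact_mod_cast Nat.pos_of_ne_zero (NeZero.ne M)) (eps_pos hL hn)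
  set d := splice hu.L_pos n u e (N + 2 * M) with hd
  have hdR : ∀ i, |d i| ≤ R := hu.abs_splice_le hzR heR _
  have hdper : ∀ i, d (i + n) = d i := hu.splice_add hn hq hsep hfine.le
  have hdsum := hu.abs_sum_splice_sub_le hG hn hq hsep hfine.le he (fun t => (hJ t).2) hzR heR hLip
  rw [← hd, ← hΛ] at hdsum
  -- The constant that makes the sum of the slopes over a period exactly `n α`, as the boundary
  -- condition requires.
  set r := (n * α - ∑ i ∈ Finset.range n, d i) / n with hr
  have hrΛ : |r| ≤ Λ / n := by
    rw [hr, abs_div, abs_of_pos hnR, abs_sub_comm]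
    exact div_le_div_of_nonneg_right hdsum hnR.le
  have hmem : latticePrimitive (eps L n) (fun i => d i + r) (u 0 0) ∈ discreteSpace L ℓ n := by
    refine latticePrimitive_mem_discreteSpace hL hn (R := R + |r|)
      (fun i => (abs_add_le _ _).trans (add_le_add (hdR i) le_rfl)) (fun i => by rw [hdper]) ?_
    rw [Finset.sum_add_distrib, Finset.sum_const, Finset.card_range, nsmul_eq_mul, hr, ← hα]
    field_simp; ring
  refine ⟨latticePrimitive (eps L n) (fun i => d i + r) (u 0 0), ?_, fun k t ht => ?_⟩
  · rw [H.renormEnergy_eq hL hn hmem, latticeSlope_latticePrimitive hL hn, EReal.coe_le_coe_iff]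
    refine (hcost n hn hq hfine.le r (hrΛ.trans h1.le)).trans ?_
    have h3 := Finset.sum_le_sum hE
    rw [Finset.sum_add_distrib, Finset.sum_const, nsmul_eq_mul] at h3
    have h4 : J.card * (η / (3 * (J.card + 1))) ≤ η / 3 := by
      rw [mul_div_assoc', div_le_div_iff₀ (by positivity) (by positivity)]
      nlinarith
    have h5 : n * (η / (3 * (Λ + 1)) * |r|) + η / (3 * (Λ + 1)) ≤ η / 3 := by
      have h6 : n * |r| ≤ Λ := by rwa [le_div_iff₀' hnR] at hrΛ
      have h7 : η / (3 * (Λ + 1)) * (Λ + 1) = η / 3 := by field_simp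
      rw [← h7]
      have : 0 < η / (3 * (Λ + 1)) := by positivity
      nlinarith
    linarith
  · have hx : node L n (latticePrimitive (eps L n) (fun i => d i + r) (u 0 0)) 0 = u 0 0 := by
      unfold node; rw [Int.cast_zero, mul_zero, latticePrimitive_zero]
    rw [interpolation_eq, latticeSlope_latticePrimitive hL hn, hx, hu.apply_zero 0 k]
    have hstep := intervalIntegrable_step (fun I => d (M * I + ((k : ℕ) : ℤ))) hMε
    have h3 : blockInterp M (eps L n) (fun i => d i + r) (u 0 k) k t - u t k =
        ∫ s in (0 : ℝ)..t, (d (M * ⌊s / (M * eps L n)⌋ + ((k : ℕ) : ℤ)) - rightSlope u s k + r) := by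
      have h4 := hftc 0 t k
      rw [intervalIntegral.integral_add ((hstep _ _).sub (hint _ _ _)) (by simp),
        intervalIntegral.integral_sub (hstep _ _) (hint _ _ _), ← h4]
      unfold blockInterp
      rw [intervalIntegral.integral_add (hstep _ _) (by simp)]
      ring
    rw [h3]
    have hF : ∀ a b, IntervalIntegrable (fun s =>
        |d (M * ⌊s / (M * eps L n)⌋ + ((k : ℕ) : ℤ)) - rightSlope u s k|) volume a b := fun a b =>
      ((hstep a b).sub (hint a b k)).abs
    calc |∫ s in (0 : ℝ)..t, (d (M * ⌊s / (M * eps L n)⌋ + ((k : ℕ) : ℤ)) - rightSlope u s k + r)|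
        ≤ ∫ s in (0 : ℝ)..t,
            |d (M * ⌊s / (M * eps L n)⌋ + ((k : ℕ) : ℤ)) - rightSlope u s k + r| :=
          intervalIntegral.abs_integral_le_integral_abs ht.1.le
      _ ≤ ∫ s in (0 : ℝ)..t,
            (|d (M * ⌊s / (M * eps L n)⌋ + ((k : ℕ) : ℤ)) - rightSlope u s k| + |r|) :=
          intervalIntegral.integral_mono_on ht.1.le
            (((hstep _ _).sub (hint _ _ k)).add (by simp)).abs ((hF _ _).add (by simp))
            fun s _ => abs_add_le _ _
      _ ≤ ∫ s in (0 : ℝ)..L,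
            (|d (M * ⌊s / (M * eps L n)⌋ + ((k : ℕ) : ℤ)) - rightSlope u s k| + |r|) :=
          intervalIntegral.integral_mono_interval le_rfl ht.1.le ht.2.le
            (Eventually.of_forall fun s => by positivity) ((hF _ _).add (by simp))
      _ ≤ η := by
          rw [intervalIntegral.integral_add (hF _ _) (by simp), intervalIntegral.integral_const,
            sub_zero, smul_eq_mul]
          have h4 := hconv k
          have h5 : L * |r| ≤ L * (η / (2 * L)) :=
            mul_le_mul_of_nonneg_left (hrΛ.trans h2.le) hL.le
          have h6 : L * (η / (2 * L)) = η / 2 := by field_simp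
          linarith


/-! ### Recovery sequences -/

/-- For each `n` the largest level `m ≤ n` that can be realized is chosen. Every fixed level can be
realized eventually, so the chosen levels eventually exceed it; no monotonicity in `m` is needed. -/
theorem exists_diagonal {X : Type*} [Nonempty X] {l : Filter ℕ} (hl : l ≤ atTop)
    {P : ℕ → ℕ → X → Prop} (hP : ∀ m, ∀ᶠ n in l, ∃ x, P m n x) :
    ∃ x : ℕ → X, ∀ m, ∀ᶠ n in l, ∃ m' ≥ m, P m' n (x n) := by
  classical
  let f : ℕ → ℕ := fun n => Nat.findGreatest (fun m => ∃ x, P m n x) n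
  refine ⟨fun n => if h : ∃ x, P (f n) n x then h.choose else Classical.arbitrary X, fun m => ?_⟩
  filter_upwards [hP m, hl (eventually_ge_atTop m)] with n h1 h2
  have h3 : ∃ x, P (f n) n x := Nat.findGreatest_spec (P := fun m => ∃ x, P m n x) h2 h1
  refine ⟨f n, Nat.le_findGreatest (P := fun m => ∃ x, P m n x) h2 h1, ?_⟩
  rw [dif_pos h3]
  exact h3.choose_spec

/-- An element of the limit domain is determined by its restriction to a period. -/
theorem IsTwisted.eq_of_ae_eq {M : ℕ} {G : (Fin M → ℝ) → ℝ} {L α : ℝ} {q : Fin M}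
    {u v : ℝ → Fin M → ℝ} (hG : IsWellCost G) (hu : IsTwisted G L α q u)
    (hv : IsTwisted G L α q v) (h : ∀ᵐ t ∂(volume.restrict (Ioo 0 L)), u t = v t) : u = v := by
  have := hG.neZero
  have hL := hu.L_pos
  have hEq : EqOn u v (Icc 0 L) := by
    refine Measure.eqOn_Icc_of_ae_eq (μ := volume) hL.ne ?_ hu.pa.1.continuousOn
      hv.pa.1.continuousOn
    rwa [← Measure.restrict_congr_set Ioo_ae_eq_Icc]
  have hslope : ∀ t ∈ Ico 0 L, rightSlope u t = rightSlope v t := by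
    intro t ht
    refine EventuallyEq.derivWithin_eq ?_ (hEq ⟨ht.1, ht.2.le⟩)
    filter_upwards [Ioo_mem_nhdsGT ht.2] with s hs
    exact hEq ⟨ht.1.trans hs.1.le, hs.2.le⟩
  have hslope' : ∀ t, rightSlope u t = rightSlope v t := by
    intro t
    have h1 := toIcoMod_mem_Ico hL 0 t
    rw [zero_add] at h1
    have h2 : t = toIcoMod hL 0 t + toIcoDiv hL 0 t * L := by
      have := toIcoMod_add_toIcoDiv_zsmul hL 0 t
      rw [zsmul_eq_mul] at this
      exact this.symm
    -- The translation rule for patterns applies with `n = q`. Evaluating at the index `k` minus `q`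
    -- times the number of periods then isolates the `k`-th entry of the slope at `t`.
    have hq : (q : ℕ) % M = q := Nat.mod_eq_of_lt q.2
    funext k
    have h3 := hu.per_right hq (toIcoMod hL 0 t) (toIcoDiv hL 0 t)
      (((k : ℕ) : ℤ) - toIcoDiv hL 0 t * (q : ℕ))
    have h4 := hv.per_right hq (toIcoMod hL 0 t) (toIcoDiv hL 0 t)
      (((k : ℕ) : ℤ) - toIcoDiv hL 0 t * (q : ℕ))
    rw [sub_add_cancel, ← h2, per_coe] at h3 h4
    rw [h3, h4, hslope _ h1]
  obtain ⟨-, -, -, -, h1⟩ := hu.exists_slope_bound hG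
  obtain ⟨-, -, -, -, h2⟩ := hv.exists_slope_bound hG
  funext t k
  have h3 := h1 0 t k
  have h4 := h2 0 t k
  simp_rw [hslope'] at h3
  rw [← h4, hEq ⟨le_rfl, hL.le⟩] at h3
  linarith

/-- A finite limit value means that `v` is the restriction of some `u` in the domain. Uniqueness of
`u` bounds the infimum from below by its interface energy, and the approximations with errors `1/(m
+ 1)` are combined diagonally. -/
theorem Admissible.exists_recovery {M : ℕ} {W₁ W₂ ψ₁ ψM : ℝ → ℝ} {c L ℓ : ℝ}
    (H : Admissible M W₁ W₂ ψ₁ ψM c (ℓ / L)) (hL : 0 < L) (q : Fin M) {v : ℝ → Fin M → ℝ}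
    (hv : limitEnergy M ψ₁ ψM L ℓ q v ≠ ⊤) :
    ∃ u : ℕ → ℝ → ℝ, InterpConverges M L (atTop ⊓ 𝓟 {n : ℕ | n % M = q}) u v ∧
      limsup (fun n => renormEnergy M ψ₁ ψM L ℓ n (u n)) (atTop ⊓ 𝓟 {n : ℕ | n % M = q}) ≤
        limitEnergy M ψ₁ ψM L ℓ q v := by
  have hG := H.isWellCost
  have hZ := H.minimalSlopes_eq
  obtain ⟨u, hu, hae⟩ : ∃ u ∈ limitDomain M ψ₁ ψM L ℓ q,
      ∀ᵐ t ∂(volume.restrict (Ioo 0 L)), v t = u t := by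
    by_contra hno
    exact hv (iInf₂_eq_top.2 fun u hu => absurd ⟨u, hu.1, hu.2⟩ hno)
  have htw := isTwisted_of_mem_limitDomain hL hZ hu
  have hle : ((interfaceEnergy M ψ₁ ψM L ℓ u : ℝ) : EReal) ≤ limitEnergy M ψ₁ ψM L ℓ q v := by
    refine le_iInf₂ fun u' hu' => ?_
    have htw' := isTwisted_of_mem_limitDomain hL hZ hu'.1
    have : u = u' := htw.eq_of_ae_eq hG htw' (by
      filter_upwards [hae, hu'.2] with t h1 h2
      rw [← h1, h2])
    rw [this]
  obtain ⟨w, hw⟩ := exists_diagonal inf_le_left fun m : ℕ =>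
    H.eventually_exists_near htw (Nat.one_div_pos_of_nat (α := ℝ) (n := m))
  refine ⟨w, fun k => ?_, le_trans ?_ hle⟩
  · rw [ENNReal.tendsto_nhds_zero]
    intro δ hδ
    have h1 : Tendsto (fun m : ℕ => ENNReal.ofReal (1 / ((m : ℝ) + 1))) atTop (𝓝 0) := by
      rw [← ENNReal.ofReal_zero]
      exact ENNReal.tendsto_ofReal tendsto_one_div_add_atTop_nhds_zero_nat
    obtain ⟨m, hm⟩ := (ENNReal.tendsto_nhds_zero.1 h1 δ hδ).exists
    filter_upwards [hw m] with n hn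
    obtain ⟨m', hm', -, h2⟩ := hn
    refine le_trans ?_ hm
    rw [eLpNorm_exponent_top]
    refine eLpNormEssSup_le_of_ae_bound ?_
    filter_upwards [hae, ae_restrict_mem measurableSet_Ioo] with t h3 h4
    rw [h3, Real.norm_eq_abs]
    exact (h2 k t h4).trans (Nat.one_div_le_one_div hm')
  · have h1 : Tendsto (fun m : ℕ =>
        ((interfaceEnergy M ψ₁ ψM L ℓ u + 1 / ((m : ℝ) + 1) : ℝ) : EReal)) atTop
        (𝓝 ((interfaceEnergy M ψ₁ ψM L ℓ u : ℝ) : EReal)) := by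
      refine (continuous_coe_real_ereal.tendsto _).comp ?_
      simpa using tendsto_one_div_add_atTop_nhds_zero_nat.const_add
        (interfaceEnergy M ψ₁ ψM L ℓ u)
    refine ge_of_tendsto h1 (Eventually.of_forall fun m => limsup_le_of_le (by isBoundedDefault) ?_)
    filter_upwards [hw m] with n hn
    obtain ⟨m', hm', h2, -⟩ := hn
    refine h2.trans ?_
    rw [EReal.coe_le_coe_iff]
    have := Nat.one_div_le_one_div (α := ℝ) hm'
    linarith

end LatticeGamma

theorem mainTheorem1
    (M : ℕ) (hM : 2 ≤ M) (L ℓ : ℝ) (hL : 0 < L)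
    (W₁ W₂ ψ₁ ψM : ℝ → ℝ)
    (hψ₁ : ∀ z, ψ₁ z = min (W₁ z) (W₂ z))
    (hψ₁_nonneg : ∀ z, 0 ≤ ψ₁ z) (hψM_nonneg : ∀ z, 0 ≤ ψM z)
    (hW₁ : StrictConvexOn ℝ Set.univ W₁) (hW₂ : StrictConvexOn ℝ Set.univ W₂)
    (c : ℝ) (hc : 0 < c)
    (hW₁_growth : ∀ z, c * z ^ 2 - 1 / c ≤ W₁ z)
    (hW₂_growth : ∀ z, c * z ^ 2 - 1 / c ≤ W₂ z)
    (hψM : StrictConvexOn ℝ Set.univ ψM) (hψM_C1 : ContDiff ℝ 1 ψM)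
    (hψ₁_C1 : ∀ z ∈ LatticeGamma.minimalSlopes M ψ₁ ψM (ℓ / L), ∀ k : Fin M,
      ContDiffAt ℝ 1 ψ₁ (z k))
    (hdiff : DifferentiableAt ℝ (LatticeGamma.psiZeroConv M ψ₁ ψM) (ℓ / L))
    (q : Fin M) :
    LatticeGamma.GammaConverges
      (Filter.atTop ⊓ Filter.principal {n : ℕ | n % M = q})
      (LatticeGamma.InterpConverges M L
        (Filter.atTop ⊓ Filter.principal {n : ℕ | n % M = q}))
      (LatticeGamma.renormEnergy M ψ₁ ψM L ℓ)
      (LatticeGamma.limitEnergy M ψ₁ ψM L ℓ q) := by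
  have H : LatticeGamma.Admissible M W₁ W₂ ψ₁ ψM c (ℓ / L) :=
    ⟨hM, hψ₁, hψ₁_nonneg, hψM_nonneg, hW₁, hW₂, hc, hW₁_growth, hW₂_growth, hψM, hψM_C1, hψ₁_C1,
      hdiff⟩
  exact ⟨fun _ _ h => H.limitEnergy_le_liminf hL q h, fun _ h => H.exists_recovery hL q h⟩
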